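/- **Setting.** Let $p\ge 1$ be an integer and let $f,g:\mathbb R^{d_x}\times\mathbb R^{d_y}\to\mathbb R$ be differentiable. Norms are Euclidean (operator norms for matrices and tensors). Let $L_0,\dots,L_{p+1}>0$, $0<\mu\le L_1$, $\Delta>0$, and let $x_0\in\mathbb R^{d_x}$. The pair $(f,g)$ belongs to the class $\mathcal F^{\text{nc-sc}}(L_0,\dots,L_{p+1},\mu,\Delta)$ if * $g(x,\cdot)$ is $\mu$-strongly convex for every $x$; write $y^*(x)=\arg\min_y g(x,y)$ and $\varphi(x)=f(x,y^*(x))$; * $\inf\varphi>-\infty$ and $\varphi(x_0)-\inf\varphi\le\Delta$; * $f$ is $L_0$-Lipschitz in $y$; $\nabla f$ and $\nabla g$ are $L_1$-Lipschitz in $(x,y)$; $\nabla^2_{xy}g$ and $\nabla^2_{yy}g$ exist and are $L_2$-Lipschitz in $(x,y)$; * for $q=1,\dots,p-1$, $\frac{\partial^q}{\partial y^q}\nabla f$ exists and is $L_{q+1}$-Lipschitz in $y$, and $\frac{\partial^{q+1}}{\partial y^{q+1}}\nabla g$ exists and is $L_{q+2}$-Lipschitz in $y$. Put $\bar L=\max_{0\le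 j\le p+1}L_j$ and $\kappa=\bar L/\mu$. Only stochastic gradients $F(x,y;s)=(F_x,F_y)$ of $f$ and $G(x,y;s)=(G_x,G_y)$ of $g$ are available. They are unbiased, with $\mathbb E\|F-\nabla f\|^2\le\sigma^2$ and $\mathbb E\|G-\nabla g\|^2\le\sigma^2$, $\sigma>0$. One evaluation of $F$ or of $G$ is one SFO call. **Algorithm F²SA-$p$.** Let $J=\{-p/2,\dots,p/2\}$ if $p$ is even and $J=\{0,\dots,p\}$ if $p$ is odd. Let $(\alpha_j)_{j\in J}$ be the finite difference coefficients, i.e. the unique solution of $\sum_{j\in J}\alpha_j j^k=\mathbf 1_{k=1}$ for $k=0,\dots,p$ (with $0^0=1$). The inputs are $x_0$, $y_0$, $\nu,\eta_x,\eta_y>0$ and $S,K,T\in\mathbb N$. Set $y_0^j=y_0$ for $j\in J$. For $t=0,\dots,T-1$: 1. for each $j\in J$ set $y_t^{j,0}=y_t^j$; for $k=0,\dots,K-1$ put $y_t^{j,k+1}=y_t^{j,k}-\eta_y\big(j\nu F_y(x_t,y_t^{j,k};s)+G_y(x_t,y_t^{j,k};s)\big)$, with a fresh sample $s$ for every $(t,j,k)$;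 set $y_{t+1}^j=y_t^{j,K}$; 2. draw a fresh batch $s_1,\dots,s_S$ and put $\Phi_t=\frac1S\sum_{i=1}^S\sum_{j\in J}\alpha_j\big(jF_x(x_t,y_{t+1}^j;s_i)+\tfrac1\nu G_x(x_t,y_{t+1}^j;s_i)\big)$; 3. put $x_{t+1}=x_t-\eta_x\Phi_t/\|\Phi_t\|$ (no move if $\Phi_t=0$). All samples are i.i.d. **Theorem.** For every $p\ge1$ there are constants $c_\nu,c_x,c_y,c_S,c_K,c_T,C>0$, depending only on $p$, with the following property. Take any instance in $\mathcal F^{\text{nc-sc}}(L_0,\dots,L_{p+1},\mu,\Delta)$ with stochastic gradients as above, any $y_0$, any $R\ge\|y_0-y^*(x_0)\|$ and any $\epsilon>0$. Put $\nu_0=\big(\epsilon/(\bar L\kappa^{2p+1})\big)^{1/p}$ and assume $$\epsilon\le\bar L\kappa,\qquad \kappa\,\nu_0\le R,\qquad \nu_0^2\epsilon^2\le\kappa\sigma^2 .$$ Run F²SA-$p$ with $$\nu=c_\nu\min\Big\{\frac R\kappa,\Big(\frac{\epsilon}{\bar L\kappa^{2p+1}}\Big)^{1/p}\Big\},\quad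 \eta_x=c_x\frac{\epsilon}{L_1\kappa^3},\quad \eta_y=c_y\frac{\nu^2\epsilon^2}{L_1\kappa\sigma^2},$$ $$S=\Big\lceil c_S\frac{\sigma^2}{\nu^2\epsilon^2}\Big\rceil,\quad K=\Big\lceil c_K\frac{\kappa^2\sigma^2}{\nu^2\epsilon^2}\log\Big(\frac{RL_1\kappa}{\nu\epsilon}\Big)\Big\rceil,\quad T=\Big\lceil c_T\frac{\Delta}{\eta_x\epsilon}\Big\rceil .$$ Then $\varphi$ is differentiable, and a uniformly random iterate is an $\epsilon$-stationary point of $\varphi$ in expectation: $$\frac1T\sum_{t=0}^{T-1}\mathbb E\|\nabla\varphi(x_t)\|\le\epsilon .$$ The number of SFO calls is at most $4pT(S+K)$. If moreover $\epsilon^2\le\Delta L_1\kappa^3$, then $$pT(S+K)\le C\,\frac{p\,\Delta L_1\bar L^{2/p}\sigma^2\kappa^{9+2/p}}{\epsilon^{4+2/p}}\log\Big(\frac{RL_1\kappa}{\nu\epsilon}\Big),$$ and if in addition $\epsilon\le\min\{\tfrac12,\;RL_1,\;(RL_1\bar L)^2\}$, then $$pT(S+K)\le C\,\frac{p\,\Delta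 L_1\bar L^{2/p}\sigma^2\kappa^{9+2/p}}{\epsilon^{4+2/p}}\log\Big(\frac{RL_1\bar L\kappa}{\epsilon}\Big).$$ -/

import Mathlib

open MeasureTheory ProbabilityTheory

noncomputable section

namespace Bilevel

/-- `ℝ^d` with the Euclidean norm. -/
abbrev Vec (d : ℕ) : Type := EuclideanSpace ℝ (Fin d)

/-- `ℝ^dx × ℝ^dy` with the Euclidean norm of `ℝ^(dx+dy)`. -/
abbrev Joint (dx dy : ℕ) : Type := WithLp 2 (Vec dx × Vec dy)

/-- The point `(x, y)` of `ℝ^(dx+dy)`. -/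
def pair {dx dy : ℕ} (x : Vec dx) (y : Vec dy) : Joint dx dy := WithLp.toLp 2 (x, y)

/-! ### Gradients, the lower-level solution and the hyper-objective -/

/-- `∇ₓ f (x, y)`. -/
def gradX {dx dy : ℕ} (f : Vec dx → Vec dy → ℝ) (x : Vec dx) (y : Vec dy) : Vec dx :=
  gradient (fun u => f u y) x

/-- `∇_y f (x, y)`. -/
def gradY {dx dy : ℕ} (f : Vec dx → Vec dy → ℝ) (x : Vec dx) (y : Vec dy) : Vec dy :=
  gradient (fun v => f x v) y

/-- The full gradient `∇ f (x, y) = (∇ₓ f (x, y), ∇_y f (x, y))`. -/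
def grad {dx dy : ℕ} (f : Vec dx → Vec dy → ℝ) (x : Vec dx) (y : Vec dy) : Joint dx dy :=
  pair (gradX f x y) (gradY f x y)

/-- `y*(x)`, a minimizer of `g (x, ·)` (it exists and is unique when `g (x, ·)` is differentiable
and strongly convex). -/
def lowerSol {dx dy : ℕ} (g : Vec dx → Vec dy → ℝ) (x : Vec dx) : Vec dy :=
  Classical.epsilon (fun y => ∀ z, g x y ≤ g x z)

/-- The hyper-objective `φ(x) = f (x, y*(x))`. -/
def hyperObj {dx dy : ℕ} (f g : Vec dx → Vec dy → ℝ) (x : Vec dx) : ℝ :=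
  f x (lowerSol g x)

/-! ### The problem class -/

/-- `p`-th-order smooth nonconvex--strongly-convex bilevel instances `(f, g)`, with initial
point `x₀`: the class `F^{nc-sc}(L_0, …, L_{p+1}, μ, Δ)`. -/
structure ProblemClass {dx dy : ℕ} (p : ℕ) (L : ℕ → ℝ) (μ Δ : ℝ)
    (f g : Vec dx → Vec dy → ℝ) (x₀ : Vec dx) : Prop where
  L_pos : ∀ j ≤ p + 1, 0 < L j
  μ_pos : 0 < μ
  μ_le : μ ≤ L 1
  Δ_pos : 0 < Δ
  /-- `φ` is bounded below, with initial gap at most `Δ` -/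
  bddBelow : BddBelow (Set.range (hyperObj f g))
  gap : hyperObj f g x₀ - ⨅ x, hyperObj f g x ≤ Δ
  f_diff : Differentiable ℝ (fun z : Vec dx × Vec dy => f z.1 z.2)
  g_diff : Differentiable ℝ (fun z : Vec dx × Vec dy => g z.1 z.2)
  /-- `g` is `μ`-strongly convex in `y` -/
  strongConvex : ∀ x y₁ y₂,
    g x y₁ + inner ℝ (gradY g x y₁) (y₂ - y₁) + μ / 2 * ‖y₁ - y₂‖ ^ 2 ≤ g x y₂
  /-- `f` is `L_0`-Lipschitz in `y` -/
  f_lip : ∀ x y y', |f x y - f x y'| ≤ L 0 * ‖y - y'‖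
  /-- `∇f` and `∇g` are `L_1`-Lipschitz, jointly in `(x, y)` -/
  gradf_lip : ∀ x y x' y', ‖grad f x y - grad f x' y'‖ ≤ L 1 * ‖pair x y - pair x' y'‖
  gradg_lip : ∀ x y x' y', ‖grad g x y - grad g x' y'‖ ≤ L 1 * ‖pair x y - pair x' y'‖
  /-- the second derivatives `∇²_{xy} g` and `∇²_{yy} g` exist and are `L_2`-Lipschitz, jointly
  in `(x, y)` -/
  gradYg_diff : Differentiable ℝ (fun z : Vec dx × Vec dy => gradY g z.1 z.2)
  hessxy_lip : ∀ x y x' y',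
    ‖fderiv ℝ (fun u => gradY g u y) x - fderiv ℝ (fun u => gradY g u y') x'‖
      ≤ L 2 * ‖pair x y - pair x' y'‖
  hessyy_lip : ∀ x y x' y',
    ‖fderiv ℝ (fun v => gradY g x v) y - fderiv ℝ (fun v => gradY g x' v) y'‖
      ≤ L 2 * ‖pair x y - pair x' y'‖
  /-- `∂^q/∂y^q ∇f` exists and is `L_{q+1}`-Lipschitz in `y`, for `q = 1, …, p - 1` -/
  f_high_diff : ∀ x, ContDiff ℝ ((p - 1 : ℕ) : WithTop ℕ∞) (grad f x)
  f_high_lip : ∀ q, 1 ≤ q → q ≤ p - 1 → ∀ x y y',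
    ‖iteratedFDeriv ℝ q (grad f x) y - iteratedFDeriv ℝ q (grad f x) y'‖
      ≤ L (q + 1) * ‖y - y'‖
  /-- `∂^(q+1)/∂y^(q+1) ∇g` exists and is `L_{q+2}`-Lipschitz in `y`, for `q = 1, …, p - 1` -/
  g_high_diff : ∀ x, ContDiff ℝ (p : WithTop ℕ∞) (grad g x)
  g_high_lip : ∀ q, 1 ≤ q → q ≤ p - 1 → ∀ x y y',
    ‖iteratedFDeriv ℝ (q + 1) (grad g x) y - iteratedFDeriv ℝ (q + 1) (grad g x) y'‖
      ≤ L (q + 2) * ‖y - y'‖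

/-- The largest smoothness constant `max (L_0, …, L_{p+1})`. -/
def Lbar (p : ℕ) (L : ℕ → ℝ) : ℝ :=
  (Finset.range (p + 2)).sup' ⟨0, Finset.mem_range.2 (Nat.succ_pos _)⟩ L

/-- The condition number `κ = Lbar / μ`. -/
def cond (p : ℕ) (L : ℕ → ℝ) (μ : ℝ) : ℝ := Lbar p L / μ

/-! ### Stochastic first-order oracles -/

/-- `F (x, y; s)`, with `s` drawn from `D`, is an unbiased estimator of `∇f (x, y)` with variance
at most `σ²`. -/
structure IsGradEstimator {dx dy : ℕ} {𝒮 : Type*} [MeasurableSpace 𝒮] (D : Measure 𝒮) (σ : ℝ)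
    (f : Vec dx → Vec dy → ℝ) (F : Vec dx → Vec dy → 𝒮 → Joint dx dy) : Prop where
  measurable : Measurable (fun z : Vec dx × Vec dy × 𝒮 => F z.1 z.2.1 z.2.2)
  integrable : ∀ x y, Integrable (F x y) D
  unbiased : ∀ x y, ∫ s, F x y s ∂D = grad f x y
  integrable_sq : ∀ x y, Integrable (fun s => ‖F x y s - grad f x y‖ ^ 2) D
  variance_le : ∀ x y, ∫ s, ‖F x y s - grad f x y‖ ^ 2 ∂D ≤ σ ^ 2

/-! ### Finite difference coefficients -/

/-- The nodes of the `p`-th-order difference formula: `-p/2, …, p/2` (central) for even `p`, and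
`0, …, p` (forward) for odd `p`. -/
def nodes (p : ℕ) : Finset ℤ :=
  if Even p then Finset.Icc (-(p / 2 : ℤ)) (p / 2 : ℤ) else Finset.Icc 0 (p : ℤ)

/-- The `p`-th-order finite difference coefficients on `nodes p`: the derivatives at `0` of the
Lagrange basis polynomials. They are characterized by `sum_fdCoeff_mul_pow`. -/
def fdCoeff (p : ℕ) (j : ℤ) : ℝ :=
  (Polynomial.derivative (Lagrange.basis (nodes p) (fun i : ℤ => (i : ℝ)) j)).eval 0

theorem card_nodes (p : ℕ) : (nodes p).card = p + 1 := by
  unfold nodes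
  split_ifs with h
  · obtain ⟨m, rfl⟩ := h
    simp only [Int.card_Icc]
    omega
  · simp

/-- The defining linear system of the coefficients: `p + 1` equations for `p + 1` unknowns, with a
Vandermonde matrix. -/
theorem sum_fdCoeff_mul_pow (p k : ℕ) (hk : k ≤ p) :
    ∑ j ∈ nodes p, fdCoeff p j * (j : ℝ) ^ k = if k = 1 then 1 else 0 := by
  have hinj : Set.InjOn (fun i : ℤ => (i : ℝ)) (nodes p) := fun a _ b _ h =>
    Int.cast_injective h
  have hdeg : (Polynomial.X ^ k : Polynomial ℝ).degree < (nodes p).card := by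
    rw [Polynomial.degree_X_pow, card_nodes]
    exact_mod_cast Nat.lt_succ_of_le hk
  have h := Lagrange.eq_interpolate hinj hdeg
  have h2 := congrArg (fun q => (Polynomial.derivative q).eval (0 : ℝ)) h
  simp only [Lagrange.interpolate_apply, Polynomial.derivative_sum,
    Polynomial.derivative_C_mul, Polynomial.eval_finsetSum, Polynomial.eval_mul,
    Polynomial.eval_C, Polynomial.eval_pow, Polynomial.eval_X] at h2
  have h3 : ∑ j ∈ nodes p, fdCoeff p j * (j : ℝ) ^ k
      = (Polynomial.derivative (Polynomial.X ^ k : Polynomial ℝ)).eval 0 := by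
    rw [h2]
    exact Finset.sum_congr rfl fun j _ => by rw [fdCoeff, mul_comm]
  rw [h3, Polynomial.derivative_X_pow]
  rcases k with _ | _ | k <;> simp

/-! ### The algorithm -/

/-- Hyper-parameters: the difference step `ν`, the step sizes of the outer and of the inner loop,
the batch size `S` and the numbers `K`, `T` of inner and of outer iterations. -/
structure Params where
  ν : ℝ
  ηx : ℝ
  ηy : ℝ
  S : ℕ
  K : ℕ
  T : ℕ

/-- The indices of the samples that the algorithm draws: `inner t j k` for step `k` of the inner
loop on the `j`-th lower-level problem in outer iteration `t`, and `batch t i` for the `i`-th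
member of the batch of outer iteration `t`. -/
inductive SampleIdx where
  | inner (t : ℕ) (j : ℤ) (k : ℕ)
  | batch (t i : ℕ)

/-- The state of the algorithm, with a counter of the stochastic first-order oracle calls (one
call is one evaluation of `F` or of `G` at one point). Only the `y j` with `j ∈ nodes p` are ever
computed; the others are never read. -/
structure State (dx dy : ℕ) where
  x : Vec dx
  y : ℤ → Vec dy
  calls : ℕ

section Algorithm

variable {dx dy : ℕ} {𝒮 : Type*} (F G : Vec dx → Vec dy → 𝒮 → Joint dx dy)

/-- `k` steps of single-sample SGD on `j ν f (x, ·) + g (x, ·)` from `y`, with step size `ηy`,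
together with the number of oracle calls made. -/
def innerLoop (h : Params) (j : ℤ) (x : Vec dx) (s : ℕ → 𝒮) (y : Vec dy) : ℕ → Vec dy × ℕ
  | 0 => (y, 0)
  | k + 1 =>
    let r := innerLoop h j x s y k
    (r.1 - h.ηy • (((j : ℝ) * h.ν) • (F x r.1 (s k)).snd + (G x r.1 (s k)).snd), r.2 + 2)

/-- The hyper-gradient estimator
`Φ = 1/S ∑_i ∑_j α_j (j Fₓ(x, y^j; s_i) + Gₓ(x, y^j; s_i) / ν)`. -/
def hyperGradEst (p : ℕ) (h : Params) (x : Vec dx) (y : ℤ → Vec dy) (s : ℕ → 𝒮) : Vec dx :=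
  (1 / (h.S : ℝ)) • ∑ i ∈ Finset.range h.S, ∑ j ∈ nodes p,
    fdCoeff p j • ((j : ℝ) • (F x (y j) (s i)).fst + (1 / h.ν) • (G x (y j) (s i)).fst)

/-- One outer iteration: the inner loops, then the normalized step `x - ηx Φ / ‖Φ‖` (no move if
`Φ = 0`). -/
def outerStep (p : ℕ) (h : Params) (sy : ℤ → ℕ → 𝒮) (sx : ℕ → 𝒮) (st : State dx dy) :
    State dx dy :=
  let r : ℤ → Vec dy × ℕ := fun j => innerLoop F G h j st.x (sy j) (st.y j) h.K
  let Φ := hyperGradEst F G p h st.x (fun j => (r j).1) sx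
  { x := st.x - h.ηx • ((1 / ‖Φ‖) • Φ)
    y := fun j => (r j).1
    calls := st.calls + (∑ j ∈ nodes p, (r j).2)
      + ∑ _i ∈ Finset.range h.S, ∑ _j ∈ nodes p, 2 }

/-- The state of `F²SA-p` after `t` outer iterations, run on the samples `s` from `(x₀, y₀)`. -/
def run (p : ℕ) (h : Params) (x₀ : Vec dx) (y₀ : Vec dy) (s : SampleIdx → 𝒮) : ℕ → State dx dy
  | 0 => { x := x₀, y := fun _ => y₀, calls := 0 }
  | t + 1 => outerStep F G p h (fun j k => s (.inner t j k)) (fun i => s (.batch t i))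
      (run p h x₀ y₀ s t)

end Algorithm

/-! ### The choice of the hyper-parameters -/

/-- `(ε / (Lbar κ^(2p+1)))^(1/p)`. -/
def baseStep (p : ℕ) (L : ℕ → ℝ) (μ ε : ℝ) : ℝ :=
  (ε / (Lbar p L * cond p L μ ^ (2 * p + 1))) ^ (1 / (p : ℝ))

/-- The constant factors in the choice of the hyper-parameters. -/
structure Factors where
  cν : ℝ
  cx : ℝ
  cy : ℝ
  cS : ℝ
  cK : ℝ
  cT : ℝ

/-- All constant factors are positive. -/
def Factors.Pos (c : Factors) : Prop :=
  0 < c.cν ∧ 0 < c.cx ∧ 0 < c.cy ∧ 0 < c.cS ∧ 0 < c.cK ∧ 0 < c.cT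

/-- The prescribed hyper-parameters, with the constant factors `c`; the integer ones are rounded
up. -/
def Factors.params (c : Factors) (p : ℕ) (L : ℕ → ℝ) (μ Δ σ R ε : ℝ) : Params :=
  let κ := cond p L μ
  let ν := c.cν * min (R / κ) (baseStep p L μ ε)
  let ηx := c.cx * (ε / (L 1 * κ ^ 3))
  { ν := ν
    ηx := ηx
    ηy := c.cy * (ν ^ 2 * ε ^ 2 / (L 1 * κ * σ ^ 2))
    S := ⌈c.cS * (σ ^ 2 / (ν ^ 2 * ε ^ 2))⌉₊
    K := ⌈c.cK * (κ ^ 2 * σ ^ 2 / (ν ^ 2 * ε ^ 2) * Real.log (R * L 1 * κ / (ν * ε)))⌉₊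
    T := ⌈c.cT * (Δ / (ηx * ε))⌉₊ }

/-- `p Δ L_1 Lbar^(2/p) σ² κ^(9+2/p) / ε^(4+2/p)`. -/
def rate (p : ℕ) (L : ℕ → ℝ) (μ Δ σ ε : ℝ) : ℝ :=
  p * Δ * L 1 * Lbar p L ^ (2 / (p : ℝ)) * σ ^ 2 * cond p L μ ^ (9 + 2 / (p : ℝ))
    / ε ^ (4 + 2 / (p : ℝ))

end Bilevel

end

noncomputable section

namespace Bilevel

/-! For small `lam`, the value function `min_y (lam f + g)` has x-gradient `lam ∇ₓf + ∇ₓg` at the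
penalized solution `tiltSol f g lam x`, and the derivative of this gradient in `lam` at 0 is
`∇φ(x)`. With exact inner solutions, the mean of the estimator `Φ` is a difference quotient of this
gradient with step `ν`, and the coefficients are exact on polynomials of degree at most `p`. What is
needed is a Taylor-type expansion in `lam` with constants that depend on `p` only.

The expansion is obtained without differentiating `tiltSol` in `lam`. With `τ = κ² lam` and `e(τ) =
(κ/τ)(tiltSol - y*)`, the stationarity condition becomes `e = ∑ τ^q Z_q(e) + O(τ^m)`, where the
`Z_q` are polynomial maps bounded in terms of `p`, `Z_0` is constant and `e` is bounded by 2. An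
expansion of `e` of order `n`, put into the right side, gives one of order `n + 1`, since every term
that depends on `e` carries a power of `τ` (`exists_hasExpansion_of_fixedPoint`). Substituting the
result into the gradient quotient gives the bias bound `C Lbar κ (κ² ν)^p` of
`exists_norm_fd_sub_hyperGrad_le`, which the choice of `ν` turns into a small multiple of `ε`.

The other errors are stochastic. The penalized problems are `μ/2`-strongly convex, so SGD contracts
the mean squared error down to a noise floor (`lintegral_innerLoop_le`). A normalized outer step
moves the minimizers by a bounded amount, so warm starts never lose more than a fixed level
(`lintegral_inner_error_le`). The members of a batch are independent given the iterates, so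
averaging divides the variance by `S` (`lintegral_hyperGradEst_sub_le`).

The hyper-gradient is Lipschitz with constant `20 L_1 κ³`. Normalized descent with an inexact
gradient (`sum_norm_hyperGrad_le`) then bounds the average of `‖∇φ(x_t)‖` by `Δ/(ηx T)`, twice the
mean error of `Φ`, and a term linear in `ηx`. The constant factors make the three add up to less
than `ε`; the complexity bounds are arithmetic in the parameters. -/

theorem abs_le_of_mem_nodes {p : ℕ} {j : ℤ} (hj : j ∈ nodes p) : |(j : ℝ)| ≤ p := by
  have h1 : |j| ≤ (p : ℤ) := by
    unfold nodes at hj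
    split_ifs at hj with hpe
    · rw [Finset.mem_Icc] at hj; rw [abs_le]; omega
    · rw [Finset.mem_Icc] at hj; rw [abs_le]; omega
  exact_mod_cast h1

/-! ### Taylor's formula with Lipschitz top derivative. -/

open Finset Nat in
/-- Taylor's formula on `[0, 1]`, with the remainder bounded by the variation of the last
derivative. -/
theorem norm_sub_taylor_line_le {F : Type*} [NormedAddCommGroup F] [NormedSpace ℝ F] (n : ℕ) :
    ∀ (v : ℕ → ℝ → F) (M : ℝ), (∀ k < n, ∀ t, HasDerivAt (v k) (v (k + 1) t) t) →
      (∀ t ∈ Set.Icc (0 : ℝ) 1, ‖v n t - v n 0‖ ≤ M) →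
      ∀ t ∈ Set.Icc (0 : ℝ) 1,
        ‖v 0 t - ∑ k ∈ range (n + 1), ((k ! : ℝ)⁻¹ * t ^ k) • v k 0‖ ≤ M := by
  induction n with
  | zero => intro v M _ hM t ht; simpa using hM t ht
  | succ n ih =>
    intro v M hv hM
    have hM0 : 0 ≤ M := (norm_nonneg _).trans (hM 0 (by simp))
    -- The derivative of the remainder of `v` is the remainder, one order lower, of the shifted
    -- family. The mean value inequality on `[0, 1]` then keeps the bound `M`; the factorial of the
    -- sharp bound is given away.
    have h1 := ih (fun k => v (k + 1)) M (fun k hk t => hv (k + 1) (by omega) t) hM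
    set r : ℝ → F := fun t => v 0 t - ∑ k ∈ range (n + 1 + 1), ((k ! : ℝ)⁻¹ * t ^ k) • v k 0
      with hr
    have hd : ∀ t, HasDerivAt r
        (v 1 t - ∑ k ∈ range (n + 1), ((k ! : ℝ)⁻¹ * t ^ k) • v (k + 1) 0) t := by
      intro t
      refine (hv 0 (by omega) t).sub ?_
      have h2 : HasDerivAt (fun t : ℝ => ∑ k ∈ range (n + 1 + 1), ((k ! : ℝ)⁻¹ * t ^ k) • v k 0)
          (∑ k ∈ range (n + 1 + 1), ((k ! : ℝ)⁻¹ * (k * t ^ (k - 1))) • v k 0) t := by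
        refine HasDerivAt.fun_sum fun k _ => ?_
        exact ((hasDerivAt_pow k t).const_mul _).smul_const _
      convert h2 using 1
      rw [Finset.sum_range_succ' _ (n + 1)]
      simp only [CharP.cast_eq_zero, zero_mul, mul_zero, zero_smul, add_zero, add_tsub_cancel_right]
      refine Finset.sum_congr rfl fun k _ => ?_
      congr 1
      rw [Nat.factorial_succ]
      push_cast
      have : (k ! : ℝ) ≠ 0 := by positivity
      field_simp
    intro t ht
    have h3 := norm_image_sub_le_of_norm_deriv_le_segment' (f := r) (C := M) (a := 0) (b := 1)
      (fun x _ => (hd x).hasDerivWithinAt) (fun x hx => h1 x ⟨hx.1, hx.2.le⟩) t ht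
    have hr0 : r 0 = 0 := by
      simp only [hr]
      rw [Finset.sum_range_succ' _ (n + 1)]
      simp
    rw [hr0, sub_zero, sub_zero] at h3
    exact h3.trans (mul_le_of_le_one_right hM0 ht.2)

open Finset Nat in
/-- Taylor's formula for a function whose `n`-th derivative is Lipschitz. -/
theorem norm_sub_taylor_le {E F : Type*} [NormedAddCommGroup E] [NormedSpace ℝ E]
    [NormedAddCommGroup F] [NormedSpace ℝ F] {f : E → F} {n : ℕ} {C : ℝ} (hf : ContDiff ℝ n f)
    (hC : ∀ y y', ‖iteratedFDeriv ℝ n f y - iteratedFDeriv ℝ n f y'‖ ≤ C * ‖y - y'‖) (y d : E) :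
    ‖f (y + d) - ∑ k ∈ range (n + 1), (k ! : ℝ)⁻¹ • iteratedFDeriv ℝ k f y (fun _ => d)‖
      ≤ C * ‖d‖ ^ (n + 1) := by
  -- Restriction to the segment from `y` to `y + d`: the top derivative varies there by at most `C
  -- ‖d‖` as an operator, and its `n` arguments `d` contribute `‖d‖ ^ n`.
  have h := norm_sub_taylor_line_le n
    (fun k t => iteratedFDeriv ℝ k f (y + t • d) (fun _ => d)) (C * ‖d‖ ^ (n + 1)) ?_ ?_ 1
    (by simp)
  · simpa using h
  · intro k hk t
    have hk' : ((k + 1 : ℕ) : WithTop ℕ∞) ≤ n := by exact_mod_cast hk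
    have hfk : ContDiffAt ℝ (k + 1 : ℕ) f (y + t • d) := (hf.of_le hk').contDiffAt
    have hdiff : DifferentiableAt ℝ
        (fun s : ℝ => iteratedFDeriv ℝ k f (y + s • d) (fun _ => d)) t := by
      have h1 : DifferentiableAt ℝ (iteratedFDeriv ℝ k f) (y + t • d) :=
        hfk.differentiableAt_iteratedFDeriv (by exact_mod_cast lt_add_one k)
      have h2 := h1.continuousMultilinear_apply_const (fun _ => d)
      exact DifferentiableAt.comp (g := fun z => iteratedFDeriv ℝ k f z (fun _ => d)) t h2
        (by fun_prop)
    have h3 := hdiff.hasDerivAt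
    rwa [ContDiffAt.deriv_fderiv_add_smul (by exact_mod_cast hfk)] at h3
  · intro t ht
    have hC0 : 0 ≤ C * ‖d‖ := by
      have := (norm_nonneg _).trans (hC (y + d) y)
      simpa using this
    have h1 : ‖iteratedFDeriv ℝ n f (y + t • d) - iteratedFDeriv ℝ n f (y + (0 : ℝ) • d)‖
        ≤ C * ‖d‖ := by
      refine (hC _ _).trans ?_
      rw [add_sub_add_left_eq_sub, zero_smul, sub_zero, norm_smul, Real.norm_of_nonneg ht.1]
      nlinarith [ht.2]
    have h2 := (iteratedFDeriv ℝ n f (y + t • d)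
      - iteratedFDeriv ℝ n f (y + (0 : ℝ) • d)).le_opNorm (fun _ => d)
    simp only [Finset.prod_const, Finset.card_univ, Fintype.card_fin] at h2
    refine h2.trans ?_
    calc _ ≤ C * ‖d‖ * ‖d‖ ^ n := by gcongr
      _ = _ := by ring

/-! ### Expansions in powers of `τ` with controlled constants. -/

/-- `h` agrees on `s` up to `O(τ^n)` with a polynomial of degree `< n` in `τ`, and the
coefficients and the constant in the remainder are bounded by `C`. -/
def HasExpansion {E : Type*} [NormedAddCommGroup E] [NormedSpace ℝ E] (s : Set ℝ) (n : ℕ) (C : ℝ)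
    (h : ℝ → E) : Prop :=
  ∃ a : ℕ → E, (∀ i < n, ‖a i‖ ≤ C) ∧
    ∀ τ ∈ s, ‖h τ - ∑ i ∈ Finset.range n, τ ^ i • a i‖ ≤ C * |τ| ^ n

namespace HasExpansion

variable {E F : Type*} [NormedAddCommGroup E] [NormedSpace ℝ E] [NormedAddCommGroup F]
  [NormedSpace ℝ F] {s : Set ℝ} {n : ℕ} {C C' : ℝ} {h h' : ℝ → E}

theorem mono (H : HasExpansion s n C h) (hC : C ≤ C') : HasExpansion s n C' h := by
  obtain ⟨a, ha, hr⟩ := H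
  exact ⟨a, fun i hi => (ha i hi).trans hC, fun τ hτ => (hr τ hτ).trans (by gcongr)⟩

theorem add (H : HasExpansion s n C h) (H' : HasExpansion s n C' h') :
    HasExpansion s n (C + C') (fun τ => h τ + h' τ) := by
  obtain ⟨a, ha, hr⟩ := H
  obtain ⟨b, hb, hq⟩ := H'
  refine ⟨fun i => a i + b i, fun i hi => (norm_add_le _ _).trans (add_le_add (ha i hi) (hb i hi)),
    fun τ hτ => ?_⟩
  have : h τ + h' τ - ∑ i ∈ Finset.range n, τ ^ i • (a i + b i)
      = (h τ - ∑ i ∈ Finset.range n, τ ^ i • a i) + (h' τ - ∑ i ∈ Finset.range n, τ ^ i • b i) := by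
    simp only [smul_add, Finset.sum_add_distrib]; abel
  rw [this, add_mul]
  exact (norm_add_le _ _).trans (add_le_add (hr τ hτ) (hq τ hτ))

theorem zero : HasExpansion s n 0 (fun _ => (0 : E)) :=
  ⟨fun _ => 0, by simp, by simp⟩

theorem sum {ι : Type*} {t : Finset ι} {c : ι → ℝ} {k : ι → ℝ → E}
    (H : ∀ i ∈ t, HasExpansion s n (c i) (k i)) :
    HasExpansion s n (∑ i ∈ t, c i) (fun τ => ∑ i ∈ t, k i τ) := by
  classical
  induction t using Finset.induction_on with
  | empty => simpa using zero
  | insert i t hi ih =>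
    simp only [Finset.sum_insert hi]
    exact (H i (by simp)).add (ih fun j hj => H j (by simp [hj]))

theorem of_le (H : HasExpansion s n C h) (hh : ∀ τ ∈ s, ‖h' τ - h τ‖ ≤ C' * |τ| ^ n)
    (hC' : 0 ≤ C') : HasExpansion s n (C + C') h' := by
  obtain ⟨a, ha, hr⟩ := H
  refine ⟨a, fun i hi => (ha i hi).trans (by linarith), fun τ hτ => ?_⟩
  have := norm_add_le (h' τ - h τ) (h τ - ∑ i ∈ Finset.range n, τ ^ i • a i)
  rw [sub_add_sub_cancel] at this
  linarith [hh τ hτ, hr τ hτ]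

/-- A power with `k ≥ n` belongs to the remainder, because `|τ| ≤ 1`. -/
theorem monomial (hs : ∀ τ ∈ s, |τ| ≤ 1) (k : ℕ) (b : E) :
    HasExpansion s n ‖b‖ (fun τ => τ ^ k • b) := by
  by_cases hk : k < n
  · refine ⟨fun i => if i = k then b else 0, fun i _ => ?_, fun τ _ => ?_⟩
    · dsimp only
      split_ifs <;> simp
    · simp [hk]; positivity
  · refine ⟨fun _ => 0, by simp, fun τ hτ => ?_⟩
    simp only [smul_zero, Finset.sum_const_zero, sub_zero, norm_smul, norm_pow, Real.norm_eq_abs]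
    rw [mul_comm]
    gcongr ?_ * ?_
    exact pow_le_pow_of_le_one (abs_nonneg _) (hs τ hτ) (by omega)

theorem const (hs : ∀ τ ∈ s, |τ| ≤ 1) (b : E) : HasExpansion s n ‖b‖ (fun _ => b) := by
  simpa using monomial (n := n) hs 0 b

/-- The dropped top coefficient joins the remainder, which doubles the constant. -/
theorem pred (hs : ∀ τ ∈ s, |τ| ≤ 1) (hC : 0 ≤ C) (H : HasExpansion s (n + 1) C h) :
    HasExpansion s n (2 * C) h := by
  obtain ⟨a, ha, hr⟩ := H
  refine ⟨a, fun i hi => (ha i (by omega)).trans (by linarith), fun τ hτ => ?_⟩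
  have h1 := hr τ hτ
  rw [Finset.sum_range_succ, ← sub_sub] at h1
  have h2 : ‖τ ^ n • a n‖ ≤ C * |τ| ^ n := by
    rw [norm_smul, norm_pow, Real.norm_eq_abs, mul_comm]
    gcongr
    exact ha n (by omega)
  have h3 : C * |τ| ^ (n + 1) ≤ C * |τ| ^ n :=
    mul_le_mul_of_nonneg_left (pow_le_pow_of_le_one (abs_nonneg _) (hs τ hτ) n.le_succ) hC
  have h4 := norm_sub_norm_le (h τ - ∑ i ∈ Finset.range n, τ ^ i • a i) (τ ^ n • a n)
  linarith

/-- The gain of one order under multiplication by `τ` is what drives the bootstrap in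
`exists_hasExpansion_of_fixedPoint`. -/
theorem id_smul (hC : 0 ≤ C) (H : HasExpansion s n C h) :
    HasExpansion s (n + 1) C (fun τ => τ • h τ) := by
  obtain ⟨a, ha, hr⟩ := H
  refine ⟨fun i => if i = 0 then 0 else a (i - 1), fun i hi => ?_, fun τ hτ => ?_⟩
  · dsimp only
    split_ifs with h0
    · simpa using hC
    · exact ha _ (by omega)
  · rw [Finset.sum_range_succ' _ n]
    simp only [Nat.add_eq_zero_iff, one_ne_zero, and_false, if_false, Nat.add_sub_cancel, if_true,
      smul_zero, add_zero]
    have : τ • h τ - ∑ i ∈ Finset.range n, τ ^ (i + 1) • a i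
        = τ • (h τ - ∑ i ∈ Finset.range n, τ ^ i • a i) := by
      rw [smul_sub, Finset.smul_sum]
      simp only [smul_smul, pow_succ']
    rw [this, norm_smul, Real.norm_eq_abs, pow_succ]
    nlinarith [hr τ hτ, abs_nonneg τ]

/-- One gained order is enough. Each further factor `τ` gains another one, which `pred` gives back
at the price of a factor 2. -/
theorem pow_succ_smul (hs : ∀ τ ∈ s, |τ| ≤ 1) (hC : 0 ≤ C) (H : HasExpansion s n C h) (k : ℕ) :
    HasExpansion s (n + 1) (2 ^ k * C) (fun τ => τ ^ (k + 1) • h τ) := by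
  induction k with
  | zero => simpa using H.id_smul hC
  | succ k ih =>
    have := (ih.id_smul (by positivity)).pred hs (by positivity)
    rw [← mul_assoc, ← pow_succ'] at this
    simpa only [smul_smul, ← pow_succ'] using this

theorem norm_le (hs : ∀ τ ∈ s, |τ| ≤ 1) (hC : 0 ≤ C) (H : HasExpansion s n C h) {τ : ℝ}
    (hτ : τ ∈ s) : ‖h τ‖ ≤ C * (n + 1) := by
  obtain ⟨a, ha, hr⟩ := H
  have h1 : ‖∑ i ∈ Finset.range n, τ ^ i • a i‖ ≤ n * C := by
    refine (norm_sum_le_of_le (Finset.range n) (f := fun i => τ ^ i • a i) (n := fun _ => C)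
      fun i hi => ?_).trans (by simp)
    rw [norm_smul, norm_pow, Real.norm_eq_abs]
    exact (mul_le_of_le_one_left (norm_nonneg _) (pow_le_one₀ (abs_nonneg _) (hs τ hτ))).trans
      (ha i (Finset.mem_range.1 hi))
  have h2 : C * |τ| ^ n ≤ C := mul_le_of_le_one_right hC (pow_le_one₀ (abs_nonneg _) (hs τ hτ))
  have h3 := norm_sub_norm_le (h τ) (∑ i ∈ Finset.range n, τ ^ i • a i)
  linarith [hr τ hτ]

/-- Replace `h` by its polynomial part. Multilinearity expands the value there into at most `n ^ q`
monomials; the replacement error is controlled by the Lipschitz bound of `M` on the ball of radius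
`C (n + 1)`, which contains both arguments. -/
theorem multilinear (hs : ∀ τ ∈ s, |τ| ≤ 1) (hC : 0 ≤ C) (H : HasExpansion s n C h) {q : ℕ}
    (M : E [×q]→L[ℝ] F) :
    HasExpansion s n (‖M‖ * (n ^ q * C ^ q + q * (C * (n + 1)) ^ (q - 1) * C))
      (fun τ => M (fun _ => h τ)) := by
  obtain ⟨a, ha, hr⟩ := id H
  have hP : HasExpansion s n (‖M‖ * (n ^ q * C ^ q))
      (fun τ => M (fun _ => ∑ i ∈ Finset.range n, τ ^ i • a i)) := by
    have h1 : ∀ τ : ℝ, M (fun _ => ∑ i ∈ Finset.range n, τ ^ i • a i)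
        = ∑ r ∈ Fintype.piFinset (fun _ : Fin q => Finset.range n),
          τ ^ (∑ i, r i) • M (fun i => a (r i)) := by
      intro τ
      have := M.toMultilinearMap.map_sum_finset (fun (_ : Fin q) (i : ℕ) => τ ^ i • a i)
        (fun _ => Finset.range n)
      refine this.trans (Finset.sum_congr rfl fun r _ => ?_)
      rw [M.toMultilinearMap.map_smul_univ (fun i => τ ^ (r i)) (fun i => a (r i)),
        Finset.prod_pow_eq_pow_sum]
      rfl
    simp only [h1]
    refine (sum fun r _ => monomial hs (∑ i, r i) (M fun i => a (r i))).mono ?_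
    calc ∑ r ∈ Fintype.piFinset (fun _ : Fin q => Finset.range n), ‖M fun i => a (r i)‖
        ≤ ∑ r ∈ Fintype.piFinset (fun _ : Fin q => Finset.range n), ‖M‖ * C ^ q := by
          refine Finset.sum_le_sum fun r hr => ?_
          have := M.le_opNorm_mul_pow_of_le (m := fun i => a (r i)) (b := C) ?_
          · simpa using this
          · refine (pi_norm_le_iff_of_nonneg hC).2 fun i => ha _ ?_
            exact Finset.mem_range.1 (Fintype.mem_piFinset.1 hr i)
      _ = ‖M‖ * (n ^ q * C ^ q) := by
          rw [Finset.sum_const, Fintype.card_piFinset]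
          simp
          ring
  have hb : 0 ≤ C * (n + 1) := by positivity
  refine (hP.of_le (C' := ‖M‖ * (q * (C * (n + 1)) ^ (q - 1) * C)) (fun τ hτ => ?_)
    (by positivity)).mono (by rw [← mul_add])
  have h1 := M.norm_image_sub_le (fun _ => h τ) (fun _ => ∑ i ∈ Finset.range n, τ ^ i • a i)
  have h2 : ‖fun _ : Fin q => h τ‖ ≤ C * (n + 1) :=
    (pi_norm_le_iff_of_nonneg hb).2 fun _ => H.norm_le hs hC hτ
  have h3 : ‖fun _ : Fin q => ∑ i ∈ Finset.range n, τ ^ i • a i‖ ≤ C * (n + 1) := by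
    refine (pi_norm_le_iff_of_nonneg hb).2 fun _ => ?_
    refine (norm_sum_le_of_le (Finset.range n) (f := fun i => τ ^ i • a i) (n := fun _ => C)
      fun i hi => ?_).trans (by simp; nlinarith)
    rw [norm_smul, norm_pow, Real.norm_eq_abs]
    exact (mul_le_of_le_one_left (norm_nonneg _) (pow_le_one₀ (abs_nonneg _) (hs τ hτ))).trans
      (ha i (Finset.mem_range.1 hi))
  have h4 : ‖(fun _ : Fin q => h τ) - fun _ => ∑ i ∈ Finset.range n, τ ^ i • a i‖
      ≤ C * |τ| ^ n :=
    (pi_norm_le_iff_of_nonneg (by positivity)).2 fun _ => hr τ hτ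
  refine h1.trans ?_
  rw [Fintype.card_fin]
  calc _ ≤ ‖M‖ * q * (C * (n + 1)) ^ (q - 1) * (C * |τ| ^ n) := by
        gcongr
        exact max_le h2 h3
    _ = _ := by ring

end HasExpansion

/-- An approximate fixed-point equation `e = ∑ τ^q Z_q(e) + O(τ^n)` with polynomial `Z_q` bounded
in terms of `c` yields an expansion of `e` whose constant depends on `n` and `c` only. -/
theorem exists_hasExpansion_of_fixedPoint (n : ℕ) {c : ℝ} (hc : 0 ≤ c) :
    ∃ C, 0 ≤ C ∧ ∀ (E : Type) [NormedAddCommGroup E] [NormedSpace ℝ E] (s : Set ℝ) (e : ℝ → E)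
      (A : (q : ℕ) → E [×q]→L[ℝ] E) (B : (q : ℕ) → E [×(q + 1)]→L[ℝ] E),
      (∀ τ ∈ s, |τ| ≤ 1) → (∀ τ ∈ s, ‖e τ‖ ≤ c) → B 0 = 0 →
      (∀ q < n, ‖A q‖ ≤ c) → (∀ q < n, ‖B q‖ ≤ c) →
      (∀ m < n, ∀ τ ∈ s, ‖e τ - ∑ q ∈ Finset.range (m + 1),
        τ ^ q • (A q (fun _ => e τ) + B q (fun _ => e τ))‖ ≤ c * |τ| ^ (m + 1)) →
      HasExpansion s n C e := by
  induction n with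
  | zero =>
    refine ⟨c, hc, fun E _ _ s e A B hs he _ _ _ _ => ⟨0, by simp, fun τ hτ => ?_⟩⟩
    simpa using he τ hτ
  | succ n ih =>
    obtain ⟨C, hC, H⟩ := ih
    -- The constant of `multilinear` with `c` in place of `‖M‖`. It does not see the space or the
    -- maps, so the final constant can be fixed before them.
    set K : ℕ → ℝ := fun q => c * (n ^ q * C ^ q + q * (C * (n + 1)) ^ (q - 1) * C) with hK
    have hK0 : ∀ q, 0 ≤ K q := fun q => by simp only [hK]; positivity
    refine ⟨(∑ q ∈ Finset.range n, 2 ^ q * (K (q + 1) + K (q + 1 + 1)) + c) + c,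
      by have := Finset.sum_nonneg (s := Finset.range n) (f := fun q => 2 ^ q * (K (q + 1) + K (q + 1 + 1)))
          (fun q _ => by have := hK0 (q + 1); have := hK0 (q + 1 + 1); positivity)
         linarith, ?_⟩
    intro E _ _ s e A B hs he hB0 hA hB happ
    have hexp := H E s e A B hs he hB0 (fun q hq => hA q (by omega)) (fun q hq => hB q (by omega))
      (fun m hm => happ m (by omega))
    have hM : ∀ {q : ℕ} (M : E [×q]→L[ℝ] E), ‖M‖ ≤ c →
        HasExpansion s n (K q) (fun τ => M (fun _ => e τ)) := by
      intro q M hMc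
      refine (hexp.multilinear hs hC M).mono ?_
      simp only [hK]
      gcongr
    -- In the equation of order `n + 1` the terms with `q ≥ 1` gain an order from `τ ^ q`. The term
    -- `q = 0` is constant in `τ`, since `A 0` has no arguments and `B 0 = 0`; it has an expansion
    -- of any order.
    refine HasExpansion.of_le ?_ (happ n (by omega)) hc
    simp only [Finset.sum_range_succ' _ n]
    refine HasExpansion.add (HasExpansion.sum fun q hq => ?_) ?_
    · have hq' := Finset.mem_range.1 hq
      exact HasExpansion.pow_succ_smul hs (add_nonneg (hK0 _) (hK0 _))
        ((hM _ (hA (q + 1) (by omega))).add (hM _ (hB (q + 1) (by omega)))) q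
    · have h0 : ∀ τ, A 0 (fun _ => e τ) = A 0 (fun _ => 0) := fun τ => by
        congr 1; ext i; exact i.elim0
      simp only [pow_zero, one_smul, hB0, _root_.zero_apply, add_zero, h0]
      refine (HasExpansion.const hs _).mono ?_
      refine ((A 0).le_opNorm _).trans ?_
      simpa using hA 0 (by omega)

/-- The finite difference formula recovers the constant coefficient of an expansion. -/
theorem norm_fd_sub_le {E : Type*} [NormedAddCommGroup E] [NormedSpace ℝ E] {p : ℕ} (hp : 1 ≤ p)
    {s : Set ℝ} {C : ℝ} {h : ℝ → E} {a : ℕ → E} {τ : ℝ}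
    (hr : ∀ t ∈ s, ‖h t - ∑ i ∈ Finset.range p, t ^ i • a i‖ ≤ C * |t| ^ p)
    (hτ : ∀ j ∈ nodes p, j ≠ 0 → (j : ℝ) * τ ∈ s) :
    ‖∑ j ∈ nodes p, (fdCoeff p j * j) • h (j * τ) - a 0‖
      ≤ C * (∑ j ∈ nodes p, |fdCoeff p j * j| * |(j : ℝ)| ^ p) * |τ| ^ p := by
  have h1 : ∑ j ∈ nodes p, (fdCoeff p j * j) • ∑ i ∈ Finset.range p, ((j : ℝ) * τ) ^ i • a i
      = a 0 := by
    simp only [Finset.smul_sum]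
    rw [Finset.sum_comm]
    have h2 : ∀ i ∈ Finset.range p, ∑ j ∈ nodes p, (fdCoeff p j * j) • ((j : ℝ) * τ) ^ i • a i
        = if i = 0 then a 0 else 0 := by
      intro i hi
      -- The weight `j` shifts the moments by one, so the powers `i < p` meet exactly the moment
      -- conditions of orders `1, …, p`; only `i = 0` survives.
      have h3 := sum_fdCoeff_mul_pow p (i + 1) (Finset.mem_range.1 hi)
      have : ∀ j ∈ nodes p, (fdCoeff p j * j) • ((j : ℝ) * τ) ^ i • a i
          = (fdCoeff p j * (j : ℝ) ^ (i + 1)) • (τ ^ i • a i) := fun j _ => by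
        rw [smul_smul, smul_smul]; congr 1; ring
      rw [Finset.sum_congr rfl this, ← Finset.sum_smul, h3]
      by_cases hi0 : i = 0
      · simp [hi0]
      · simp [hi0]
    rw [Finset.sum_congr rfl h2]
    simp; omega
  rw [← h1, ← Finset.sum_sub_distrib, Finset.mul_sum, Finset.sum_mul]
  refine norm_sum_le_of_le _ fun j hj => ?_
  rw [← smul_sub, norm_smul, Real.norm_eq_abs]
  -- The node 0 has weight 0, so the expansion is never needed at `τ = 0`.
  by_cases hj0 : j = 0
  · simp [hj0]
  · calc _ ≤ |fdCoeff p j * j| * (C * |(j : ℝ) * τ| ^ p) := by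
          gcongr; exact hr _ (hτ j hj hj0)
      _ = _ := by rw [abs_mul (j : ℝ) τ, mul_pow]; ring

/-! ### Smooth and strongly convex functions. -/

section StronglyConvex

variable {E : Type*} [NormedAddCommGroup E] [InnerProductSpace ℝ E]

/-- The first-order quadratic bound for a function with `L`-Lipschitz gradient. -/
theorem abs_sub_sub_inner_le [CompleteSpace E] {h : E → ℝ} {G : E → E}
    {L : ℝ} (hG : ∀ y, HasGradientAt h (G y) y) (hL : ∀ y y', ‖G y - G y'‖ ≤ L * ‖y - y'‖)
    (y z : E) : |h z - h y - inner ℝ (G y) (z - y)| ≤ L * ‖z - y‖ ^ 2 := by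
  -- The mean value inequality for `h - ⟨G y, ·⟩`, whose gradient has norm at most `L ‖z - y‖` on
  -- the segment. It gives `L` where integration would give `L / 2`; later constants inherit this.
  have hd : ∀ u ∈ segment ℝ y z, HasFDerivWithinAt (fun u => h u - inner ℝ (G y) u)
      (innerSL ℝ (G u - G y)) (segment ℝ y z) u := by
    intro u _
    have h1 := (hG u).hasFDerivAt
    have h2 : HasFDerivAt (fun u => inner ℝ (G y) u) (innerSL ℝ (G y)) u :=
      (innerSL ℝ (G y)).hasFDerivAt
    refine ((h1.sub h2).congr_fderiv ?_).hasFDerivWithinAt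
    ext v
    simp
  have hL0 : 0 ≤ L * ‖z - y‖ := (norm_nonneg _).trans (hL z y)
  have hb : ∀ u ∈ segment ℝ y z, ‖innerSL ℝ (G u - G y)‖ ≤ L * ‖z - y‖ := by
    rintro u ⟨a, b, ha, hb, hab, rfl⟩
    rw [innerSL_apply_norm]
    refine (hL _ _).trans ?_
    have : a • y + b • z - y = b • (z - y) := by
      rw [← sub_eq_zero, show a = 1 - b by linarith]; module
    rw [this, norm_smul, Real.norm_of_nonneg hb]
    nlinarith
  have h3 := (convex_segment y z).norm_image_sub_le_of_norm_hasFDerivWithin_le hd hb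
    (left_mem_segment ℝ y z) (right_mem_segment ℝ y z)
  rw [Real.norm_eq_abs] at h3
  rw [inner_sub_right]
  calc _ = |h z - inner ℝ (G y) z - (h y - inner ℝ (G y) y)| := by congr 1; ring
    _ ≤ _ := h3
    _ = _ := by ring

/-- `h` is `m`-strongly convex with gradient `G`. -/
structure StrongConvexGrad [CompleteSpace E] (m : ℝ) (h : E → ℝ) (G : E → E) : Prop where
  pos : 0 < m
  hasGradientAt : ∀ y, HasGradientAt h (G y) y
  le : ∀ y z, h y + inner ℝ (G y) (z - y) + m / 2 * ‖y - z‖ ^ 2 ≤ h z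

namespace StrongConvexGrad

variable [CompleteSpace E] {m : ℝ} {h : E → ℝ} {G : E → E} (H : StrongConvexGrad m h G)
include H

/-- Outside the ball of radius `2 ‖G 0‖ / m` the quadratic term of the lower bound at 0 beats the
linear one, so a minimizer over that compact ball is global. -/
theorem exists_min [FiniteDimensional ℝ E] : ∃ y, ∀ z, h y ≤ h z := by
  have hcont : Continuous h := continuous_iff_continuousAt.2 fun y =>
    (H.hasGradientAt y).hasFDerivAt.continuousAt
  have hm := H.pos
  set r := 2 * ‖G 0‖ / m with hr
  have hr0 : 0 ≤ r := by positivity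
  obtain ⟨y, -, hy⟩ := (isCompact_closedBall (0 : E) r).exists_isMinOn
    ⟨0, by simpa using hr0⟩ hcont.continuousOn
  refine ⟨y, fun z => ?_⟩
  by_cases hz : z ∈ Metric.closedBall (0 : E) r
  · exact hy hz
  · have h0 : h y ≤ h 0 := hy (by simpa using hr0)
    refine h0.trans ?_
    have h1 := H.le 0 z
    have h2 := abs_le.1 (abs_real_inner_le_norm (G 0) (z - 0))
    simp only [sub_zero, zero_sub, norm_neg, mem_closedBall_zero_iff, not_le] at h1 h2 hz
    have h3 : 2 * ‖G 0‖ < ‖z‖ * m := (div_lt_iff₀ hm).1 hz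
    nlinarith [norm_nonneg z]

theorem grad_eq_zero {y : E} (hy : ∀ z, h y ≤ h z) : G y = 0 := by
  have h1 : IsLocalMin h y := Filter.Eventually.of_forall hy
  have h2 := h1.hasFDerivAt_eq_zero (H.hasGradientAt y).hasFDerivAt
  simpa using h2

theorem mono (y z : E) : m * ‖y - z‖ ^ 2 ≤ inner ℝ (G y - G z) (y - z) := by
  have h1 := H.le y z
  have h2 := H.le z y
  rw [norm_sub_rev z y] at h2
  have h3 : inner ℝ (G y) (z - y) = -inner ℝ (G y) (y - z) := by
    rw [← inner_neg_right, neg_sub]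
  rw [inner_sub_left]
  linarith

theorem mul_norm_sub_le (y z : E) : m * ‖y - z‖ ≤ ‖G y - G z‖ := by
  have h1 := H.mono y z
  have h2 := real_inner_le_norm (G y - G z) (y - z)
  rcases (norm_nonneg (y - z)).eq_or_lt with h0 | h0
  · rw [← h0, mul_zero]; exact norm_nonneg _
  · nlinarith

/-- A gradient step of size `1 / (2 L)`, the best one for the quadratic bound with constant `L`,
cannot go below the minimum. -/
theorem norm_sq_grad_le {L : ℝ} (hL0 : 0 < L) (hL : ∀ y y', ‖G y - G y'‖ ≤ L * ‖y - y'‖)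
    {ys : E} (hys : ∀ z, h ys ≤ h z) (y : E) : ‖G y‖ ^ 2 ≤ 4 * L * (h y - h ys) := by
  have h1 := (abs_le.1 (abs_sub_sub_inner_le H.hasGradientAt hL y (y - (1 / (2 * L)) • G y))).2
  have h2 := hys (y - (1 / (2 * L)) • G y)
  have h3 : y - (1 / (2 * L)) • G y - y = -((1 / (2 * L)) • G y) := by abel
  rw [h3, inner_neg_right, inner_smul_right, norm_neg, norm_smul, real_inner_self_eq_norm_sq,
    Real.norm_of_nonneg (by positivity)] at h1
  have h4 : L * (1 / (2 * L) * ‖G y‖) ^ 2 = ‖G y‖ ^ 2 / (4 * L) := by field_simp; norm_num; ring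
  have h5 : 1 / (2 * L) * ‖G y‖ ^ 2 = 2 * (‖G y‖ ^ 2 / (4 * L)) := by field_simp; norm_num; ring
  rw [h4, h5] at h1
  have h6 : ‖G y‖ ^ 2 / (4 * L) ≤ h y - h ys := by linarith
  rw [div_le_iff₀ (by positivity)] at h6
  linarith

/-- One exact gradient step contracts the distance to the minimizer. -/
theorem norm_sq_gradStep_le {L η : ℝ} (hL0 : 0 < L)
    (hL : ∀ y y', ‖G y - G y'‖ ≤ L * ‖y - y'‖) {ys : E} (hys : ∀ z, h ys ≤ h z) (hη : 0 ≤ η)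
    (hηL : 2 * η * L ≤ 1) (y : E) :
    ‖y - η • G y - ys‖ ^ 2 ≤ (1 - η * m) * ‖y - ys‖ ^ 2 := by
  have h1 := H.norm_sq_grad_le hL0 hL hys y
  have h2 := H.le y ys
  have h3 : y - η • G y - ys = (y - ys) - η • G y := by abel
  rw [h3, norm_sub_sq_real, inner_smul_right, norm_smul, Real.norm_of_nonneg hη,
    real_inner_comm, mul_pow]
  have h4 : inner ℝ (G y) (ys - y) = -inner ℝ (G y) (y - ys) := by
    rw [← inner_neg_right, neg_sub]
  rw [h4] at h2
  -- The squared step is paid for by the gap `h y - h ys`, which strong convexity supplies in the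
  -- cross term; `2 η L ≤ 1` makes the two cancel.
  have h5 : η ^ 2 * ‖G y‖ ^ 2 ≤ 2 * η * (h y - h ys) := by
    have h6 := hys y
    calc _ ≤ η ^ 2 * (4 * L * (h y - h ys)) := by gcongr
      _ = 2 * η * (2 * η * L) * (h y - h ys) := by ring
      _ ≤ 2 * η * 1 * (h y - h ys) := by
        have : 0 ≤ h y - h ys := by linarith
        gcongr
      _ = _ := by ring
  nlinarith

end StrongConvexGrad

end StronglyConvex

/-! ### Partial gradients on the product space. -/

section Partial

variable {dx dy : ℕ} {f : Vec dx → Vec dy → ℝ}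

theorem norm_fst_le_norm (z : Joint dx dy) : ‖z.fst‖ ≤ ‖z‖ := by
  have h := WithLp.prod_norm_sq_eq_of_L2 z
  exact le_of_sq_le_sq (by nlinarith [sq_nonneg ‖z.snd‖]) (norm_nonneg _)

theorem norm_snd_le_norm (z : Joint dx dy) : ‖z.snd‖ ≤ ‖z‖ := by
  have h := WithLp.prod_norm_sq_eq_of_L2 z
  exact le_of_sq_le_sq (by nlinarith [sq_nonneg ‖z.fst‖]) (norm_nonneg _)

theorem norm_le_fst_add_snd (z : Joint dx dy) : ‖z‖ ≤ ‖z.fst‖ + ‖z.snd‖ := by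
  have h := WithLp.prod_norm_sq_eq_of_L2 z
  exact le_of_sq_le_sq (by nlinarith [norm_nonneg z.fst, norm_nonneg z.snd]) (by positivity)

theorem norm_pair_sub_le (x x' : Vec dx) (y y' : Vec dy) :
    ‖pair x y - pair x' y'‖ ≤ ‖x - x'‖ + ‖y - y'‖ :=
  norm_le_fst_add_snd _

theorem hasGradientAt_gradY (hf : Differentiable ℝ (fun z : Vec dx × Vec dy => f z.1 z.2))
    (x : Vec dx) (y : Vec dy) : HasGradientAt (f x) (gradY f x y) y := by
  have h : DifferentiableAt ℝ (f x) y :=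
    DifferentiableAt.comp (g := fun z : Vec dx × Vec dy => f z.1 z.2) (f := fun v => (x, v)) y
      (hf _) (by fun_prop)
  exact h.hasGradientAt

theorem hasGradientAt_gradX (hf : Differentiable ℝ (fun z : Vec dx × Vec dy => f z.1 z.2))
    (x : Vec dx) (y : Vec dy) : HasGradientAt (fun u => f u y) (gradX f x y) x := by
  have h : DifferentiableAt ℝ (fun u => f u y) x :=
    DifferentiableAt.comp (g := fun z : Vec dx × Vec dy => f z.1 z.2) (f := fun u => (u, y)) x
      (hf _) (by fun_prop)
  exact h.hasGradientAt

theorem fderiv_uncurry_apply (hf : Differentiable ℝ (fun z : Vec dx × Vec dy => f z.1 z.2))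
    (x : Vec dx) (y : Vec dy) (u : Vec dx) (v : Vec dy) :
    fderiv ℝ (fun z : Vec dx × Vec dy => f z.1 z.2) (x, y) (u, v)
      = inner ℝ (gradX f x y) u + inner ℝ (gradY f x y) v := by
  have h0 := (hf (x, y)).hasFDerivAt
  have h1 := h0.comp x (hasFDerivAt_prodMk_left (𝕜 := ℝ) x y)
  have h2 := h0.comp y (hasFDerivAt_prodMk_right (𝕜 := ℝ) x y)
  have h3 := h1.unique (hasGradientAt_gradX hf x y).hasFDerivAt
  have h4 := h2.unique (hasGradientAt_gradY hf x y).hasFDerivAt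
  have h5 := congrArg (fun A => A u) h3
  have h6 := congrArg (fun A => A v) h4
  simp only [ContinuousLinearMap.comp_apply, ContinuousLinearMap.inl_apply,
    ContinuousLinearMap.inr_apply, InnerProductSpace.toDual_apply_apply] at h5 h6
  rw [← h5, ← h6, ← map_add]
  simp

variable {L : ℝ}
  (hL : ∀ x y x' y', ‖grad f x y - grad f x' y'‖ ≤ L * ‖pair x y - pair x' y'‖)
include hL

theorem norm_gradX_sub_le (hL0 : 0 ≤ L) (x x' : Vec dx) (y y' : Vec dy) :
    ‖gradX f x y - gradX f x' y'‖ ≤ L * (‖x - x'‖ + ‖y - y'‖) :=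
  (norm_fst_le_norm (grad f x y - grad f x' y')).trans <| (hL x y x' y').trans <| by
    gcongr; exact norm_pair_sub_le _ _ _ _

theorem norm_gradY_sub_le (hL0 : 0 ≤ L) (x x' : Vec dx) (y y' : Vec dy) :
    ‖gradY f x y - gradY f x' y'‖ ≤ L * (‖x - x'‖ + ‖y - y'‖) :=
  (norm_snd_le_norm (grad f x y - grad f x' y')).trans <| (hL x y x' y').trans <| by
    gcongr; exact norm_pair_sub_le _ _ _ _

end Partial

/-! ### Symmetry of second derivatives. -/

section MixedDerivatives

variable {dx dy : ℕ} {g : Vec dx → Vec dy → ℝ}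

/-- `D_y gradX g` is the adjoint of `D_x gradY g` when the latter is continuous; here in the
quantitative form for a Lipschitz mixed derivative. -/
theorem norm_gradX_add_sub_sub_adjoint_le
    (hg : Differentiable ℝ (fun z : Vec dx × Vec dy => g z.1 z.2))
    (hg' : Differentiable ℝ (fun z : Vec dx × Vec dy => gradY g z.1 z.2)) {L : ℝ}
    (hL0 : 0 ≤ L)
    (hL : ∀ x y x' y', ‖fderiv ℝ (fun u => gradY g u y) x - fderiv ℝ (fun u => gradY g u y') x'‖
      ≤ L * ‖pair x y - pair x' y'‖) (x : Vec dx) (y v : Vec dy) :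
    ‖gradX g x (y + v) - gradX g x y
      - ContinuousLinearMap.adjoint (fderiv ℝ (fun u => gradY g u y) x) v‖ ≤ L * ‖v‖ ^ 2 := by
  set B := fderiv ℝ (fun u => gradY g u y) x with hB
  -- The defect itself serves as the direction in `x`. The mixed second difference of `g` along `t •
  -- w` and `v` is estimated through `gradY`; divided by `t`, it tends to an inner product with `w`
  -- that equals `‖w‖ ^ 2`.
  set w := gradX g x (y + v) - gradX g x y - ContinuousLinearMap.adjoint B v with hw
  have hsec : ∀ t : ℝ, 0 ≤ t → ∀ r ∈ Set.Icc (0 : ℝ) 1,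
      ‖gradY g (x + t • w) (y + r • v) - gradY g x (y + r • v) - B (t • w)‖
        ≤ L * (t * ‖w‖ + ‖v‖) * (t * ‖w‖) := by
    intro t ht r hr
    have hd : ∀ u ∈ segment ℝ x (x + t • w),
        HasFDerivWithinAt (fun u => gradY g u (y + r • v) - B u)
          (fderiv ℝ (fun u => gradY g u (y + r • v)) u - B) (segment ℝ x (x + t • w)) u := by
      intro u _
      have h1 : DifferentiableAt ℝ (fun u => gradY g u (y + r • v)) u :=
        DifferentiableAt.comp (g := fun z : Vec dx × Vec dy => gradY g z.1 z.2)
          (f := fun u => (u, y + r • v)) u (hg' _) (by fun_prop)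
      exact (h1.hasFDerivAt.sub B.hasFDerivAt).hasFDerivWithinAt
    have hb : ∀ u ∈ segment ℝ x (x + t • w),
        ‖fderiv ℝ (fun u => gradY g u (y + r • v)) u - B‖ ≤ L * (t * ‖w‖ + ‖v‖) := by
      rintro u ⟨a, b, ha, hb, hab, rfl⟩
      refine (hL _ _ _ _).trans ?_
      gcongr
      refine (norm_pair_sub_le _ _ _ _).trans ?_
      have h1 : a • x + b • (x + t • w) - x = (b * t) • w := by
        rw [show a = 1 - b by linarith]; module
      rw [h1, add_sub_cancel_left, norm_smul, norm_smul, Real.norm_of_nonneg hr.1,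
        Real.norm_of_nonneg (by positivity)]
      gcongr
      · nlinarith
      · exact mul_le_of_le_one_left (norm_nonneg _) hr.2
    have h3 := (convex_segment x (x + t • w)).norm_image_sub_le_of_norm_hasFDerivWithin_le hd hb
      (left_mem_segment ℝ _ _) (right_mem_segment ℝ _ _)
    rw [add_sub_cancel_left, norm_smul, Real.norm_of_nonneg ht] at h3
    have h4 : gradY g (x + t • w) (y + r • v) - B (x + t • w) - (gradY g x (y + r • v) - B x)
        = gradY g (x + t • w) (y + r • v) - gradY g x (y + r • v) - B (t • w) := by
      rw [map_add]; abel
    rwa [h4] at h3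
  have hfirst : ∀ t : ℝ, 0 ≤ t →
      |g (x + t • w) (y + v) - g x (y + v) - (g (x + t • w) y - g x y) - inner ℝ (B (t • w)) v|
        ≤ L * (t * ‖w‖ + ‖v‖) * (t * ‖w‖) * ‖v‖ := by
    intro t ht
    -- `hsec` bounds the derivative in `r` along the segment from `y` to `y + v`.
    have hd : ∀ r ∈ Set.Icc (0 : ℝ) 1, HasDerivWithinAt
        (fun r : ℝ => g (x + t • w) (y + r • v) - g x (y + r • v) - r * inner ℝ (B (t • w)) v)
        (inner ℝ (gradY g (x + t • w) (y + r • v) - gradY g x (y + r • v) - B (t • w)) v)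
        (Set.Icc 0 1) r := by
      intro r _
      have hl : HasDerivAt (fun r : ℝ => y + r • v) v r := by
        simpa using ((hasDerivAt_id r).smul_const v).const_add y
      have h1 := (hasGradientAt_gradY hg (x + t • w) (y + r • v)).hasFDerivAt.comp_hasDerivAt r hl
      have h2 := (hasGradientAt_gradY hg x (y + r • v)).hasFDerivAt.comp_hasDerivAt r hl
      have h3 := ((h1.sub h2).sub ((hasDerivAt_id r).mul_const (inner ℝ (B (t • w)) v)))
      refine (h3.congr_deriv ?_).hasDerivWithinAt
      simp [inner_sub_left]
    have h3 := norm_image_sub_le_of_norm_deriv_le_segment_01' hd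
      (C := L * (t * ‖w‖ + ‖v‖) * (t * ‖w‖) * ‖v‖) (fun r hr => by
        refine (norm_inner_le_norm _ _).trans ?_
        gcongr
        exact hsec t ht r ⟨hr.1, hr.2.le⟩)
    rw [Real.norm_eq_abs] at h3
    convert h3 using 2
    simp; ring
  -- divide by `t` and let `t → 0`
  have hlim : ‖w‖ ^ 2 ≤ L * ‖v‖ * ‖w‖ * ‖v‖ := by
    have hl : HasDerivAt (fun t : ℝ => x + t • w) w 0 := by
      simpa using ((hasDerivAt_id (0 : ℝ)).smul_const w).const_add x
    have hx0 : x + (0 : ℝ) • w = x := by simp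
    have h1 := (hx0.symm ▸ hasGradientAt_gradX hg x (y + v)
      : HasGradientAt (fun u => g u (y + v)) (gradX g x (y + v))
        (x + (0 : ℝ) • w)).hasFDerivAt.comp_hasDerivAt (0 : ℝ) hl
    have h2 := (hx0.symm ▸ hasGradientAt_gradX hg x y
      : HasGradientAt (fun u => g u y) (gradX g x y)
        (x + (0 : ℝ) • w)).hasFDerivAt.comp_hasDerivAt (0 : ℝ) hl
    have h3 := (h1.sub h2).sub ((hasDerivAt_id (0 : ℝ)).mul_const (inner ℝ (B w) v))
    have h4 := h3.tendsto_slope_zero_right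
    have h5 : Filter.Tendsto (fun t : ℝ => L * (t * ‖w‖ + ‖v‖) * ‖w‖ * ‖v‖)
        (nhdsWithin 0 (Set.Ioi 0)) (nhds (L * (0 * ‖w‖ + ‖v‖) * ‖w‖ * ‖v‖)) :=
      (Continuous.tendsto (by fun_prop) 0).mono_left nhdsWithin_le_nhds
    have h6 := le_of_tendsto_of_tendsto h4 h5 ?_
    · simp only [InnerProductSpace.toDual_apply_apply, one_mul, zero_mul, zero_add] at h6
      have h7 : inner ℝ (B w) v = inner ℝ (ContinuousLinearMap.adjoint B v) w := by
        rw [ContinuousLinearMap.adjoint_inner_left, real_inner_comm]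
      rw [h7, ← inner_sub_left, ← inner_sub_left, ← hw, real_inner_self_eq_norm_sq] at h6
      exact h6
    · filter_upwards [self_mem_nhdsWithin] with t ht
      have ht : 0 < t := ht
      have h8 := (abs_le.1 (hfirst t ht.le)).2
      rw [map_smul, inner_smul_left] at h8
      simp only [Function.comp_def, Pi.sub_apply, id, zero_add, zero_smul, add_zero, zero_mul,
        sub_zero, smul_eq_mul]
      rw [inv_mul_le_iff₀ ht]
      simp only [conj_trivial] at h8
      linarith
  have h0 := norm_nonneg w
  rcases h0.eq_or_lt with h | h
  · rw [← h]; positivity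
  · nlinarith

/-- The derivative of `gradX g` in `y` is the adjoint of the derivative of `gradY g` in `x`. -/
theorem hasFDerivAt_gradX_snd
    (hg : Differentiable ℝ (fun z : Vec dx × Vec dy => g z.1 z.2))
    (hg' : Differentiable ℝ (fun z : Vec dx × Vec dy => gradY g z.1 z.2)) {L : ℝ}
    (hL0 : 0 ≤ L)
    (hL : ∀ x y x' y', ‖fderiv ℝ (fun u => gradY g u y) x - fderiv ℝ (fun u => gradY g u y') x'‖
      ≤ L * ‖pair x y - pair x' y'‖) (x : Vec dx) (y : Vec dy) :
    HasFDerivAt (gradX g x) (ContinuousLinearMap.adjoint (fderiv ℝ (fun u => gradY g u y) x)) y := by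
  rw [hasFDerivAt_iff_isLittleO_nhds_zero]
  refine Asymptotics.IsBigO.trans_isLittleO (g := fun v : Vec dy => ‖v‖ ^ 2) ?_ ?_
  · refine Asymptotics.IsBigO.of_bound L (Filter.Eventually.of_forall fun v => ?_)
    rw [Real.norm_of_nonneg (by positivity)]
    exact norm_gradX_add_sub_sub_adjoint_le hg hg' hL0 hL x y v
  · exact Asymptotics.isLittleO_norm_pow_id one_lt_two

/-- A derivative of a gradient is a symmetric operator. -/
theorem inner_fderiv_gradY_comm
    (hg : Differentiable ℝ (fun z : Vec dx × Vec dy => g z.1 z.2))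
    (hg' : Differentiable ℝ (fun z : Vec dx × Vec dy => gradY g z.1 z.2))
    (x : Vec dx) (y v w : Vec dy) :
    inner ℝ (fderiv ℝ (gradY g x) y v) w = inner ℝ v (fderiv ℝ (gradY g x) y w) := by
  have h1 : DifferentiableAt ℝ (gradY g x) y :=
    DifferentiableAt.comp (g := fun z : Vec dx × Vec dy => gradY g z.1 z.2)
      (f := fun v => (x, v)) y (hg' _) (by fun_prop)
  have h2 : HasFDerivAt (fun z => innerSL ℝ (gradY g x z))
      ((innerSL ℝ).comp (fderiv ℝ (gradY g x) y)) y :=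
    (innerSL ℝ).hasFDerivAt.comp y h1.hasFDerivAt
  have h3 := second_derivative_symmetric (f := g x) (f' := fun z => innerSL ℝ (gradY g x z))
    (fun z => (hasGradientAt_gradY hg x z).hasFDerivAt) h2 v w
  simp only [ContinuousLinearMap.comp_apply, innerSL_apply_apply] at h3
  rw [h3, real_inner_comm]

end MixedDerivatives

/-! ### The penalized problem, the implicit derivative of `y*`, and smoothness of `φ`. -/

section Class

variable {dx dy p : ℕ} {L : ℕ → ℝ} {μ Δ : ℝ} {f g : Vec dx → Vec dy → ℝ} {x₀ : Vec dx}

/-- The penalized lower-level objective `lam * f + g`. -/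
def tilt (f g : Vec dx → Vec dy → ℝ) (lam : ℝ) (x : Vec dx) (y : Vec dy) : ℝ :=
  lam * f x y + g x y

/-- The gradient in `y` of `tilt f g lam`. -/
def tiltGrad (f g : Vec dx → Vec dy → ℝ) (lam : ℝ) (x : Vec dx) (y : Vec dy) : Vec dy :=
  lam • gradY f x y + gradY g x y

/-- The minimizer in `y` of `tilt f g lam`. -/
def tiltSol (f g : Vec dx → Vec dy → ℝ) (lam : ℝ) (x : Vec dx) : Vec dy :=
  lowerSol (tilt f g lam) x

theorem tiltSol_zero (x : Vec dx) : tiltSol f g 0 x = lowerSol g x := by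
  unfold tiltSol
  congr
  ext x y
  simp [tilt]

theorem le_Lbar {j : ℕ} (hj : j ≤ p + 1) : L j ≤ Lbar p L :=
  Finset.le_sup' L (Finset.mem_range.2 (by omega))

/-- The second derivative in `y` of `g` at the lower-level solution. -/
def hess (g : Vec dx → Vec dy → ℝ) (x : Vec dx) : Vec dy →L[ℝ] Vec dy :=
  fderiv ℝ (gradY g x) (lowerSol g x)

/-- The mixed second derivative of `g` at the lower-level solution. -/
def mixed (g : Vec dx → Vec dy → ℝ) (x : Vec dx) : Vec dx →L[ℝ] Vec dy :=
  fderiv ℝ (fun u => gradY g u (lowerSol g x)) x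

/-- The formula for the gradient of the hyper-objective that the implicit function theorem
gives. -/
def hyperGrad (f g : Vec dx → Vec dy → ℝ) (x : Vec dx) : Vec dx :=
  gradX f x (lowerSol g x)
    - ContinuousLinearMap.adjoint (mixed g x) ((hess g x).inverse (gradY f x (lowerSol g x)))

namespace ProblemClass

variable (hpc : ProblemClass p L μ Δ f g x₀)
include hpc

theorem L1_pos : 0 < L 1 := hpc.L_pos 1 (by omega)

theorem Lbar_pos : 0 < Lbar p L := (hpc.L_pos 0 (by omega)).trans_le (le_Lbar (by omega))

theorem cond_pos : 0 < cond p L μ := div_pos hpc.Lbar_pos hpc.μ_pos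

theorem one_le_cond : 1 ≤ cond p L μ := by
  rw [cond, one_le_div hpc.μ_pos]
  exact hpc.μ_le.trans (le_Lbar (by omega))

theorem le_cond_mul {j : ℕ} (hj : j ≤ p + 1) : L j ≤ cond p L μ * μ := by
  rw [cond, div_mul_cancel₀ _ hpc.μ_pos.ne']
  exact le_Lbar hj

theorem Lbar_eq : Lbar p L = cond p L μ * μ := by
  rw [cond, div_mul_cancel₀ _ hpc.μ_pos.ne']

theorem strongConvexGrad (x : Vec dx) : StrongConvexGrad μ (g x) (gradY g x) :=
  ⟨hpc.μ_pos, hasGradientAt_gradY hpc.g_diff x, hpc.strongConvex x⟩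

theorem norm_gradY_f_le (x : Vec dx) (y : Vec dy) : ‖gradY f x y‖ ≤ L 0 := by
  have h := (hasGradientAt_gradY hpc.f_diff x y).hasFDerivAt
  have h0 : 0 ≤ L 0 := (hpc.L_pos 0 (by omega)).le
  have := h.le_of_lip' h0 (Filter.Eventually.of_forall fun y' => hpc.f_lip x y' y)
  simpa using this

theorem abs_le_of_mul_le {lam : ℝ} (hlam : |lam| * L 1 ≤ μ / 4) : |lam| ≤ 1 := by
  have := hpc.L1_pos
  have := hpc.μ_le
  by_contra! h
  nlinarith

/-- The term `lam * f` bends by at most `|lam| L_1 ‖y - z‖²`, hence takes at most `μ / 4` from the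
coefficient `μ / 2` of `g`. The threshold `μ / 4` is chosen for this. -/
theorem tilt_strongConvexGrad {lam : ℝ} (hlam : |lam| * L 1 ≤ μ / 4) (x : Vec dx) :
    StrongConvexGrad (μ / 2) (tilt f g lam x) (tiltGrad f g lam x) := by
  have hμ := hpc.μ_pos
  refine ⟨by positivity, fun y => ?_, fun y z => ?_⟩
  · have h1 := (hasGradientAt_gradY hpc.f_diff x y).hasFDerivAt.const_mul lam
    have h2 := (hasGradientAt_gradY hpc.g_diff x y).hasFDerivAt
    rw [hasGradientAt_iff_hasFDerivAt]
    refine (h1.add h2).congr_fderiv ?_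
    simp [tiltGrad]
  · have h1 := hpc.strongConvex x y z
    have h2 := abs_sub_sub_inner_le (hasGradientAt_gradY hpc.f_diff x)
      (fun y y' => by
        have := norm_gradY_sub_le hpc.gradf_lip hpc.L1_pos.le x x y y'
        rwa [sub_self, norm_zero, zero_add] at this) y z
    rw [norm_sub_rev z y] at h2
    have h3 : |lam * (f x z - f x y - inner ℝ (gradY f x y) (z - y))| ≤ μ / 4 * ‖y - z‖ ^ 2 := by
      rw [abs_mul]
      calc _ ≤ |lam| * (L 1 * ‖y - z‖ ^ 2) := by gcongr
        _ = |lam| * L 1 * ‖y - z‖ ^ 2 := by ring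
        _ ≤ _ := by gcongr
    have h4 := (abs_le.1 h3).1
    simp only [tilt, tiltGrad, inner_add_left, inner_smul_left, conj_trivial]
    linarith

theorem norm_tiltGrad_sub_le {lam : ℝ} (hlam : |lam| * L 1 ≤ μ / 4) (x x' : Vec dx)
    (y y' : Vec dy) :
    ‖tiltGrad f g lam x y - tiltGrad f g lam x' y'‖ ≤ 2 * L 1 * (‖x - x'‖ + ‖y - y'‖) := by
  have h1 := norm_gradY_sub_le hpc.gradf_lip hpc.L1_pos.le x x' y y'
  have h2 := norm_gradY_sub_le hpc.gradg_lip hpc.L1_pos.le x x' y y'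
  have h3 := hpc.abs_le_of_mul_le hlam
  have h4 : tiltGrad f g lam x y - tiltGrad f g lam x' y'
      = lam • (gradY f x y - gradY f x' y') + (gradY g x y - gradY g x' y') := by
    simp only [tiltGrad]; module
  rw [h4]
  refine (norm_add_le _ _).trans ?_
  rw [norm_smul, Real.norm_eq_abs]
  nlinarith [norm_nonneg (gradY f x y - gradY f x' y')]

theorem tilt_tiltSol_le {lam : ℝ} (hlam : |lam| * L 1 ≤ μ / 4) (x : Vec dx) :
    ∀ z, tilt f g lam x (tiltSol f g lam x) ≤ tilt f g lam x z :=
  Classical.epsilon_spec (p := fun y => ∀ z, tilt f g lam x y ≤ tilt f g lam x z)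
    (hpc.tilt_strongConvexGrad hlam x).exists_min

theorem tiltGrad_tiltSol {lam : ℝ} (hlam : |lam| * L 1 ≤ μ / 4) (x : Vec dx) :
    tiltGrad f g lam x (tiltSol f g lam x) = 0 :=
  (hpc.tilt_strongConvexGrad hlam x).grad_eq_zero (hpc.tilt_tiltSol_le hlam x)

theorem zero_mul_le : |(0 : ℝ)| * L 1 ≤ μ / 4 := by
  have := hpc.μ_pos
  simp; positivity

theorem gradY_lowerSol (x : Vec dx) : gradY g x (lowerSol g x) = 0 := by
  have := hpc.tiltGrad_tiltSol hpc.zero_mul_le x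
  simpa [tiltGrad, tiltSol_zero] using this

/-- At the minimizer for `x'`, the gradient taken at `x` is its own change from `x'` to `x`, at most
`2 L_1 ‖x - x'‖`; dividing by the convexity `μ / 2` gives the constant. -/
theorem norm_tiltSol_sub_le {lam : ℝ} (hlam : |lam| * L 1 ≤ μ / 4) (x x' : Vec dx) :
    ‖tiltSol f g lam x - tiltSol f g lam x'‖ ≤ 4 * (L 1 / μ) * ‖x - x'‖ := by
  have h1 := (hpc.tilt_strongConvexGrad hlam x).mul_norm_sub_le (tiltSol f g lam x)
    (tiltSol f g lam x')
  rw [hpc.tiltGrad_tiltSol hlam, ← hpc.tiltGrad_tiltSol hlam x'] at h1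
  have h2 := hpc.norm_tiltGrad_sub_le hlam x' x (tiltSol f g lam x') (tiltSol f g lam x')
  rw [sub_self (tiltSol f g lam x'), norm_zero, add_zero, norm_sub_rev x' x] at h2
  have hμ := hpc.μ_pos
  have h3 : 4 * (L 1 / μ) * ‖x - x'‖ = 2 * L 1 * ‖x - x'‖ / (μ / 2) := by field_simp; ring
  rw [h3, le_div_iff₀ (by positivity)]
  linarith

theorem norm_lowerSol_sub_le (x x' : Vec dx) :
    ‖lowerSol g x - lowerSol g x'‖ ≤ 4 * (L 1 / μ) * ‖x - x'‖ := by
  have := hpc.norm_tiltSol_sub_le hpc.zero_mul_le x x'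
  simpa only [tiltSol_zero] using this

theorem norm_tiltSol_sub_lowerSol_le {lam : ℝ} (hlam : |lam| * L 1 ≤ μ / 4) (x : Vec dx) :
    ‖tiltSol f g lam x - lowerSol g x‖ ≤ 2 * |lam| * (L 0 / μ) := by
  have h1 := (hpc.tilt_strongConvexGrad hlam x).mul_norm_sub_le (tiltSol f g lam x)
    (lowerSol g x)
  have h2 : tiltGrad f g lam x (lowerSol g x) = lam • gradY f x (lowerSol g x) := by
    simp [tiltGrad, hpc.gradY_lowerSol]
  rw [hpc.tiltGrad_tiltSol hlam, h2, zero_sub, norm_neg, norm_smul, Real.norm_eq_abs] at h1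
  have hμ := hpc.μ_pos
  have h3 : 2 * |lam| * (L 0 / μ) = |lam| * L 0 / (μ / 2) := by field_simp
  rw [h3, le_div_iff₀ (by positivity)]
  have := hpc.norm_gradY_f_le x (lowerSol g x)
  nlinarith [abs_nonneg lam]

theorem differentiableAt_gradY_snd (x : Vec dx) (y : Vec dy) :
    DifferentiableAt ℝ (gradY g x) y :=
  DifferentiableAt.comp (g := fun z : Vec dx × Vec dy => gradY g z.1 z.2)
    (f := fun v => (x, v)) y (hpc.gradYg_diff _) (by fun_prop)

theorem differentiableAt_gradY_fst (x : Vec dx) (y : Vec dy) :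
    DifferentiableAt ℝ (fun u => gradY g u y) x :=
  DifferentiableAt.comp (g := fun z : Vec dx × Vec dy => gradY g z.1 z.2)
    (f := fun v => (v, y)) x (hpc.gradYg_diff _) (by fun_prop)

theorem norm_mixed_le (x : Vec dx) : ‖mixed g x‖ ≤ L 1 := by
  refine (hpc.differentiableAt_gradY_fst x (lowerSol g x)).hasFDerivAt.le_of_lip' hpc.L1_pos.le
    (Filter.Eventually.of_forall fun x' => ?_)
  have := norm_gradY_sub_le hpc.gradg_lip hpc.L1_pos.le x' x (lowerSol g x) (lowerSol g x)
  rwa [sub_self (lowerSol g x), norm_zero, add_zero] at this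

theorem le_inner_hess (x : Vec dx) (v : Vec dy) :
    μ * ‖v‖ ^ 2 ≤ inner ℝ (hess g x v) v := by
  set y := lowerSol g x
  have hl : HasDerivAt (fun t : ℝ => y + t • v) v 0 := by
    simpa using ((hasDerivAt_id (0 : ℝ)).smul_const v).const_add y
  have h1 : HasFDerivAt (gradY g x) (hess g x) (y + (0 : ℝ) • v) := by
    rw [zero_smul, add_zero]
    exact (hpc.differentiableAt_gradY_snd x y).hasFDerivAt
  have h2 := (h1.comp_hasDerivAt (0 : ℝ) hl).tendsto_slope_zero_right
  have h3 : Filter.Tendsto (fun t : ℝ => inner ℝ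
      (t⁻¹ • ((gradY g x ∘ fun t : ℝ => y + t • v) (0 + t)
        - (gradY g x ∘ fun t : ℝ => y + t • v) 0)) v) (nhdsWithin 0 (Set.Ioi 0))
      (nhds (inner ℝ (hess g x v) v)) := h2.inner tendsto_const_nhds
  refine ge_of_tendsto h3 ?_
  filter_upwards [self_mem_nhdsWithin] with t ht
  have ht : 0 < t := ht
  have h4 := (hpc.strongConvexGrad x).mono (y + t • v) y
  simp only [add_sub_cancel_left, norm_smul, inner_smul_right, Real.norm_of_nonneg ht.le] at h4
  simp only [Function.comp_apply, zero_add, zero_smul, add_zero, inner_smul_left, conj_trivial]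
  rw [inv_mul_eq_div, le_div_iff₀ ht]
  have h5 : t * (μ * ‖v‖ ^ 2 * t) ≤ t * inner ℝ (gradY g x (y + t • v) - gradY g x y) v := by
    linarith
  exact le_of_mul_le_mul_left h5 ht

theorem mul_norm_le_hess (x : Vec dx) (v : Vec dy) : μ * ‖v‖ ≤ ‖hess g x v‖ := by
  have h1 := hpc.le_inner_hess x v
  have h2 := real_inner_le_norm (hess g x v) v
  rcases (norm_nonneg v).eq_or_lt with h0 | h0
  · rw [← h0, mul_zero]; exact norm_nonneg _
  · nlinarith

theorem hess_isInvertible (x : Vec dx) : (hess g x).IsInvertible := by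
  have hinj : Function.Injective (hess g x : Vec dy →ₗ[ℝ] Vec dy) := by
    rw [← LinearMap.ker_eq_bot, LinearMap.ker_eq_bot']
    intro v hv
    have h1 := hpc.mul_norm_le_hess x v
    have h2 : hess g x v = 0 := hv
    rw [h2, norm_zero] at h1
    have h3 : ‖v‖ ≤ 0 := by have := hpc.μ_pos; nlinarith [norm_nonneg v]
    exact norm_le_zero_iff.1 h3
  exact ⟨(LinearEquiv.ofInjectiveEndo _ hinj).toContinuousLinearEquiv, by ext v; rfl⟩

theorem hess_inverse_apply (x : Vec dx) (v : Vec dy) :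
    hess g x ((hess g x).inverse v) = v := by
  obtain ⟨e, he⟩ := hpc.hess_isInvertible x
  rw [← he, ContinuousLinearMap.inverse_equiv]
  simp

theorem inverse_hess_apply (x : Vec dx) (v : Vec dy) :
    (hess g x).inverse (hess g x v) = v := by
  obtain ⟨e, he⟩ := hpc.hess_isInvertible x
  rw [← he, ContinuousLinearMap.inverse_equiv]
  simp

theorem norm_inverse_hess_apply_le (x : Vec dx) (v : Vec dy) :
    ‖(hess g x).inverse v‖ ≤ μ⁻¹ * ‖v‖ := by
  have h1 := hpc.mul_norm_le_hess x ((hess g x).inverse v)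
  rw [hpc.hess_inverse_apply] at h1
  have hμ := hpc.μ_pos
  rw [inv_mul_eq_div, le_div_iff₀ hμ]
  linarith

theorem inner_inverse_hess_comm (x : Vec dx) (v w : Vec dy) :
    inner ℝ ((hess g x).inverse v) w = inner ℝ v ((hess g x).inverse w) := by
  conv_lhs => rw [← hpc.hess_inverse_apply x w]
  conv_rhs => rw [← hpc.hess_inverse_apply x v]
  exact (inner_fderiv_gradY_comm hpc.g_diff hpc.gradYg_diff x _ _ _).symm

/-- `gradY g` vanishes at both `(x, y*(x))` and `(x', y*(x'))`, so its linearization applied to the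
displacement is `o` of the displacement. The Lipschitz bound on `y*` turns this into `o(‖x' - x‖)`,
and the inverse Hessian solves for the change of `y*`. Differentiability at the single point
suffices. -/
theorem hasFDerivAt_lowerSol (x : Vec dx) :
    HasFDerivAt (lowerSol g) (-((hess g x).inverse.comp (mixed g x))) x := by
  set ys := lowerSol g with hys
  have h1 := (hpc.gradYg_diff (x, ys x)).hasFDerivAt
  have hB := (HasFDerivAt.comp (f := fun u => (u, ys x)) x h1
    (hasFDerivAt_prodMk_left (𝕜 := ℝ) x (ys x))).unique
    (hpc.differentiableAt_gradY_fst x (ys x)).hasFDerivAt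
  have hH := (HasFDerivAt.comp (f := fun v => (x, v)) (ys x) h1
    (hasFDerivAt_prodMk_right (𝕜 := ℝ) x (ys x))).unique
    (hpc.differentiableAt_gradY_snd x (ys x)).hasFDerivAt
  set D := fderiv ℝ (fun z : Vec dx × Vec dy => gradY g z.1 z.2) (x, ys x)
  have hD : ∀ u v, D (u, v) = mixed g x u + hess g x v := by
    intro u v
    have h5 : mixed g x u = D (u, 0) := by
      unfold mixed; rw [← hys, ← hB]; simp
    have h6 : hess g x v = D (0, v) := by
      unfold hess; rw [← hys, ← hH]; simp
    rw [h5, h6, ← map_add]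
    simp
  have hO : (fun x' => ((x', ys x') : Vec dx × Vec dy) - (x, ys x)) =O[nhds x]
      fun x' => x' - x := by
    have hr : 0 ≤ 4 * (L 1 / μ) := by have := hpc.L1_pos; have := hpc.μ_pos; positivity
    refine Asymptotics.IsBigO.of_bound (1 + 4 * (L 1 / μ)) (Filter.Eventually.of_forall fun x' => ?_)
    rw [Prod.mk_sub_mk, Prod.norm_mk]
    have := hpc.norm_lowerSol_sub_le x' x
    rw [← hys] at this
    have h0 := norm_nonneg (x' - x)
    exact max_le (by nlinarith) (by nlinarith)
  have htend : Filter.Tendsto (fun x' => ((x', ys x') : Vec dx × Vec dy)) (nhds x)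
      (nhds (x, ys x)) := by
    rw [tendsto_iff_norm_sub_tendsto_zero]
    have h2 : Filter.Tendsto (fun x' : Vec dx => x' - x) (nhds x) (nhds 0) := by
      have := (continuous_sub_right x).tendsto x
      simpa using this
    exact (hO.trans_tendsto h2).norm.trans (by simp)
  have ho := ((hasFDerivAt_iff_isLittleO.1 h1).comp_tendsto htend).trans_isBigO hO
  rw [hasFDerivAt_iff_isLittleO]
  refine Asymptotics.IsBigO.trans_isLittleO (Asymptotics.IsBigO.of_bound μ⁻¹
    (Filter.Eventually.of_forall fun x' => ?_)) ho
  have h7 : ys x' - ys x - (-((hess g x).inverse.comp (mixed g x))) (x' - x)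
      = (hess g x).inverse (mixed g x (x' - x) + hess g x (ys x' - ys x)) := by
    rw [map_add, hpc.inverse_hess_apply]
    simp
    abel
  rw [h7]
  refine (hpc.norm_inverse_hess_apply_le x _).trans ?_
  simp only [Function.comp_apply, Prod.mk_sub_mk, hD, hys, hpc.gradY_lowerSol, sub_zero,
    zero_sub, norm_neg]
  rfl

theorem hasGradientAt_hyperObj (x : Vec dx) :
    HasGradientAt (hyperObj f g) (hyperGrad f g x) x := by
  rw [hasGradientAt_iff_hasFDerivAt]
  have h1 : HasFDerivAt (fun x' => (x', lowerSol g x'))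
      ((ContinuousLinearMap.id ℝ (Vec dx)).prod (-((hess g x).inverse.comp (mixed g x)))) x :=
    (hasFDerivAt_id x).prodMk (hpc.hasFDerivAt_lowerSol x)
  have h2 := (hpc.f_diff (x, lowerSol g x)).hasFDerivAt.comp x h1
  refine h2.congr_fderiv ?_
  ext u
  rw [ContinuousLinearMap.comp_apply, ContinuousLinearMap.prod_apply, fderiv_uncurry_apply hpc.f_diff]
  simp only [InnerProductSpace.toDual_apply_apply, hyperGrad, inner_sub_left,
    ContinuousLinearMap.adjoint_inner_left, hpc.inner_inverse_hess_comm]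
  simp [sub_eq_add_neg]

theorem gradient_hyperObj (x : Vec dx) : gradient (hyperObj f g) x = hyperGrad f g x :=
  (hpc.hasGradientAt_hyperObj x).gradient

/-- The factors of `hyperGrad` are changed one at a time. Each of the four resulting terms is at
most `5 L_1 κ³ ‖x - x'‖`; the change of the inverse Hessian is the one that needs the full power
`κ³`. -/
theorem norm_hyperGrad_sub_le (hp : 1 ≤ p) (x x' : Vec dx) :
    ‖hyperGrad f g x - hyperGrad f g x'‖ ≤ 20 * (L 1 * cond p L μ ^ 3) * ‖x - x'‖ := by
  have hμ := hpc.μ_pos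
  have hL1 := hpc.L1_pos
  have hκ := hpc.one_le_cond
  set κ := cond p L μ
  have h0κ : L 0 ≤ κ * μ := hpc.le_cond_mul (by omega)
  have h1κ : L 1 ≤ κ * μ := hpc.le_cond_mul (by omega)
  have hL0 := hpc.L_pos 0 (by omega)
  have hμ1 := hpc.μ_le
  set δ := ‖x - x'‖ with hδ
  have hδ0 : 0 ≤ δ := norm_nonneg _
  -- A bound for the joint displacement of `(x, y*(x))`: the factor `1 + 4 L_1/μ` is at most `5
  -- L_1/μ`, as `μ ≤ L_1`.
  set D := 5 * (L 1 / μ) * δ with hD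
  have hr1 : 1 ≤ L 1 / μ := (one_le_div hμ).2 hμ1
  have hrκ : L 1 / μ ≤ κ := (div_le_iff₀ hμ).2 h1κ
  have hD0 : 0 ≤ D := by positivity
  have hsum : ‖x - x'‖ + ‖lowerSol g x - lowerSol g x'‖ ≤ D := by
    have := hpc.norm_lowerSol_sub_le x x'
    rw [hD]; nlinarith
  have hp : ‖pair x (lowerSol g x) - pair x' (lowerSol g x')‖ ≤ D :=
    (norm_pair_sub_le _ _ _ _).trans hsum
  have hX : ‖gradX f x (lowerSol g x) - gradX f x' (lowerSol g x')‖ ≤ L 1 * D :=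
    (norm_gradX_sub_le hpc.gradf_lip hL1.le _ _ _ _).trans (by gcongr)
  have hY : ‖gradY f x (lowerSol g x) - gradY f x' (lowerSol g x')‖ ≤ L 1 * D :=
    (norm_gradY_sub_le hpc.gradf_lip hL1.le _ _ _ _).trans (by gcongr)
  obtain ⟨M, hM0, hMκ, hxy, hyy⟩ : ∃ M, 0 ≤ M ∧ M ≤ κ * μ ∧
      ‖mixed g x - mixed g x'‖ ≤ M * D ∧ ‖hess g x - hess g x'‖ ≤ M * D := by
    have hL2 := hpc.L_pos 2 (by omega)
    exact ⟨L 2, hL2.le, hpc.le_cond_mul (by omega),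
      (hpc.hessxy_lip _ _ _ _).trans (by gcongr), (hpc.hessyy_lip _ _ _ _).trans (by gcongr)⟩
  set w := gradY f x (lowerSol g x)
  set w' := gradY f x' (lowerSol g x')
  set Hi := (hess g x).inverse
  set Hi' := (hess g x').inverse
  have hw : ‖w‖ ≤ κ * μ := (hpc.norm_gradY_f_le _ _).trans h0κ
  have hHw : ‖Hi w‖ ≤ κ := (hpc.norm_inverse_hess_apply_le x w).trans <| by
    rw [inv_mul_le_iff₀ hμ]; linarith
  have hHd : ‖Hi w - Hi' w‖ ≤ μ⁻¹ * (M * D * κ) := by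
    -- The resolvent identity `A⁻¹ - B⁻¹ = B⁻¹ (B - A) A⁻¹`.
    have : Hi w - Hi' w = Hi' ((hess g x' - hess g x) (Hi w)) := by
      rw [_root_.sub_apply, map_sub, hpc.inverse_hess_apply, hpc.hess_inverse_apply]
    rw [this]
    refine (hpc.norm_inverse_hess_apply_le x' _).trans ?_
    gcongr
    refine (ContinuousLinearMap.le_opNorm _ _).trans ?_
    rw [norm_sub_rev]
    gcongr
  have hHd' : ‖Hi' w - Hi' w'‖ ≤ μ⁻¹ * (L 1 * D) := by
    rw [← map_sub]
    exact (hpc.norm_inverse_hess_apply_le x' _).trans (by gcongr)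
  have hadj : ∀ (A : Vec dx →L[ℝ] Vec dy) (v : Vec dy),
      ‖ContinuousLinearMap.adjoint A v‖ ≤ ‖A‖ * ‖v‖ := fun A v => by
    have := (ContinuousLinearMap.adjoint A).le_opNorm v
    rwa [LinearIsometryEquiv.norm_map] at this
  have hsplit : hyperGrad f g x - hyperGrad f g x'
      = (gradX f x (lowerSol g x) - gradX f x' (lowerSol g x'))
        - ContinuousLinearMap.adjoint (mixed g x - mixed g x') (Hi w)
        - ContinuousLinearMap.adjoint (mixed g x') (Hi w - Hi' w)
        - ContinuousLinearMap.adjoint (mixed g x') (Hi' w - Hi' w') := by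
    simp only [hyperGrad, map_sub, _root_.sub_apply]
    abel
  have t1 := hadj (mixed g x - mixed g x') (Hi w)
  have t2 := hadj (mixed g x') (Hi w - Hi' w)
  have t3 := hadj (mixed g x') (Hi' w - Hi' w')
  have hmix := hpc.norm_mixed_le x'
  have b1 : ‖mixed g x - mixed g x'‖ * ‖Hi w‖ ≤ 5 * (L 1 * κ ^ 3) * δ := by
    calc _ ≤ (κ * μ * D) * κ := by gcongr; exact hxy.trans (by gcongr)
      _ = 5 * (L 1 * κ ^ 2) * δ := by rw [hD]; field_simp
      _ ≤ _ := by gcongr; norm_num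
  have b2 : ‖mixed g x'‖ * ‖Hi w - Hi' w‖ ≤ 5 * (L 1 * κ ^ 3) * δ := by
    calc _ ≤ L 1 * (μ⁻¹ * (κ * μ * D * κ)) := by gcongr; exact hHd.trans (by gcongr)
      _ = 5 * (L 1 * (κ ^ 2 * (L 1 / μ))) * δ := by rw [hD]; field_simp
      _ ≤ 5 * (L 1 * (κ ^ 2 * κ)) * δ := by gcongr
      _ = _ := by ring
  have b3 : ‖mixed g x'‖ * ‖Hi' w - Hi' w'‖ ≤ 5 * (L 1 * κ ^ 3) * δ := by
    calc _ ≤ L 1 * (μ⁻¹ * (L 1 * D)) := by gcongr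
      _ = 5 * (L 1 * ((L 1 / μ) * (L 1 / μ))) * δ := by rw [hD]; field_simp
      _ ≤ 5 * (L 1 * (κ * κ)) * δ := by gcongr
      _ = 5 * (L 1 * κ ^ 2) * δ := by ring
      _ ≤ _ := by gcongr; norm_num
  have b0 : L 1 * D ≤ 5 * (L 1 * κ ^ 3) * δ := by
    calc _ = 5 * (L 1 * (L 1 / μ)) * δ := by rw [hD]; ring
      _ ≤ 5 * (L 1 * κ ^ 1) * δ := by rw [pow_one]; gcongr
      _ ≤ _ := by gcongr; norm_num
  rw [hsplit]
  refine (norm_sub_le _ _).trans ?_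
  refine (add_le_add_left (norm_sub_le _ _) _).trans ?_
  refine (add_le_add_left (add_le_add_left (norm_sub_le _ _) _) _).trans ?_
  linarith

end ProblemClass

end Class

/-! ### Order-`p` expansion of the penalized solution. -/

/-- The derivatives of `u` up to order `n` exist and are `K`-Lipschitz. -/
structure LipDerivs {E F : Type*} [NormedAddCommGroup E] [NormedSpace ℝ E]
    [NormedAddCommGroup F] [NormedSpace ℝ F] (n : ℕ) (K : ℝ) (u : E → F) : Prop where
  contDiff : ContDiff ℝ n u
  lip : ∀ q ≤ n, ∀ y y', ‖iteratedFDeriv ℝ q u y - iteratedFDeriv ℝ q u y'‖ ≤ K * ‖y - y'‖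

namespace LipDerivs

variable {E F G : Type*} [NormedAddCommGroup E] [NormedSpace ℝ E] [NormedAddCommGroup F]
  [NormedSpace ℝ F] [NormedAddCommGroup G] [NormedSpace ℝ G] {n : ℕ} {K : ℝ} {u : E → F}

theorem norm_le (H : LipDerivs n K u) (hK : 0 ≤ K) {q : ℕ} (hq : q < n) (y : E) :
    ‖iteratedFDeriv ℝ (q + 1) u y‖ ≤ K := by
  rw [← norm_fderiv_iteratedFDeriv]
  have h1 : ContDiffAt ℝ n u y := H.contDiff.contDiffAt
  have h2 : DifferentiableAt ℝ (iteratedFDeriv ℝ q u) y :=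
    h1.differentiableAt_iteratedFDeriv (by exact_mod_cast hq)
  exact h2.hasFDerivAt.le_of_lip' hK (Filter.Eventually.of_forall fun y' => H.lip q hq.le y' y)

theorem comp_left (H : LipDerivs n K u) (A : F →L[ℝ] G) (hA : ‖A‖ ≤ 1) :
    LipDerivs n K (fun y => A (u y)) := by
  refine ⟨A.contDiff.comp H.contDiff, fun q hq y y' => ?_⟩
  have hq' : (q : WithTop ℕ∞) ≤ n := by exact_mod_cast hq
  have h1 : ∀ y, iteratedFDeriv ℝ q (fun y => A (u y)) y
      = A.compContinuousMultilinearMap (iteratedFDeriv ℝ q u y) := fun y =>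
    A.iteratedFDeriv_comp_left H.contDiff.contDiffAt hq'
  have h2 : A.compContinuousMultilinearMap (iteratedFDeriv ℝ q u y)
      - A.compContinuousMultilinearMap (iteratedFDeriv ℝ q u y')
      = A.compContinuousMultilinearMap (iteratedFDeriv ℝ q u y - iteratedFDeriv ℝ q u y') := by
    ext m; simp
  rw [h1, h1, h2]
  refine (A.norm_compContinuousMultilinearMap_le _).trans ?_
  exact (mul_le_of_le_one_left (norm_nonneg _) hA).trans (H.lip q hq y y')

theorem taylor (H : LipDerivs n K u) {m : ℕ} (hm : m ≤ n) (y d : E) :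
    ‖u (y + d) - ∑ k ∈ Finset.range (m + 1),
      (k.factorial : ℝ)⁻¹ • iteratedFDeriv ℝ k u y (fun _ => d)‖ ≤ K * ‖d‖ ^ (m + 1) :=
  norm_sub_taylor_le (H.contDiff.of_le (by exact_mod_cast hm)) (H.lip m hm) y d

end LipDerivs

theorem HasExpansion.pow_smul {E : Type*} [NormedAddCommGroup E] [NormedSpace ℝ E] {s : Set ℝ}
    {n : ℕ} {C : ℝ} {h : ℝ → E} (hs : ∀ τ ∈ s, |τ| ≤ 1) (hC : 0 ≤ C) (H : HasExpansion s n C h)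
    (k : ℕ) : HasExpansion s n (2 ^ k * C) (fun τ => τ ^ k • h τ) := by
  cases k with
  | zero => simpa using H
  | succ k =>
    rw [pow_succ', mul_assoc]
    exact (H.pow_succ_smul hs hC k).pred hs (by positivity)

theorem multilinear_smul_diag {E F : Type*} [NormedAddCommGroup E] [NormedSpace ℝ E]
    [NormedAddCommGroup F] [NormedSpace ℝ F] {q : ℕ} (M : E [×q]→L[ℝ] F) (c : ℝ) (e : E) :
    M (fun _ => c • e) = c ^ q • M (fun _ => e) := by
  simpa using M.map_smul_univ (fun _ => c) (fun _ => e)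

theorem norm_iteratedFDeriv_zero_sub {E F : Type*} [NormedAddCommGroup E] [NormedSpace ℝ E]
    [NormedAddCommGroup F] [NormedSpace ℝ F] (u : E → F) (y y' : E) :
    ‖iteratedFDeriv ℝ 0 u y - iteratedFDeriv ℝ 0 u y'‖ = ‖u y - u y'‖ := by
  rw [iteratedFDeriv_zero_eq_comp]
  simp only [Function.comp_apply]
  rw [← map_sub, LinearIsometryEquiv.norm_map]

/-- The scaled dependence on the penalty of the penalized lower-level solution. -/
def scaledSol {dx dy : ℕ} (f g : Vec dx → Vec dy → ℝ) (κ : ℝ) (x : Vec dx) (τ : ℝ) : Vec dy :=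
  (κ / τ) • (tiltSol f g (τ / κ ^ 2) x - lowerSol g x)

/-- The range of the scaled penalties. -/
def scaledRange : Set ℝ := {τ | τ ≠ 0 ∧ |τ| ≤ 1 / 4}

theorem abs_le_one_of_mem_scaledRange : ∀ τ ∈ scaledRange, |τ| ≤ 1 := fun τ hτ =>
  hτ.2.trans (by norm_num)

namespace ProblemClass

variable {dx dy p : ℕ} {L : ℕ → ℝ} {μ Δ : ℝ} {f g : Vec dx → Vec dy → ℝ} {x₀ : Vec dx}
  (hpc : ProblemClass p L μ Δ f g x₀)
include hpc

theorem lipDerivs_grad_f (x : Vec dx) : LipDerivs (p - 1) (2 * Lbar p L) (grad f x) := by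
  have hLb := hpc.Lbar_pos
  refine ⟨hpc.f_high_diff x, fun q hq y y' => ?_⟩
  rcases q with _ | q
  · rw [norm_iteratedFDeriv_zero_sub]
    refine (hpc.gradf_lip x y x y').trans ?_
    have := norm_pair_sub_le x x y y'
    rw [sub_self, norm_zero, zero_add] at this
    have h1 : L 1 ≤ 2 * Lbar p L := by linarith [le_Lbar (p := p) (L := L) (j := 1) (by omega)]
    gcongr
  · refine (hpc.f_high_lip (q + 1) (by omega) hq x y y').trans ?_
    have h1 : L (q + 1 + 1) ≤ 2 * Lbar p L := by
      linarith [le_Lbar (p := p) (L := L) (j := q + 1 + 1) (by omega)]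
    gcongr

/-- The class controls the blocks `∇²_{xy} g` and `∇²_{yy} g` separately. The `x`-component of the
derivative of `∇g` in `y` is the adjoint of the first block; adding the two gives the factor 2 that
appears as `2 * Lbar` throughout. -/
theorem norm_fderiv_grad_g_sub_le (hp : 1 ≤ p) (x : Vec dx) (y y' : Vec dy) :
    ‖fderiv ℝ (grad g x) y - fderiv ℝ (grad g x) y'‖ ≤ 2 * L 2 * ‖y - y'‖ := by
  have hL2 := hpc.L_pos 2 (by omega)
  have hd : ∀ y, HasFDerivAt (grad g x) (fderiv ℝ (grad g x) y) y := fun y =>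
    ((hpc.g_high_diff x).differentiable (by exact_mod_cast (by omega : p ≠ 0)) y).hasFDerivAt
  have h1 : ∀ y, (WithLp.fstL 2 ℝ (Vec dx) (Vec dy)).comp (fderiv ℝ (grad g x) y)
      = ContinuousLinearMap.adjoint (fderiv ℝ (fun u => gradY g u y) x) := fun y =>
    ((WithLp.fstL 2 ℝ (Vec dx) (Vec dy)).hasFDerivAt.comp y (hd y)).unique
      (hasFDerivAt_gradX_snd hpc.g_diff hpc.gradYg_diff hL2.le hpc.hessxy_lip x y)
  have h2 : ∀ y, (WithLp.sndL 2 ℝ (Vec dx) (Vec dy)).comp (fderiv ℝ (grad g x) y)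
      = fderiv ℝ (gradY g x) y := fun y =>
    ((WithLp.sndL 2 ℝ (Vec dx) (Vec dy)).hasFDerivAt.comp y (hd y)).unique
      (hpc.differentiableAt_gradY_snd x y).hasFDerivAt
  have hp : ‖pair x y - pair x y'‖ ≤ ‖y - y'‖ := by
    simpa using norm_pair_sub_le x x y y'
  refine ContinuousLinearMap.opNorm_le_bound _ (by positivity) fun v => ?_
  refine (norm_le_fst_add_snd _).trans ?_
  have h3 : ((fderiv ℝ (grad g x) y - fderiv ℝ (grad g x) y') v).fst
      = ContinuousLinearMap.adjoint (fderiv ℝ (fun u => gradY g u y) x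
        - fderiv ℝ (fun u => gradY g u y') x) v := by
    rw [map_sub, _root_.sub_apply, ← h1, ← h1]
    rfl
  have h4 : ((fderiv ℝ (grad g x) y - fderiv ℝ (grad g x) y') v).snd
      = (fderiv ℝ (gradY g x) y - fderiv ℝ (gradY g x) y') v := by
    rw [_root_.sub_apply (f := fderiv ℝ (gradY g x) y), ← h2, ← h2]
    rfl
  rw [h3, h4]
  have h5 : ‖ContinuousLinearMap.adjoint (fderiv ℝ (fun u => gradY g u y) x
        - fderiv ℝ (fun u => gradY g u y') x) v‖ ≤ L 2 * ‖y - y'‖ * ‖v‖ := by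
    refine (ContinuousLinearMap.le_opNorm _ _).trans ?_
    rw [LinearIsometryEquiv.norm_map]
    gcongr
    exact (hpc.hessxy_lip _ _ _ _).trans (by gcongr)
  have h6 : ‖(fderiv ℝ (gradY g x) y - fderiv ℝ (gradY g x) y') v‖ ≤ L 2 * ‖y - y'‖ * ‖v‖ := by
    refine (ContinuousLinearMap.le_opNorm _ _).trans ?_
    gcongr
    exact (hpc.hessyy_lip _ _ _ _).trans (by gcongr)
  linarith

theorem lipDerivs_grad_g (hp : 1 ≤ p) (x : Vec dx) : LipDerivs p (2 * Lbar p L) (grad g x) := by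
  have hLb := hpc.Lbar_pos
  refine ⟨hpc.g_high_diff x, fun q hq y y' => ?_⟩
  rcases q with _ | _ | q
  · rw [norm_iteratedFDeriv_zero_sub]
    refine (hpc.gradg_lip x y x y').trans ?_
    have := norm_pair_sub_le x x y y'
    rw [sub_self, norm_zero, zero_add] at this
    have h1 : L 1 ≤ 2 * Lbar p L := by linarith [le_Lbar (p := p) (L := L) (j := 1) (by omega)]
    gcongr
  -- `g_high_lip` starts at order two; order one comes from the joint Lipschitz bounds on the
  -- Hessian blocks.
  · refine ContinuousMultilinearMap.opNorm_le_bound (by positivity) fun m => ?_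
    have h0 : (iteratedFDeriv ℝ (0 + 1) (grad g x) y - iteratedFDeriv ℝ (0 + 1) (grad g x) y') m
        = (fderiv ℝ (grad g x) y - fderiv ℝ (grad g x) y') (m 0) := by
      rw [_root_.sub_apply, _root_.sub_apply]
      exact congrArg₂ (· - ·) (iteratedFDeriv_one_apply m) (iteratedFDeriv_one_apply m)
    rw [h0, Fin.prod_univ_one]
    refine (ContinuousLinearMap.le_opNorm _ _).trans ?_
    have h1 : L 2 ≤ Lbar p L := le_Lbar (by omega)
    refine mul_le_mul_of_nonneg_right ?_ (norm_nonneg _)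
    exact (hpc.norm_fderiv_grad_g_sub_le hp x y y').trans (by gcongr)
  · refine (hpc.g_high_lip (q + 1) (by omega) (by omega) x y y').trans ?_
    have h1 : L (q + 1 + 2) ≤ 2 * Lbar p L := by
      linarith [le_Lbar (p := p) (L := L) (j := q + 1 + 2) (by omega)]
    gcongr

omit hpc in
theorem norm_fstL_le : ‖WithLp.fstL 2 ℝ (Vec dx) (Vec dy)‖ ≤ 1 :=
  ContinuousLinearMap.opNorm_le_bound _ zero_le_one fun z => by
    rw [one_mul]; exact norm_fst_le_norm z

omit hpc in
theorem norm_sndL_le : ‖WithLp.sndL 2 ℝ (Vec dx) (Vec dy)‖ ≤ 1 :=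
  ContinuousLinearMap.opNorm_le_bound _ zero_le_one fun z => by
    rw [one_mul]; exact norm_snd_le_norm z

theorem lipDerivs_gradX_f (x : Vec dx) : LipDerivs (p - 1) (2 * Lbar p L) (gradX f x) :=
  (hpc.lipDerivs_grad_f x).comp_left _ norm_fstL_le

theorem lipDerivs_gradY_f (x : Vec dx) : LipDerivs (p - 1) (2 * Lbar p L) (gradY f x) :=
  (hpc.lipDerivs_grad_f x).comp_left _ norm_sndL_le

theorem lipDerivs_gradX_g (hp : 1 ≤ p) (x : Vec dx) : LipDerivs p (2 * Lbar p L) (gradX g x) :=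
  (hpc.lipDerivs_grad_g hp x).comp_left _ norm_fstL_le

theorem lipDerivs_gradY_g (hp : 1 ≤ p) (x : Vec dx) : LipDerivs p (2 * Lbar p L) (gradY g x) :=
  (hpc.lipDerivs_grad_g hp x).comp_left _ norm_sndL_le

/-- This explains the bound `1 / 4` in `scaledRange`: since `L_1 ≤ κ μ ≤ κ² μ`, the penalty `τ / κ²`
stays under the threshold of strong convexity. -/
theorem abs_div_sq_mul_le {τ : ℝ} (hτ : |τ| ≤ 1 / 4) : |τ / cond p L μ ^ 2| * L 1 ≤ μ / 4 := by
  have hκ := hpc.one_le_cond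
  have h1 : L 1 ≤ cond p L μ * μ := hpc.le_cond_mul (by omega)
  have hμ := hpc.μ_pos
  rw [abs_div, abs_of_nonneg (by positivity : (0 : ℝ) ≤ cond p L μ ^ 2), div_mul_eq_mul_div,
    div_le_iff₀ (by positivity)]
  have h2 : L 1 ≤ cond p L μ ^ 2 * μ := h1.trans (by gcongr; nlinarith)
  have := hpc.L1_pos
  nlinarith [abs_nonneg τ]

/-- The scaling is chosen so that this bound contains no constant of the instance. -/
theorem norm_scaledSol_le {τ : ℝ} (hτ : τ ∈ scaledRange) (x : Vec dx) :
    ‖scaledSol f g (cond p L μ) x τ‖ ≤ 2 := by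
  have hκ := hpc.cond_pos
  have h1 := hpc.norm_tiltSol_sub_lowerSol_le (hpc.abs_div_sq_mul_le hτ.2) x
  have h2 : L 0 / μ ≤ cond p L μ := (div_le_iff₀ hpc.μ_pos).2 (hpc.le_cond_mul (by omega))
  have hτ0 : 0 < |τ| := abs_pos.2 hτ.1
  rw [scaledSol, norm_smul, Real.norm_eq_abs, abs_div, abs_of_pos hκ]
  rw [abs_div, abs_of_pos (by positivity : (0 : ℝ) < cond p L μ ^ 2)] at h1
  calc _ ≤ cond p L μ / |τ| * (2 * (|τ| / cond p L μ ^ 2) * cond p L μ) := by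
        gcongr; exact h1.trans (by gcongr)
    _ = 2 := by field_simp

omit hpc in
theorem tiltSol_eq_add {κ τ : ℝ} (hκ : κ ≠ 0) (hτ : τ ≠ 0) (x : Vec dx) :
    tiltSol f g (τ / κ ^ 2) x = lowerSol g x + (τ / κ) • scaledSol f g κ x τ := by
  rw [scaledSol, smul_smul, show τ / κ * (κ / τ) = 1 by field_simp, one_smul]
  abel

/-- The stationarity condition of the penalized problem, multiplied by `κ / τ`, with the linear part
of `gradY g` at `y*` moved to the other side and inverted. -/
theorem scaledSol_eq {τ : ℝ} (hτ : τ ∈ scaledRange) (x : Vec dx) :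
    scaledSol f g (cond p L μ) x τ = -(hess g x).inverse
      ((cond p L μ)⁻¹ • gradY f x (lowerSol g x + (τ / cond p L μ) • scaledSol f g (cond p L μ) x τ)
        + (cond p L μ / τ) • (gradY g x (lowerSol g x + (τ / cond p L μ) • scaledSol f g (cond p L μ) x τ)
          - hess g x ((τ / cond p L μ) • scaledSol f g (cond p L μ) x τ))) := by
  have hκ := hpc.cond_pos
  set κ := cond p L μ
  have h1 := hpc.tiltGrad_tiltSol (hpc.abs_div_sq_mul_le hτ.2) x
  have hτ0 := hτ.1
  rw [tiltGrad, tiltSol_eq_add hκ.ne' hτ0] at h1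
  set e := scaledSol f g κ x τ
  set w := gradY f x (lowerSol g x + (τ / κ) • e)
  set v := gradY g x (lowerSol g x + (τ / κ) • e)
  have h2 : v = -((τ / κ ^ 2) • w) := by
    rw [eq_neg_iff_add_eq_zero, add_comm]; exact h1
  have h3 : κ⁻¹ • w + (κ / τ) • (v - hess g x ((τ / κ) • e)) = -hess g x e := by
    rw [h2, map_smul, smul_sub, smul_neg, smul_smul, smul_smul,
      show κ / τ * (τ / κ ^ 2) = κ⁻¹ by field_simp, show κ / τ * (τ / κ) = 1 by field_simp]
    module
  rw [h3, map_neg, neg_neg, hpc.inverse_hess_apply]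

/-- The first-order approximation of `scaledSol` and the equations for the higher orders. -/
theorem norm_scaledSol_sub_sum_le (hp : 1 ≤ p) {τ : ℝ} (hτ : τ ∈ scaledRange) (x : Vec dx) {m : ℕ}
    (hm : m < p) :
    ‖scaledSol f g (cond p L μ) x τ - ∑ q ∈ Finset.range (m + 1), τ ^ q •
      ((-((cond p L μ)⁻¹ ^ (q + 1) * (q.factorial : ℝ)⁻¹)) • (hess g x).inverse
          (iteratedFDeriv ℝ q (gradY f x) (lowerSol g x)
            (fun _ => scaledSol f g (cond p L μ) x τ))
        + (if q = 0 then 0 else -((cond p L μ)⁻¹ ^ q * ((q + 1).factorial : ℝ)⁻¹)) •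
          (hess g x).inverse (iteratedFDeriv ℝ (q + 1) (gradY g x) (lowerSol g x)
            (fun _ => scaledSol f g (cond p L μ) x τ)))‖
      ≤ 2 ^ (p + 4) * |τ| ^ (m + 1) := by
  have hκ := hpc.one_le_cond
  have hκ0 := hpc.cond_pos
  have hμ := hpc.μ_pos
  have hLb := hpc.Lbar_pos
  have heq := hpc.scaledSol_eq hτ x
  have he := hpc.norm_scaledSol_le hτ x
  have hLbar := hpc.Lbar_eq
  have hYf := hpc.lipDerivs_gradY_f x
  have hYg := hpc.lipDerivs_gradY_g hp x
  have hg0 := hpc.gradY_lowerSol x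
  have hH := hpc.norm_inverse_hess_apply_le x
  set κ := cond p L μ
  set e := scaledSol f g κ x τ
  set y := lowerSol g x
  set Hi := (hess g x).inverse with hHi
  have hτ0 : τ ≠ 0 := hτ.1
  have hτ0' : 0 < |τ| := abs_pos.2 hτ.1
  set d := (τ / κ) • e with hd
  have hdn : ‖d‖ ≤ 2 * |τ| / κ := by
    rw [hd, norm_smul, Real.norm_eq_abs, abs_div, abs_of_pos hκ0]
    calc _ ≤ |τ| / κ * 2 := by gcongr
      _ = _ := by ring
  -- The part of `g` is multiplied by `κ / τ`, so it needs one more Taylor order than the part of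
  -- `f`. This matches the `p - 1` and `p` derivatives that the class provides.
  have hf := hYf.taylor (m := m) (by omega) y d
  have hg := hYg.taylor (m := m + 1) (by omega) y d
  set ρf := gradY f x (y + d) - ∑ k ∈ Finset.range (m + 1),
      (k.factorial : ℝ)⁻¹ • iteratedFDeriv ℝ k (gradY f x) y (fun _ => d) with hρf
  set ρg := gradY g x (y + d) - ∑ k ∈ Finset.range (m + 1 + 1),
      (k.factorial : ℝ)⁻¹ • iteratedFDeriv ℝ k (gradY g x) y (fun _ => d) with hρg
  -- The constant term of `gradY g` at `y*` vanishes and the linear term is the Hessian, already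
  -- taken out; this is the origin of the zero coefficient at `q = 0`.
  have hρg' : ρg = gradY g x (y + d) - hess g x d - ∑ q ∈ Finset.range (m + 1),
      (if q = 0 then 0 else ((q + 1).factorial : ℝ)⁻¹) •
        iteratedFDeriv ℝ (q + 1) (gradY g x) y (fun _ => d) := by
    rw [hρg, Finset.sum_range_succ', Finset.sum_range_succ', Finset.sum_range_succ' _ m]
    simp [hg0, hess, y]
    abel
  have key : e - ∑ q ∈ Finset.range (m + 1), τ ^ q •
      ((-(κ⁻¹ ^ (q + 1) * (q.factorial : ℝ)⁻¹)) • Hi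
          (iteratedFDeriv ℝ q (gradY f x) y (fun _ => e))
        + (if q = 0 then 0 else -(κ⁻¹ ^ q * ((q + 1).factorial : ℝ)⁻¹)) •
          Hi (iteratedFDeriv ℝ (q + 1) (gradY g x) y (fun _ => e)))
      = -Hi (κ⁻¹ • ρf + (κ / τ) • ρg) := by
    conv_lhs => lhs; rw [heq]
    rw [hρg', hρf]
    simp only [smul_sub, map_add, map_sub, Finset.smul_sum, map_sum, map_smul, hd,
      multilinear_smul_diag, smul_add, Finset.sum_add_distrib]
    have s1 : ∑ q ∈ Finset.range (m + 1), τ ^ q • (-(κ⁻¹ ^ (q + 1) * (q.factorial : ℝ)⁻¹)) • Hi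
          (iteratedFDeriv ℝ q (gradY f x) y (fun _ => e))
        = -∑ q ∈ Finset.range (m + 1), κ⁻¹ • (q.factorial : ℝ)⁻¹ • (τ / κ) ^ q • Hi
          (iteratedFDeriv ℝ q (gradY f x) y (fun _ => e)) := by
      rw [← Finset.sum_neg_distrib]
      refine Finset.sum_congr rfl fun q _ => ?_
      rw [smul_smul, smul_smul, smul_smul, ← neg_smul]
      congr 1
      rw [div_pow, inv_pow]
      field_simp
      ring
    have s2 : ∑ q ∈ Finset.range (m + 1), τ ^ q •
          (if q = 0 then 0 else -(κ⁻¹ ^ q * ((q + 1).factorial : ℝ)⁻¹)) • Hi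
          (iteratedFDeriv ℝ (q + 1) (gradY g x) y (fun _ => e))
        = -∑ q ∈ Finset.range (m + 1), (κ / τ) • (if q = 0 then 0 else
          ((q + 1).factorial : ℝ)⁻¹) • (τ / κ) ^ (q + 1) • Hi
          (iteratedFDeriv ℝ (q + 1) (gradY g x) y (fun _ => e)) := by
      rw [← Finset.sum_neg_distrib]
      refine Finset.sum_congr rfl fun q _ => ?_
      rw [smul_smul, smul_smul, smul_smul, ← neg_smul]
      congr 1
      split_ifs
      · simp
      · rw [div_pow, inv_pow]
        field_simp
        ring
    rw [s1, s2]
    abel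
  rw [key, norm_neg]
  refine (hH _).trans ?_
  have b1 : ‖κ⁻¹ • ρf‖ ≤ 2 ^ (p + 1) * μ * |τ| ^ (m + 1) := by
    rw [norm_smul, Real.norm_of_nonneg (by positivity)]
    calc κ⁻¹ * ‖ρf‖ ≤ κ⁻¹ * (2 * Lbar p L * (2 * |τ| / κ) ^ (m + 1)) := by
          gcongr; exact hf.trans (by gcongr)
      _ = 2 ^ (m + 2) * μ * |τ| ^ (m + 1) * (κ⁻¹) ^ (m + 1) := by
          rw [hLbar, div_pow, mul_pow, inv_pow, pow_succ 2 (m + 1)]; field_simp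
      _ ≤ 2 ^ (m + 2) * μ * |τ| ^ (m + 1) * 1 := by
          gcongr; exact pow_le_one₀ (by positivity) (inv_le_one_of_one_le₀ hκ)
      _ ≤ 2 ^ (p + 1) * μ * |τ| ^ (m + 1) := by
          have h2 : (2 : ℝ) ^ (m + 2) ≤ 2 ^ (p + 1) := pow_le_pow_right₀ one_le_two (by omega)
          rw [mul_one]; gcongr
  have b2 : ‖(κ / τ) • ρg‖ ≤ 2 ^ (p + 2) * μ * |τ| ^ (m + 1) := by
    rw [norm_smul, Real.norm_eq_abs, abs_div, abs_of_pos hκ0]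
    calc κ / |τ| * ‖ρg‖ ≤ κ / |τ| * (2 * Lbar p L * (2 * |τ| / κ) ^ (m + 1 + 1)) := by
          gcongr; exact hg.trans (by gcongr)
      _ = 2 ^ (m + 3) * μ * |τ| ^ (m + 1) * (κ⁻¹) ^ m := by
          rw [hLbar, div_pow, mul_pow, inv_pow]; field_simp; ring
      _ ≤ 2 ^ (m + 3) * μ * |τ| ^ (m + 1) * 1 := by
          gcongr; exact pow_le_one₀ (by positivity) (inv_le_one_of_one_le₀ hκ)
      _ ≤ 2 ^ (p + 2) * μ * |τ| ^ (m + 1) := by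
          have h2 : (2 : ℝ) ^ (m + 3) ≤ 2 ^ (p + 2) := pow_le_pow_right₀ one_le_two (by omega)
          rw [mul_one]; gcongr
  rw [inv_mul_le_iff₀ hμ]
  refine (norm_add_le _ _).trans ((add_le_add b1 b2).trans ?_)
  have : (0 : ℝ) ≤ 2 ^ p * μ * |τ| ^ (m + 1) := by positivity
  calc _ = 6 * (2 ^ p * μ * |τ| ^ (m + 1)) := by ring
    _ ≤ 16 * (2 ^ p * μ * |τ| ^ (m + 1)) := by linarith
    _ = _ := by ring

end ProblemClass

theorem inv_pow_mul_inv_factorial_le_one {κ : ℝ} (hκ : 1 ≤ κ) (k q : ℕ) :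
    κ⁻¹ ^ k * (q.factorial : ℝ)⁻¹ ≤ 1 := by
  refine mul_le_one₀ (pow_le_one₀ (by positivity) (inv_le_one_of_one_le₀ hκ)) (by positivity) ?_
  exact inv_le_one_of_one_le₀ (by exact_mod_cast Nat.factorial_pos q)

namespace ProblemClass

theorem norm_inverse_hess_le {dx dy p : ℕ} {L : ℕ → ℝ} {μ Δ : ℝ} {f g : Vec dx → Vec dy → ℝ}
    {x₀ : Vec dx} (hpc : ProblemClass p L μ Δ f g x₀) (x : Vec dx) :
    ‖(hess g x).inverse‖ ≤ μ⁻¹ :=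
  ContinuousLinearMap.opNorm_le_bound _ (inv_nonneg.2 hpc.μ_pos.le)
    (hpc.norm_inverse_hess_apply_le x)

/-- The constant is uniform because the coefficients are at most 2: the inverse Hessian costs `1/μ`,
a derivative is at most `2 Lbar = 2 κ μ`, and every nonzero coefficient carries at least one factor
`κ⁻¹`. -/
theorem exists_hasExpansion_scaledSol {p : ℕ} (hp : 1 ≤ p) :
    ∃ C, 0 ≤ C ∧ ∀ {dx dy : ℕ} {L : ℕ → ℝ} {μ Δ : ℝ} {f g : Vec dx → Vec dy → ℝ} {x₀ : Vec dx},
      ProblemClass p L μ Δ f g x₀ → ∀ x,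
        HasExpansion scaledRange p C (scaledSol f g (cond p L μ) x) := by
  obtain ⟨C, hC, H⟩ := exists_hasExpansion_of_fixedPoint p (c := 2 ^ (p + 4)) (by positivity)
  refine ⟨C, hC, fun {dx dy L μ Δ f g x₀} hpc x => ?_⟩
  have hκ := hpc.one_le_cond
  have hκ0 := hpc.cond_pos
  have hμ := hpc.μ_pos
  have hLbar := hpc.Lbar_eq
  have hLb := hpc.Lbar_pos
  have hYf := hpc.lipDerivs_gradY_f x
  have hYg := hpc.lipDerivs_gradY_g hp x
  have h2p : (2 : ℝ) ≤ 2 ^ (p + 4) := by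
    calc (2 : ℝ) = 2 ^ 1 := by norm_num
      _ ≤ _ := pow_le_pow_right₀ one_le_two (by omega)
  have hHi := hpc.norm_inverse_hess_le x
  have hcomp : ∀ {q : ℕ} (M : Vec dy [×q]→L[ℝ] Vec dy), ‖M‖ ≤ 2 * Lbar p L →
      ‖(hess g x).inverse.compContinuousMultilinearMap M‖ ≤ 2 * cond p L μ := by
    intro q M hM
    refine (ContinuousLinearMap.norm_compContinuousMultilinearMap_le _ _).trans ?_
    calc _ ≤ μ⁻¹ * (2 * Lbar p L) := by gcongr
      _ = _ := by rw [hLbar]; field_simp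
  have hscale : ∀ k q : ℕ, (cond p L μ)⁻¹ ^ (k + 1) * (q.factorial : ℝ)⁻¹ * (2 * cond p L μ)
      ≤ 2 := fun k q => by
    have := inv_pow_mul_inv_factorial_le_one hκ k q
    calc _ = (cond p L μ)⁻¹ ^ k * (q.factorial : ℝ)⁻¹ * 2 := by rw [pow_succ]; field_simp
      _ ≤ 1 * 2 := by gcongr
      _ = 2 := one_mul 2
  refine H (Vec dy) scaledRange (scaledSol f g (cond p L μ) x)
    (fun q => (-((cond p L μ)⁻¹ ^ (q + 1) * (q.factorial : ℝ)⁻¹)) •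
      (hess g x).inverse.compContinuousMultilinearMap
        (iteratedFDeriv ℝ q (gradY f x) (lowerSol g x)))
    (fun q => (if q = 0 then 0 else -((cond p L μ)⁻¹ ^ q * ((q + 1).factorial : ℝ)⁻¹)) •
      (hess g x).inverse.compContinuousMultilinearMap
        (iteratedFDeriv ℝ (q + 1) (gradY g x) (lowerSol g x)))
    abs_le_one_of_mem_scaledRange
    (fun τ hτ => (hpc.norm_scaledSol_le hτ x).trans h2p) (by simp) (fun q hq => ?_)
    (fun q hq => ?_) (fun m hm τ hτ => hpc.norm_scaledSol_sub_sum_le hp hτ x hm)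
  · rw [norm_smul, norm_neg, Real.norm_of_nonneg (by positivity)]
    refine le_trans ?_ ((hscale q q).trans h2p)
    gcongr
    refine hcomp _ ?_
    rcases q with _ | q
    · rw [norm_iteratedFDeriv_zero]
      refine (hpc.norm_gradY_f_le _ _).trans ?_
      linarith [le_Lbar (p := p) (L := L) (j := 0) (by omega)]
    · exact hYf.norm_le (by positivity) (by omega) _
  · rcases q with _ | q
    · rw [if_pos rfl, norm_smul, norm_zero, zero_mul]
      positivity
    · rw [if_neg (by omega), norm_smul, norm_neg, Real.norm_of_nonneg (by positivity)]
      refine le_trans ?_ ((hscale q (q + 1 + 1)).trans h2p)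
      gcongr
      exact hcomp _ (hYg.norm_le (by positivity) hq _)

end ProblemClass

/-! ### The finite difference error. -/

/-- The scaled difference quotient of the gradient of the penalized value function. -/
def valueGradQuot {dx dy : ℕ} (f g : Vec dx → Vec dy → ℝ) (κ : ℝ) (x : Vec dx) (τ : ℝ) : Vec dx :=
  (gradX f x (tiltSol f g (τ / κ ^ 2) x) - gradX f x (lowerSol g x))
    + (κ ^ 2 / τ) • (gradX g x (tiltSol f g (τ / κ ^ 2) x) - gradX g x (lowerSol g x))

namespace ProblemClass

variable {dx dy p : ℕ} {L : ℕ → ℝ} {μ Δ : ℝ} {f g : Vec dx → Vec dy → ℝ} {x₀ : Vec dx}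

/-- Taylor at `y*` along `(τ/κ) e`. The values at `y*` are subtracted, so the sums start with first
derivatives; the factor `κ²/τ` lowers the powers of `τ` for `g` by one. Division by `Lbar κ` makes
all coefficients bounded uniformly in the instance. -/
theorem norm_valueGradQuot_sub_sum_le (hpc : ProblemClass p L μ Δ f g x₀) (hp : 1 ≤ p) {τ : ℝ}
    (hτ : τ ∈ scaledRange) (x : Vec dx) :
    ‖(Lbar p L * cond p L μ)⁻¹ • valueGradQuot f g (cond p L μ) x τ
      - (∑ q ∈ Finset.range (p - 1), τ ^ (q + 1) •
          (((Lbar p L)⁻¹ * ((cond p L μ)⁻¹ ^ (q + 2) * ((q + 1).factorial : ℝ)⁻¹)) •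
            iteratedFDeriv ℝ (q + 1) (gradX f x) (lowerSol g x))
              (fun _ => scaledSol f g (cond p L μ) x τ)
        + ∑ q ∈ Finset.range p, τ ^ q •
          (((Lbar p L)⁻¹ * ((cond p L μ)⁻¹ ^ q * ((q + 1).factorial : ℝ)⁻¹)) •
            iteratedFDeriv ℝ (q + 1) (gradX g x) (lowerSol g x))
              (fun _ => scaledSol f g (cond p L μ) x τ))‖
      ≤ 2 ^ (p + 3) * |τ| ^ p := by
  have hκ := hpc.one_le_cond
  have hκ0 := hpc.cond_pos
  have hLb := hpc.Lbar_pos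
  have he := hpc.norm_scaledSol_le hτ x
  have hXf := hpc.lipDerivs_gradX_f x
  have hXg := hpc.lipDerivs_gradX_g hp x
  have hy := tiltSol_eq_add (f := f) (g := g) hκ0.ne' hτ.1 x
  set κ := cond p L μ
  set Λ := Lbar p L
  set e := scaledSol f g κ x τ
  set y := lowerSol g x
  have hτ0 : τ ≠ 0 := hτ.1
  have hτ0' : 0 < |τ| := abs_pos.2 hτ.1
  set d := (τ / κ) • e with hd
  have hdn : ‖d‖ ≤ 2 * |τ| / κ := by
    rw [hd, norm_smul, Real.norm_eq_abs, abs_div, abs_of_pos hκ0]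
    calc _ ≤ |τ| / κ * 2 := by gcongr
      _ = _ := by ring
  have hf := hXf.taylor le_rfl y d
  have hg := hXg.taylor le_rfl y d
  rw [Finset.sum_range_succ', ← sub_sub, sub_right_comm] at hf hg
  simp only [Nat.factorial_zero, Nat.cast_one, inv_one, one_smul, iteratedFDeriv_zero_apply]
    at hf hg
  rw [Nat.sub_add_cancel hp] at hf
  set ρf := gradX f x (y + d) - gradX f x y - ∑ k ∈ Finset.range (p - 1),
      ((k + 1).factorial : ℝ)⁻¹ • iteratedFDeriv ℝ (k + 1) (gradX f x) y (fun _ => d) with hρf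
  set ρg := gradX g x (y + d) - gradX g x y - ∑ k ∈ Finset.range p,
      ((k + 1).factorial : ℝ)⁻¹ • iteratedFDeriv ℝ (k + 1) (gradX g x) y (fun _ => d) with hρg
  have key : (Λ * κ)⁻¹ • valueGradQuot f g κ x τ
      - (∑ q ∈ Finset.range (p - 1), τ ^ (q + 1) •
          ((Λ⁻¹ * (κ⁻¹ ^ (q + 2) * ((q + 1).factorial : ℝ)⁻¹)) •
            iteratedFDeriv ℝ (q + 1) (gradX f x) y) (fun _ => e)
        + ∑ q ∈ Finset.range p, τ ^ q •
          ((Λ⁻¹ * (κ⁻¹ ^ q * ((q + 1).factorial : ℝ)⁻¹)) •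
            iteratedFDeriv ℝ (q + 1) (gradX g x) y) (fun _ => e))
      = (Λ * κ)⁻¹ • (ρf + (κ ^ 2 / τ) • ρg) := by
    have s1 : ∑ q ∈ Finset.range (p - 1), τ ^ (q + 1) •
          ((Λ⁻¹ * (κ⁻¹ ^ (q + 2) * ((q + 1).factorial : ℝ)⁻¹)) •
            iteratedFDeriv ℝ (q + 1) (gradX f x) y) (fun _ => e)
        = (Λ * κ)⁻¹ • ∑ k ∈ Finset.range (p - 1),
          ((k + 1).factorial : ℝ)⁻¹ • iteratedFDeriv ℝ (k + 1) (gradX f x) y (fun _ => d) := by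
      rw [Finset.smul_sum]
      refine Finset.sum_congr rfl fun q _ => ?_
      rw [hd, multilinear_smul_diag, _root_.smul_apply, smul_smul, smul_smul, smul_smul]
      congr 1
      rw [div_pow, inv_pow]
      field_simp
      ring
    have s2 : ∑ q ∈ Finset.range p, τ ^ q •
          ((Λ⁻¹ * (κ⁻¹ ^ q * ((q + 1).factorial : ℝ)⁻¹)) •
            iteratedFDeriv ℝ (q + 1) (gradX g x) y) (fun _ => e)
        = (Λ * κ)⁻¹ • (κ ^ 2 / τ) • ∑ k ∈ Finset.range p,
          ((k + 1).factorial : ℝ)⁻¹ • iteratedFDeriv ℝ (k + 1) (gradX g x) y (fun _ => d) := by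
      rw [Finset.smul_sum, Finset.smul_sum]
      refine Finset.sum_congr rfl fun q _ => ?_
      rw [hd, multilinear_smul_diag, _root_.smul_apply, smul_smul, smul_smul, smul_smul, smul_smul]
      congr 1
      rw [div_pow, inv_pow]
      field_simp
      ring
    rw [s1, s2, valueGradQuot, hy, hρf, hρg]
    simp only [smul_add, smul_sub]
    abel
  rw [key, norm_smul, Real.norm_of_nonneg (by positivity), inv_mul_le_iff₀ (by positivity)]
  refine (norm_add_le _ _).trans ?_
  have hinv : κ⁻¹ ^ p ≤ 1 := pow_le_one₀ (by positivity) (inv_le_one_of_one_le₀ hκ)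
  have b1 : ‖ρf‖ ≤ 2 ^ (p + 1) * (Λ * κ) * |τ| ^ p := by
    calc ‖ρf‖ ≤ 2 * Λ * (2 * |τ| / κ) ^ p := hf.trans (by gcongr)
      _ = 2 ^ (p + 1) * (Λ * 1) * |τ| ^ p * (κ⁻¹) ^ p := by
          rw [div_pow, mul_pow, inv_pow]; field_simp; ring
      _ ≤ 2 ^ (p + 1) * (Λ * κ) * |τ| ^ p * 1 := by gcongr
      _ = _ := mul_one _
  have b2 : ‖(κ ^ 2 / τ) • ρg‖ ≤ 2 ^ (p + 2) * (Λ * κ) * |τ| ^ p := by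
    rw [norm_smul, Real.norm_eq_abs, abs_div, abs_of_pos (by positivity : 0 < κ ^ 2)]
    calc _ ≤ κ ^ 2 / |τ| * (2 * Λ * (2 * |τ| / κ) ^ (p + 1)) := by
          gcongr; exact hg.trans (by gcongr)
      _ = 2 ^ (p + 2) * (Λ * κ) * |τ| ^ p * (κ⁻¹) ^ p := by
          rw [div_pow, mul_pow, inv_pow]; field_simp; ring
      _ ≤ 2 ^ (p + 2) * (Λ * κ) * |τ| ^ p * 1 := by gcongr
      _ = _ := mul_one _
  have : (0 : ℝ) ≤ 2 ^ p * (Λ * κ) * |τ| ^ p := by positivity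
  calc _ ≤ 2 ^ (p + 1) * (Λ * κ) * |τ| ^ p + 2 ^ (p + 2) * (Λ * κ) * |τ| ^ p := add_le_add b1 b2
    _ = 6 * (2 ^ p * (Λ * κ) * |τ| ^ p) := by ring
    _ ≤ 8 * (2 ^ p * (Λ * κ) * |τ| ^ p) := by linarith
    _ = _ := by ring

/-- The expansion of `scaledSol` is inserted into the multilinear terms of the previous estimate. -/
theorem exists_hasExpansion_valueGradQuot {p : ℕ} (hp : 1 ≤ p) :
    ∃ C, 0 ≤ C ∧ ∀ {dx dy : ℕ} {L : ℕ → ℝ} {μ Δ : ℝ} {f g : Vec dx → Vec dy → ℝ} {x₀ : Vec dx},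
      ProblemClass p L μ Δ f g x₀ → ∀ x, HasExpansion scaledRange p C
        (fun τ => (Lbar p L * cond p L μ)⁻¹ • valueGradQuot f g (cond p L μ) x τ) := by
  obtain ⟨C, hC, H⟩ := exists_hasExpansion_scaledSol hp
  set M : ℕ → ℝ := fun q => 2 * (p ^ q * C ^ q + q * (C * (p + 1)) ^ (q - 1) * C) with hM
  have hM0 : ∀ q, 0 ≤ M q := fun q => by simp only [hM]; positivity
  refine ⟨∑ q ∈ Finset.range (p - 1), 2 ^ (q + 1) * M (q + 1)
    + ∑ q ∈ Finset.range p, 2 ^ q * M (q + 1) + 2 ^ (p + 3), ?_,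
    fun {dx dy L μ Δ f g x₀} hpc x => ?_⟩
  · have h1 : 0 ≤ ∑ q ∈ Finset.range (p - 1), 2 ^ (q + 1) * M (q + 1) :=
      Finset.sum_nonneg fun q _ => by have := hM0 (q + 1); positivity
    have h2 : 0 ≤ ∑ q ∈ Finset.range p, 2 ^ q * M (q + 1) :=
      Finset.sum_nonneg fun q _ => by have := hM0 (q + 1); positivity
    positivity
  have hexp := H hpc x
  have hκ := hpc.one_le_cond
  have hκ0 := hpc.cond_pos
  have hLb := hpc.Lbar_pos
  have hs := abs_le_one_of_mem_scaledRange
  have hterm : ∀ {q : ℕ} (k l : ℕ) (N : Vec dy [×q]→L[ℝ] Vec dx), ‖N‖ ≤ 2 * Lbar p L →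
      HasExpansion scaledRange p (M q) (fun τ =>
        (((Lbar p L)⁻¹ * ((cond p L μ)⁻¹ ^ k * (l.factorial : ℝ)⁻¹)) • N)
          (fun _ => scaledSol f g (cond p L μ) x τ)) := by
    intro q k l N hN
    refine (hexp.multilinear hs hC _).mono ?_
    simp only [hM]
    gcongr
    rw [norm_smul, Real.norm_of_nonneg (by positivity)]
    have := inv_pow_mul_inv_factorial_le_one hκ k l
    calc _ ≤ (Lbar p L)⁻¹ * 1 * (2 * Lbar p L) := by gcongr
      _ = 2 := by field_simp
  refine HasExpansion.of_le (HasExpansion.add (HasExpansion.sum fun q hq => ?_)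
    (HasExpansion.sum fun q hq => ?_))
    (fun τ hτ => hpc.norm_valueGradQuot_sub_sum_le hp hτ x) (by positivity)
  · exact (hterm _ _ _ ((hpc.lipDerivs_gradX_f x).norm_le (by positivity)
      (Finset.mem_range.1 hq) _)).pow_smul hs (hM0 _) _
  · exact (hterm _ _ _ ((hpc.lipDerivs_gradX_g hp x).norm_le (by positivity)
      (Finset.mem_range.1 hq) _)).pow_smul hs (hM0 _) _

/-- This identifies the limit as `τ → 0`, hence the constant coefficient of the expansion. Only the
limit is used, so `M` may depend on the instance. The main point is that `e` tends to `-κ⁻¹ H⁻¹ ∇_y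
f`, which is the case `m = 0` of the fixed-point equation. -/
theorem exists_norm_valueGradQuot_sub_le (hpc : ProblemClass p L μ Δ f g x₀) (hp : 1 ≤ p)
    (x : Vec dx) : ∃ M, ∀ τ ∈ scaledRange, ‖valueGradQuot f g (cond p L μ) x τ
      - (hyperGrad f g x - gradX f x (lowerSol g x))‖ ≤ M * |τ| := by
  have hκ0 := hpc.cond_pos
  have hL1 := hpc.L1_pos
  have hL2 := hpc.L_pos 2 (by omega)
  refine ⟨L 1 * (2 / cond p L μ) + L 2 * 4 + cond p L μ * (L 1 * 2 ^ (p + 4)), fun τ hτ => ?_⟩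
  have hτ0' : 0 < |τ| := abs_pos.2 hτ.1
  have he := hpc.norm_scaledSol_le hτ x
  have he1 := hpc.norm_scaledSol_sub_sum_le hp hτ x (m := 0) (by omega)
  have hy := tiltSol_eq_add (f := f) (g := g) hκ0.ne' hτ.1 x
  set κ := cond p L μ
  set e := scaledSol f g κ x τ
  set y := lowerSol g x with hy_def
  set B := ContinuousLinearMap.adjoint (mixed g x) with hB
  simp only [zero_add, Finset.sum_range_one, pow_zero, pow_one, Nat.factorial_zero, Nat.cast_one,
    inv_one, mul_one, if_true, zero_smul, add_zero, one_smul, iteratedFDeriv_zero_apply] at he1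
  set w := (hess g x).inverse (gradY f x y) with hw
  have hdn : ‖(τ / κ) • e‖ ≤ 2 / κ * |τ| := by
    rw [norm_smul, Real.norm_eq_abs, abs_div, abs_of_pos hκ0]
    calc _ ≤ |τ| / κ * 2 := by gcongr
      _ = _ := by ring
  set d := (τ / κ) • e with hd
  have b1 : ‖gradX f x (y + d) - gradX f x y‖ ≤ L 1 * (2 / κ) * |τ| := by
    have := norm_gradX_sub_le hpc.gradf_lip hL1.le x x (y + d) y
    rw [sub_self, norm_zero, zero_add, add_sub_cancel_left] at this
    refine this.trans ?_
    rw [mul_assoc]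
    gcongr
  have b2 : ‖(κ ^ 2 / τ) • (gradX g x (y + d) - gradX g x y - B d)‖ ≤ L 2 * 4 * |τ| := by
    have := norm_gradX_add_sub_sub_adjoint_le hpc.g_diff hpc.gradYg_diff hL2.le hpc.hessxy_lip x y d
    rw [norm_smul, Real.norm_eq_abs, abs_div, abs_of_pos (by positivity : 0 < κ ^ 2)]
    calc _ ≤ κ ^ 2 / |τ| * (L 2 * (2 / κ * |τ|) ^ 2) := by
          gcongr; exact this.trans (by gcongr)
      _ = _ := by field_simp; norm_num
  have b3 : ‖κ • B (e - -κ⁻¹ • w)‖ ≤ κ * (L 1 * 2 ^ (p + 4)) * |τ| := by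
    rw [norm_smul, Real.norm_of_nonneg hκ0.le]
    have h1 : ‖B‖ ≤ L 1 := by rw [hB, LinearIsometryEquiv.norm_map]; exact hpc.norm_mixed_le x
    calc _ ≤ κ * (L 1 * (2 ^ (p + 4) * |τ|)) := by
          gcongr; exact (B.le_opNorm _).trans (by gcongr)
      _ = _ := by ring
  have hsplit : valueGradQuot f g κ x τ - (hyperGrad f g x - gradX f x y)
      = (gradX f x (y + d) - gradX f x y)
        + (κ ^ 2 / τ) • (gradX g x (y + d) - gradX g x y - B d) + κ • B (e - -κ⁻¹ • w) := by
    have h1 : B d = (τ / κ) • B e := by rw [hd, map_smul]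
    have h2 : hyperGrad f g x = gradX f x y - B w := rfl
    rw [valueGradQuot, hy, h2, ← hy_def, h1, map_sub, map_smul B (-κ⁻¹) w]
    simp only [smul_sub, smul_smul]
    rw [show κ ^ 2 / τ * (τ / κ) = κ by have := hτ.1; field_simp,
      show κ * -κ⁻¹ = -1 by field_simp]
    module
  rw [hsplit]
  refine (norm_add_le _ _).trans ((add_le_add_left (norm_add_le _ _) _).trans ?_)
  rw [add_mul, add_mul]
  exact add_le_add (add_le_add b1 b2) b3

/-- The finite difference estimate of the hyper-gradient has order `p`. -/
theorem exists_norm_fd_sub_hyperGrad_le {p : ℕ} (hp : 1 ≤ p) :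
    ∃ C, 0 ≤ C ∧ ∀ {dx dy : ℕ} {L : ℕ → ℝ} {μ Δ : ℝ} {f g : Vec dx → Vec dy → ℝ} {x₀ : Vec dx},
      ProblemClass p L μ Δ f g x₀ → ∀ (x : Vec dx) (ν : ℝ), 0 < ν →
        p * (cond p L μ ^ 2 * ν) ≤ 1 / 4 →
        ‖∑ j ∈ nodes p, fdCoeff p j • ((j : ℝ) • gradX f x (tiltSol f g (j * ν) x)
            + (1 / ν) • gradX g x (tiltSol f g (j * ν) x)) - hyperGrad f g x‖
          ≤ C * (Lbar p L * cond p L μ * (cond p L μ ^ 2 * ν) ^ p) := by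
  obtain ⟨C, hC, H⟩ := exists_hasExpansion_valueGradQuot hp
  refine ⟨C * ∑ j ∈ nodes p, |fdCoeff p j * j| * |(j : ℝ)| ^ p, by positivity,
    fun {dx dy L μ Δ f g x₀} hpc x ν hν hνκ => ?_⟩
  obtain ⟨a, -, hr⟩ := H hpc x
  obtain ⟨M, hM⟩ := hpc.exists_norm_valueGradQuot_sub_le hp x
  have hκ0 := hpc.cond_pos
  have hLb := hpc.Lbar_pos
  set κ := cond p L μ
  set Λ := Lbar p L
  set y := lowerSol g x with hy
  -- The expansion polynomial has the limit `a 0` at `0+`; it is close to the scaled quotient, whose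
  -- limit is known. Uniqueness of limits identifies the two.
  have ha0 : a 0 = (Λ * κ)⁻¹ • (hyperGrad f g x - gradX f x y) := by
    set b := (Λ * κ)⁻¹ • (hyperGrad f g x - gradX f x y) with hb
    have hlim : Filter.Tendsto (fun τ : ℝ => ∑ i ∈ Finset.range p, τ ^ i • a i)
        (nhdsWithin 0 (Set.Ioi 0)) (nhds (a 0)) := by
      have h1 : Continuous (fun τ : ℝ => ∑ i ∈ Finset.range p, τ ^ i • a i) := by fun_prop
      have h2 := h1.tendsto 0
      have h3 : ∑ i ∈ Finset.range p, (0 : ℝ) ^ i • a i = a 0 := by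
        rw [Finset.sum_eq_single_of_mem 0 (Finset.mem_range.2 hp)]
        · simp
        · intro i _ hi; simp [hi]
      rw [h3] at h2
      exact h2.mono_left nhdsWithin_le_nhds
    have hlim2 : Filter.Tendsto (fun τ : ℝ => ∑ i ∈ Finset.range p, τ ^ i • a i)
        (nhdsWithin 0 (Set.Ioi 0)) (nhds b) := by
      rw [tendsto_iff_norm_sub_tendsto_zero]
      have h4 : Filter.Tendsto (fun τ : ℝ => C * |τ| ^ p + (Λ * κ)⁻¹ * (M * |τ|))
          (nhdsWithin 0 (Set.Ioi 0)) (nhds 0) := by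
        have h5 : Continuous (fun τ : ℝ => C * |τ| ^ p + (Λ * κ)⁻¹ * (M * |τ|)) := by fun_prop
        have h6 := h5.tendsto 0
        rw [abs_zero, zero_pow (by omega), mul_zero, mul_zero, mul_zero, add_zero] at h6
        exact h6.mono_left nhdsWithin_le_nhds
      refine squeeze_zero' (Filter.Eventually.of_forall fun _ => norm_nonneg _) ?_ h4
      have h7 : Set.Ioo (0 : ℝ) (1 / 4) ∈ nhdsWithin (0 : ℝ) (Set.Ioi 0) :=
        Ioo_mem_nhdsGT (by norm_num)
      filter_upwards [h7] with τ hτ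
      have hτs : τ ∈ scaledRange := ⟨hτ.1.ne', by rw [abs_of_pos hτ.1]; exact hτ.2.le⟩
      have h8 := hr τ hτs
      have h9 := hM τ hτs
      have h10 : ‖(Λ * κ)⁻¹ • valueGradQuot f g κ x τ - b‖ ≤ (Λ * κ)⁻¹ * (M * |τ|) := by
        rw [hb, ← smul_sub, norm_smul, Real.norm_of_nonneg (by positivity)]
        gcongr
      rw [norm_sub_rev] at h8
      calc _ = ‖(∑ i ∈ Finset.range p, τ ^ i • a i - (Λ * κ)⁻¹ • valueGradQuot f g κ x τ)
            + ((Λ * κ)⁻¹ • valueGradQuot f g κ x τ - b)‖ := by rw [sub_add_sub_cancel]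
        _ ≤ _ := (norm_add_le _ _).trans (add_le_add h8 h10)
    exact tendsto_nhds_unique hlim hlim2
  have hfd := norm_fd_sub_le hp hr (τ := κ ^ 2 * ν) (fun j hj hj0 => by
    refine ⟨by have : (j : ℝ) ≠ 0 := Int.cast_ne_zero.2 hj0
               positivity, ?_⟩
    rw [abs_mul, abs_of_pos (by positivity : 0 < κ ^ 2 * ν)]
    refine le_trans ?_ hνκ
    gcongr
    exact abs_le_of_mem_nodes hj)
  have hs0 := sum_fdCoeff_mul_pow p 0 (by omega)
  have hs1 := sum_fdCoeff_mul_pow p 1 hp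
  simp only [pow_zero, mul_one, pow_one, zero_ne_one, if_false, if_true] at hs0 hs1
  -- The subtracted values at `y*` are restored by the moments: `∑ α_j = 0` removes the term `gradX
  -- g / ν`, and `∑ α_j j = 1` gives the `gradX f` that is missing from `a 0`.
  have hsum : ∑ j ∈ nodes p, fdCoeff p j • ((j : ℝ) • gradX f x (tiltSol f g (j * ν) x)
            + (1 / ν) • gradX g x (tiltSol f g (j * ν) x)) - hyperGrad f g x
      = (Λ * κ) • (∑ j ∈ nodes p, (fdCoeff p j * j) • ((Λ * κ)⁻¹ •
          valueGradQuot f g κ x (j * (κ ^ 2 * ν))) - a 0) := by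
    rw [ha0, smul_sub, smul_smul, mul_inv_cancel₀ (by positivity), one_smul, Finset.smul_sum]
    have hterm : ∀ j ∈ nodes p, (Λ * κ) • (fdCoeff p j * j) • ((Λ * κ)⁻¹ •
          valueGradQuot f g κ x (j * (κ ^ 2 * ν)))
        = fdCoeff p j • ((j : ℝ) • gradX f x (tiltSol f g (j * ν) x)
            + (1 / ν) • gradX g x (tiltSol f g (j * ν) x))
          - (fdCoeff p j * j) • gradX f x y - fdCoeff p j • ((1 / ν) • gradX g x y) := by
      intro j _
      rw [smul_smul, smul_smul,
        show Λ * κ * (fdCoeff p j * j) * (Λ * κ)⁻¹ = fdCoeff p j * j by field_simp,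
        valueGradQuot,
        show (j : ℝ) * (κ ^ 2 * ν) / κ ^ 2 = j * ν by field_simp]
      by_cases hj0 : j = 0
      · subst hj0
        simp [tiltSol_zero, hy]
      · have hj0' : (j : ℝ) ≠ 0 := Int.cast_ne_zero.2 hj0
        rw [show κ ^ 2 / ((j : ℝ) * (κ ^ 2 * ν)) = 1 / (j * ν) by field_simp]
        simp only [smul_add, smul_sub, smul_smul]
        rw [show fdCoeff p j * j * (1 / (j * ν)) = fdCoeff p j * (1 / ν) by field_simp]
        abel
    rw [Finset.sum_congr rfl hterm, Finset.sum_sub_distrib, Finset.sum_sub_distrib,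
      ← Finset.sum_smul, ← Finset.sum_smul, hs0, hs1, one_smul, zero_smul]
    abel
  rw [hsum, norm_smul, Real.norm_of_nonneg (by positivity)]
  have hpos : |κ ^ 2 * ν| = κ ^ 2 * ν := abs_of_pos (by positivity)
  rw [hpos] at hfd
  calc _ ≤ Λ * κ * (C * (∑ j ∈ nodes p, |fdCoeff p j * j| * |(j : ℝ)| ^ p) * (κ ^ 2 * ν) ^ p) := by
        gcongr
    _ = _ := by ring

end ProblemClass

/-! ### Fresh samples and independence. -/

section Fresh

variable {Ω α 𝒮 : Type*} [MeasurableSpace Ω] [MeasurableSpace α] [MeasurableSpace 𝒮]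
  {P : Measure Ω} [IsProbabilityMeasure P] {D : Measure 𝒮} [IsProbabilityMeasure D]

/-- Averaging over a fresh sample first. -/
theorem lintegral_comp_indep {X : Ω → α} {ξ : Ω → 𝒮} (hX : Measurable X) (hξ : Measurable ξ)
    (hind : IndepFun X ξ P) (hD : P.map ξ = D) {Ψ : α × 𝒮 → ENNReal} (hΨ : Measurable Ψ) :
    ∫⁻ ω, Ψ (X ω, ξ ω) ∂P = ∫⁻ ω, ∫⁻ t, Ψ (X ω, t) ∂D ∂P := by
  have h1 := (indepFun_iff_map_prod_eq_prod_map_map hX.aemeasurable hξ.aemeasurable).1 hind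
  calc ∫⁻ ω, Ψ (X ω, ξ ω) ∂P = ∫⁻ z, Ψ z ∂(P.map (fun ω => (X ω, ξ ω))) :=
        (lintegral_map hΨ (hX.prodMk hξ)).symm
    _ = ∫⁻ x, ∫⁻ t, Ψ (x, t) ∂D ∂(P.map X) := by
        rw [h1, hD, lintegral_prod _ hΨ.aemeasurable]
    _ = _ := lintegral_map hΨ.lintegral_prod_right' hX

/-- The information contained in the samples with indices in `A`. -/
abbrev sampleInfo {Ω 𝒮 : Type*} [MeasurableSpace 𝒮] {ι : Type*} (s : ι → Ω → 𝒮) (A : Set ι) : MeasurableSpace Ω :=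
  ⨆ i ∈ A, MeasurableSpace.comap (s i) inferInstance

omit [MeasurableSpace Ω] in
theorem measurable_sampleInfo {ι : Type*} (s : ι → Ω → 𝒮) {A : Set ι} {i : ι} (hi : i ∈ A) :
    Measurable[sampleInfo s A] (s i) :=
  measurable_iff_comap_le.2 (le_iSup₂_of_le i hi le_rfl)

theorem sampleInfo_le {ι : Type*} {s : ι → Ω → 𝒮} (hs : ∀ i, Measurable (s i)) (A : Set ι) :
    sampleInfo s A ≤ (inferInstance : MeasurableSpace Ω) :=
  iSup₂_le fun i _ => measurable_iff_comap_le.1 (hs i)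

omit [IsProbabilityMeasure P] in
theorem indepFun_of_measurable_sampleInfo {ι : Type*} {s : ι → Ω → 𝒮}
    (hs : ∀ i, Measurable (s i)) (hind : iIndepFun s P) {A : Set ι} {i : ι} (hi : i ∉ A)
    {X : Ω → α} (hX : Measurable[sampleInfo s A] X) : IndepFun X (s i) P := by
  have h1 := indep_iSup_of_disjoint (fun i => measurable_iff_comap_le.1 (hs i)) hind
    (S := A) (T := {i}) (by simpa using hi)
  rw [IndepFun_iff_Indep]
  exact indep_of_indep_of_le_right (indep_of_indep_of_le_left h1 (measurable_iff_comap_le.1 hX))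
    (le_iSup₂_of_le i (Set.mem_singleton i) le_rfl)

/-- Second moments are carried as lower integrals of `ENNReal.ofReal`, so the recursions need no
integrability. -/
theorem lintegral_ofReal_affine_le {u : Ω → ℝ} {ρ c b : ℝ} (hρ : 0 ≤ ρ) (hc : 0 ≤ c) (hb : 0 ≤ b)
    (hu : ∀ ω, 0 ≤ u ω) (h : ∫⁻ ω, ENNReal.ofReal (u ω) ∂P ≤ ENNReal.ofReal b) :
    ∫⁻ ω, ENNReal.ofReal (ρ * u ω + c) ∂P ≤ ENNReal.ofReal (ρ * b + c) := by
  have h1 : ∀ ω, ENNReal.ofReal (ρ * u ω + c)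
      = ENNReal.ofReal ρ * ENNReal.ofReal (u ω) + ENNReal.ofReal c := fun ω => by
    rw [ENNReal.ofReal_add (mul_nonneg hρ (hu ω)) hc, ENNReal.ofReal_mul hρ]
  simp only [h1]
  rw [lintegral_add_right _ measurable_const, lintegral_const_mul' _ _ ENNReal.ofReal_ne_top,
    lintegral_const, measure_univ, mul_one, ENNReal.ofReal_add (mul_nonneg hρ hb) hc,
    ENNReal.ofReal_mul hρ]
  gcongr

end Fresh

/-! ### Mean-zero noise with bounded second moment. -/

section Noise

variable {𝒮 : Type*} [MeasurableSpace 𝒮] {D : Measure 𝒮}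
  {E E' : Type*} [NormedAddCommGroup E] [InnerProductSpace ℝ E] [NormedAddCommGroup E']
  [InnerProductSpace ℝ E']

/-- `ζ` has mean zero and second moment at most `V`. -/
structure IsNoise (D : Measure 𝒮) (V : ℝ) (ζ : 𝒮 → E) : Prop where
  integrable : Integrable ζ D
  mean : ∫ t, ζ t ∂D = 0
  integrable_sq : Integrable (fun t => ‖ζ t‖ ^ 2) D
  sq_le : ∫ t, ‖ζ t‖ ^ 2 ∂D ≤ V

namespace IsNoise

variable {V V' : ℝ} {ζ ζ' : 𝒮 → E}

theorem mono (h : IsNoise D V ζ) (hV : V ≤ V') : IsNoise D V' ζ :=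
  ⟨h.1, h.2, h.3, h.4.trans hV⟩

theorem smul (h : IsNoise D V ζ) (c : ℝ) : IsNoise D (c ^ 2 * V) (fun t => c • ζ t) := by
  have h1 : ∀ t, ‖c • ζ t‖ ^ 2 = c ^ 2 * ‖ζ t‖ ^ 2 := fun t => by
    rw [norm_smul, mul_pow, Real.norm_eq_abs, sq_abs]
  refine ⟨h.1.smul c, by rw [integral_smul, h.2, smul_zero], ?_, ?_⟩
  · simp only [h1]; exact h.3.const_mul _
  · simp only [h1]
    rw [integral_const_mul]
    exact mul_le_mul_of_nonneg_left h.4 (sq_nonneg c)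

/-- The two noises may depend on the same sample, as those of `F` and `G` do, so the cross term need
not vanish; hence the factor 2. -/
theorem add (h : IsNoise D V ζ) (h' : IsNoise D V' ζ') :
    IsNoise D (2 * V + 2 * V') (fun t => ζ t + ζ' t) := by
  have h1 : ∀ t, ‖ζ t + ζ' t‖ ^ 2 ≤ 2 * ‖ζ t‖ ^ 2 + 2 * ‖ζ' t‖ ^ 2 := fun t => by
    have := norm_add_le (ζ t) (ζ' t)
    nlinarith [sq_nonneg (‖ζ t‖ - ‖ζ' t‖), norm_nonneg (ζ t + ζ' t)]
  have hi : Integrable (fun t => 2 * ‖ζ t‖ ^ 2 + 2 * ‖ζ' t‖ ^ 2) D :=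
    (h.3.const_mul 2).add (h'.3.const_mul 2)
  have hsq : Integrable (fun t => ‖ζ t + ζ' t‖ ^ 2) D :=
    hi.mono' ((h.1.add h'.1).aestronglyMeasurable.norm.pow 2) (Filter.Eventually.of_forall fun t => by
      rw [Real.norm_of_nonneg (by positivity)]; exact h1 t)
  refine ⟨h.1.add h'.1, ?_, hsq, ?_⟩
  · rw [integral_add h.1 h'.1, h.2, h'.2, add_zero]
  · refine (integral_mono hsq hi h1).trans ?_
    rw [integral_add (h.3.const_mul 2) (h'.3.const_mul 2), integral_const_mul, integral_const_mul]
    linarith [h.4, h'.4]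

theorem sum {ι : Type*} {t : Finset ι} {v : ι → ℝ} {ζ : ι → 𝒮 → E}
    (h : ∀ i ∈ t, IsNoise D (v i) (ζ i)) :
    IsNoise D (t.card * ∑ i ∈ t, v i) (fun r => ∑ i ∈ t, ζ i r) := by
  have h1 : ∀ r, ‖∑ i ∈ t, ζ i r‖ ^ 2 ≤ t.card * ∑ i ∈ t, ‖ζ i r‖ ^ 2 := fun r => by
    have h2 := norm_sum_le t (fun i => ζ i r)
    have h3 := sq_sum_le_card_mul_sum_sq (s := t) (f := fun i => ‖ζ i r‖)
    exact (pow_le_pow_left₀ (norm_nonneg _) h2 2).trans h3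
  have hi : Integrable (fun r => t.card * ∑ i ∈ t, ‖ζ i r‖ ^ 2) D :=
    (integrable_finsetSum t fun i hi => (h i hi).3).const_mul _
  have hs : Integrable (fun r => ∑ i ∈ t, ζ i r) D := integrable_finsetSum t fun i hi => (h i hi).1
  have hsq : Integrable (fun r => ‖∑ i ∈ t, ζ i r‖ ^ 2) D :=
    hi.mono' (hs.aestronglyMeasurable.norm.pow 2) (Filter.Eventually.of_forall fun r => by
      rw [Real.norm_of_nonneg (by positivity)]; exact h1 r)
  refine ⟨hs, ?_, hsq, ?_⟩
  · rw [integral_finsetSum t fun i hi => (h i hi).1]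
    exact Finset.sum_eq_zero fun i hi => (h i hi).2
  · refine (integral_mono hsq hi h1).trans ?_
    rw [integral_const_mul, integral_finsetSum t fun i hi => (h i hi).3]
    gcongr with i hi
    exact (h i hi).4

theorem clm [CompleteSpace E] [CompleteSpace E'] (h : IsNoise D V ζ) (A : E →L[ℝ] E')
    (hA : ‖A‖ ≤ 1) : IsNoise D V (fun t => A (ζ t)) := by
  have h1 : ∀ t, ‖A (ζ t)‖ ^ 2 ≤ ‖ζ t‖ ^ 2 := fun t => by
    gcongr
    exact (A.le_opNorm _).trans (mul_le_of_le_one_left (norm_nonneg _) hA)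
  have hi := A.integrable_comp h.1
  have hsq : Integrable (fun t => ‖A (ζ t)‖ ^ 2) D :=
    h.3.mono' (hi.aestronglyMeasurable.norm.pow 2) (Filter.Eventually.of_forall fun t => by
      rw [Real.norm_of_nonneg (by positivity)]; exact h1 t)
  exact ⟨hi, by rw [A.integral_comp_comm h.1, h.2, map_zero], hsq,
    (integral_mono hsq h.3 h1).trans h.4⟩

/-- Here the cross term does vanish, `v` being fixed and `ζ` of mean zero. -/
theorem lintegral_sq_add_le [IsProbabilityMeasure D] [CompleteSpace E] (h : IsNoise D V ζ)
    (v : E) :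
    ∫⁻ t, ENNReal.ofReal (‖v + ζ t‖ ^ 2) ∂D ≤ ENNReal.ofReal (‖v‖ ^ 2 + V) := by
  have h1 : ∀ t, ‖v + ζ t‖ ^ 2 = ‖v‖ ^ 2 + 2 * inner ℝ v (ζ t) + ‖ζ t‖ ^ 2 := fun t =>
    norm_add_sq_real _ _
  have hin : Integrable (fun t => inner ℝ v (ζ t)) D := h.1.const_inner v
  have h2 : Integrable (fun t => ‖v‖ ^ 2 + 2 * inner ℝ v (ζ t)) D :=
    (integrable_const _).add (hin.const_mul 2)
  have h3 : Integrable (fun t => ‖v + ζ t‖ ^ 2) D := by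
    simp only [h1]; exact h2.add h.3
  rw [← ofReal_integral_eq_lintegral_ofReal h3 (Filter.Eventually.of_forall fun t => by positivity)]
  refine ENNReal.ofReal_le_ofReal ?_
  simp only [h1]
  rw [integral_add h2 h.3, integral_add (integrable_const _) (hin.const_mul 2), integral_const_mul,
    integral_inner h.1, h.2, inner_zero_right]
  simpa using h.4

end IsNoise

theorem IsGradEstimator.isNoise {dx dy : ℕ} {D : Measure 𝒮} [IsProbabilityMeasure D] {σ : ℝ}
    {f : Vec dx → Vec dy → ℝ} {F : Vec dx → Vec dy → 𝒮 → Joint dx dy}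
    (h : IsGradEstimator D σ f F) (x : Vec dx) (y : Vec dy) :
    IsNoise D (σ ^ 2) (fun t => F x y t - grad f x y) := by
  refine ⟨(h.integrable x y).sub (integrable_const _), ?_, h.integrable_sq x y, h.variance_le x y⟩
  rw [integral_sub (h.integrable x y) (integrable_const _), h.unbiased]
  simp

end Noise

/-! ### Measurability of the iterates. -/

section Measurability

variable {dx dy : ℕ} {𝒮 : Type*} [MeasurableSpace 𝒮] {F G : Vec dx → Vec dy → 𝒮 → Joint dx dy}

theorem measurable_fst_joint : Measurable (fun z : Joint dx dy => z.fst) :=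
  (WithLp.fstL 2 ℝ (Vec dx) (Vec dy)).continuous.measurable

theorem measurable_snd_joint : Measurable (fun z : Joint dx dy => z.snd) :=
  (WithLp.sndL 2 ℝ (Vec dx) (Vec dy)).continuous.measurable

variable {Ω : Type*} [MeasurableSpace Ω]

theorem measurable_oracle (hF : Measurable (fun z : Vec dx × Vec dy × 𝒮 => F z.1 z.2.1 z.2.2))
    {x : Ω → Vec dx} {y : Ω → Vec dy} {t : Ω → 𝒮} (hx : Measurable x) (hy : Measurable y)
    (ht : Measurable t) : Measurable (fun ω => F (x ω) (y ω) (t ω)) :=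
  hF.comp (hx.prodMk (hy.prodMk ht))

variable (hF : Measurable (fun z : Vec dx × Vec dy × 𝒮 => F z.1 z.2.1 z.2.2))
  (hG : Measurable (fun z : Vec dx × Vec dy × 𝒮 => G z.1 z.2.1 z.2.2)) (h : Params)
include hF hG

/-- Only the first `k` samples have to be measurable, for an arbitrary σ-algebra on `Ω`. Applied
with `sampleInfo`, this says that an iterate depends on earlier samples only, which is what makes
the next one fresh. -/
theorem measurable_innerLoop {j : ℤ} {x : Ω → Vec dx} {y : Ω → Vec dy} {t : ℕ → Ω → 𝒮}
    (hx : Measurable x) (hy : Measurable y) (k : ℕ) (ht : ∀ i < k, Measurable (t i)) :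
    Measurable (fun ω => (innerLoop F G h j (x ω) (fun i => t i ω) (y ω) k).1) := by
  induction k with
  | zero => exact hy
  | succ k ih =>
    have h1 := ih fun i hi => ht i (by omega)
    have h2 := measurable_snd_joint.comp (measurable_oracle hF hx h1 (ht k (by omega)))
    have h3 := measurable_snd_joint.comp (measurable_oracle hG hx h1 (ht k (by omega)))
    exact h1.sub (((h2.const_smul ((j : ℝ) * h.ν)).add h3).const_smul h.ηy)

/-- The contribution of one sample to the hyper-gradient estimate. -/
def hyperGradTerm (F G : Vec dx → Vec dy → 𝒮 → Joint dx dy) (p : ℕ) (ν : ℝ) (x : Vec dx)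
    (y : ℤ → Vec dy) (t : 𝒮) : Vec dx :=
  ∑ j ∈ nodes p, fdCoeff p j • ((j : ℝ) • (F x (y j) t).fst + (1 / ν) • (G x (y j) t).fst)

theorem measurable_hyperGradTerm (p : ℕ) (ν : ℝ) {x : Ω → Vec dx} {y : ℤ → Ω → Vec dy} {t : Ω → 𝒮}
    (hx : Measurable x) (hy : ∀ j, Measurable (y j)) (ht : Measurable t) :
    Measurable (fun ω => hyperGradTerm F G p ν (x ω) (fun j => y j ω) (t ω)) := by
  refine Finset.measurable_fun_sum _ fun j _ => ?_
  have h2 := measurable_fst_joint.comp (measurable_oracle hF hx (hy j) ht)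
  have h3 := measurable_fst_joint.comp (measurable_oracle hG hx (hy j) ht)
  exact ((h2.const_smul (j : ℝ)).add (h3.const_smul (1 / ν))).const_smul (fdCoeff p j)

theorem measurable_hyperGradEst (p : ℕ) {x : Ω → Vec dx} {y : ℤ → Ω → Vec dy} {t : ℕ → Ω → 𝒮}
    (hx : Measurable x) (hy : ∀ j, Measurable (y j)) (ht : ∀ i, Measurable (t i)) :
    Measurable (fun ω => hyperGradEst F G p h (x ω) (fun j => y j ω) (fun i => t i ω)) :=
  (Finset.measurable_fun_sum _ fun i _ =>
    measurable_hyperGradTerm hF hG p h.ν hx hy (ht i)).const_smul (1 / (h.S : ℝ))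

omit hF hG in
/-- The outer iteration in which a sample is drawn. -/
def SampleIdx.time : SampleIdx → ℕ
  | .inner t _ _ => t
  | .batch t _ => t

theorem measurable_run (p : ℕ) (x₀ : Vec dx) (y₀ : Vec dy) {s : SampleIdx → Ω → 𝒮} (t : ℕ)
    (hs : ∀ i, i.time < t → Measurable (s i)) :
    Measurable (fun ω => (run F G p h x₀ y₀ (fun i => s i ω) t).x) ∧
      ∀ j, Measurable (fun ω => (run F G p h x₀ y₀ (fun i => s i ω) t).y j) := by
  induction t with
  | zero => exact ⟨measurable_const, fun _ => measurable_const⟩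
  | succ t ih =>
    obtain ⟨hx, hy⟩ := ih fun i hi => hs i (by omega)
    have hy' : ∀ j, Measurable (fun ω => (innerLoop F G h j
        (run F G p h x₀ y₀ (fun i => s i ω) t).x (fun k => s (.inner t j k) ω)
        ((run F G p h x₀ y₀ (fun i => s i ω) t).y j) h.K).1) := fun j =>
      measurable_innerLoop hF hG h hx (hy j) h.K
        (t := fun k ω => s (.inner t j k) ω) fun i _ => hs _ (Nat.lt_succ_self t)
    refine ⟨?_, hy'⟩
    have hΦ := measurable_hyperGradEst hF hG h p hx hy' (t := fun i ω => s (.batch t i) ω)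
      fun i => hs _ (Nat.lt_succ_self t)
    exact hx.sub (((hΦ.norm.const_div 1).smul hΦ).const_smul h.ηx)

end Measurability

section Measurable

variable {dx dy p : ℕ} {L : ℕ → ℝ} {μ Δ : ℝ} {f g : Vec dx → Vec dy → ℝ} {x₀ : Vec dx}

theorem continuous_of_norm_sub_le {E F : Type*} [NormedAddCommGroup E] [NormedAddCommGroup F]
    {u : E → F} {C : ℝ} (h : ∀ x y, ‖u x - u y‖ ≤ C * ‖x - y‖) : Continuous u := by
  refine (LipschitzWith.of_dist_le_mul (K := C.toNNReal) fun x y => ?_).continuous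
  rw [dist_eq_norm, dist_eq_norm]
  exact (h x y).trans (by gcongr; exact Real.le_coe_toNNReal C)

theorem continuous_gradX {L : ℝ} (hL0 : 0 ≤ L)
    (hL : ∀ x y x' y', ‖grad f x y - grad f x' y'‖ ≤ L * ‖pair x y - pair x' y'‖) :
    Continuous (fun z : Vec dx × Vec dy => gradX f z.1 z.2) :=
  continuous_of_norm_sub_le (C := L * 2) fun z w => by
    refine (norm_gradX_sub_le hL hL0 _ _ _ _).trans ?_
    rw [mul_assoc]
    gcongr
    have h1 := norm_fst_le (z - w)
    have h2 := norm_snd_le (z - w)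
    simp only [Prod.fst_sub, Prod.snd_sub] at h1 h2
    linarith

namespace ProblemClass

variable (hpc : ProblemClass p L μ Δ f g x₀)
include hpc

theorem continuous_tiltSol {lam : ℝ} (hlam : |lam| * L 1 ≤ μ / 4) :
    Continuous (tiltSol f g lam) :=
  continuous_of_norm_sub_le (hpc.norm_tiltSol_sub_le hlam)

end ProblemClass

end Measurable

/-! ### Mean square bounds for the inner loop and for the batch. -/

section Inner

variable {dx dy p : ℕ} {L : ℕ → ℝ} {μ Δ σ : ℝ} {f g : Vec dx → Vec dy → ℝ} {x₀ : Vec dx}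
  {𝒮 : Type*} [MeasurableSpace 𝒮] {D : Measure 𝒮} [IsProbabilityMeasure D]
  {F G : Vec dx → Vec dy → 𝒮 → Joint dx dy}
  (hpc : ProblemClass p L μ Δ f g x₀) (hF : IsGradEstimator D σ f F)
  (hG : IsGradEstimator D σ g G)
include hpc hF hG

/-- An exact contracting step plus independent noise. The penalized gradient is `2 L_1`-Lipschitz,
whence `4 η L_1 ≤ 1`; as `|lam| ≤ 1`, the combined variance is at most `4 σ²`. -/
theorem lintegral_sgdStep_le {lam η : ℝ} (hlam : |lam| * L 1 ≤ μ / 4) (hη : 0 ≤ η)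
    (hηL : 4 * η * L 1 ≤ 1) (x : Vec dx) (y : Vec dy) :
    ∫⁻ t, ENNReal.ofReal (‖y - η • (lam • (F x y t).snd + (G x y t).snd)
      - tiltSol f g lam x‖ ^ 2) ∂D
      ≤ ENNReal.ofReal ((1 - η * (μ / 2)) * ‖y - tiltSol f g lam x‖ ^ 2 + 4 * η ^ 2 * σ ^ 2) := by
  have hN := ((((hF.isNoise x y).clm _ ProblemClass.norm_sndL_le).smul lam).add
    ((hG.isNoise x y).clm _ ProblemClass.norm_sndL_le)).smul (-η)
  have hV : (-η) ^ 2 * (2 * (lam ^ 2 * σ ^ 2) + 2 * σ ^ 2) ≤ 4 * η ^ 2 * σ ^ 2 := by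
    have h1 : lam ^ 2 ≤ 1 := by
      rw [← sq_abs]; exact pow_le_one₀ (abs_nonneg _) (hpc.abs_le_of_mul_le hlam)
    have h2 : 0 ≤ η ^ 2 * σ ^ 2 := by positivity
    nlinarith
  have h3 := (hN.mono hV).lintegral_sq_add_le
    (y - η • tiltGrad f g lam x y - tiltSol f g lam x)
  have h4 : ∀ t, y - η • tiltGrad f g lam x y - tiltSol f g lam x
      + -η • (lam • (WithLp.sndL 2 ℝ (Vec dx) (Vec dy)) (F x y t - grad f x y)
        + (WithLp.sndL 2 ℝ (Vec dx) (Vec dy)) (G x y t - grad g x y))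
      = y - η • (lam • (F x y t).snd + (G x y t).snd) - tiltSol f g lam x := fun t => by
    have e1 : (WithLp.sndL 2 ℝ (Vec dx) (Vec dy)) (F x y t - grad f x y)
        = (F x y t).snd - gradY f x y := rfl
    have e2 : (WithLp.sndL 2 ℝ (Vec dx) (Vec dy)) (G x y t - grad g x y)
        = (G x y t).snd - gradY g x y := rfl
    rw [e1, e2, tiltGrad]
    module
  simp only [h4] at h3
  refine h3.trans (ENNReal.ofReal_le_ofReal ?_)
  gcongr
  refine (hpc.tilt_strongConvexGrad hlam x).norm_sq_gradStep_le (L := 2 * L 1)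
    (by have := hpc.L1_pos; positivity) (fun y y' => ?_) (hpc.tilt_tiltSol_le hlam x) hη
    (by linarith) y
  have := hpc.norm_tiltGrad_sub_le hlam x x y y'
  rwa [sub_self, norm_zero, zero_add] at this

/-- The mean of one summand of the hyper-gradient estimate. -/
def hyperGradMean (f g : Vec dx → Vec dy → ℝ) (p : ℕ) (ν : ℝ) (x : Vec dx) (y : ℤ → Vec dy) :
    Vec dx :=
  ∑ j ∈ nodes p, fdCoeff p j • ((j : ℝ) • gradX f x (y j) + (1 / ν) • gradX g x (y j))

/-- The factor in the variance bound of the hyper-gradient estimate. -/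
def fdVariance (p : ℕ) : ℝ :=
  (p + 1) * ∑ j ∈ nodes p, fdCoeff p j ^ 2 * (2 * p ^ 2 + 2)

omit hpc in
theorem isNoise_hyperGradTerm {ν : ℝ} (hν : 0 < ν) (hν1 : ν ≤ 1) (x : Vec dx) (y : ℤ → Vec dy) :
    IsNoise D (fdVariance p * (σ ^ 2 / ν ^ 2))
      (fun t => hyperGradTerm F G p ν x y t - hyperGradMean f g p ν x y) := by
  have h1 : ∀ j ∈ nodes p, IsNoise D (fdCoeff p j ^ 2 * (2 * p ^ 2 + 2) * (σ ^ 2 / ν ^ 2))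
      (fun t => fdCoeff p j • ((j : ℝ) • (WithLp.fstL 2 ℝ (Vec dx) (Vec dy))
          (F x (y j) t - grad f x (y j))
        + (1 / ν) • (WithLp.fstL 2 ℝ (Vec dx) (Vec dy)) (G x (y j) t - grad g x (y j)))) := by
    intro j hj
    refine (((((hF.isNoise x (y j)).clm _ ProblemClass.norm_fstL_le).smul (j : ℝ)).add
      (((hG.isNoise x (y j)).clm _ ProblemClass.norm_fstL_le).smul (1 / ν))).smul
        (fdCoeff p j)).mono ?_
    rw [mul_assoc (fdCoeff p j ^ 2)]
    refine mul_le_mul_of_nonneg_left ?_ (sq_nonneg _)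
    have h2 : (j : ℝ) ^ 2 ≤ p ^ 2 := by
      rw [← sq_abs]; gcongr; exact abs_le_of_mem_nodes hj
    have h3 : σ ^ 2 ≤ σ ^ 2 / ν ^ 2 := by
      rw [le_div_iff₀ (by positivity)]
      exact mul_le_of_le_one_right (sq_nonneg _) (pow_le_one₀ hν.le hν1)
    have h4 : (1 / ν) ^ 2 * σ ^ 2 = σ ^ 2 / ν ^ 2 := by field_simp
    rw [h4]
    have h5 : (j : ℝ) ^ 2 * σ ^ 2 ≤ p ^ 2 * (σ ^ 2 / ν ^ 2) := by gcongr
    linarith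
  have h2 := IsNoise.sum h1
  rw [card_nodes, ← Finset.sum_mul, ← mul_assoc] at h2
  have h3 : (fun t => hyperGradTerm F G p ν x y t - hyperGradMean f g p ν x y)
      = fun t => ∑ j ∈ nodes p, fdCoeff p j • ((j : ℝ) • (WithLp.fstL 2 ℝ (Vec dx) (Vec dy))
          (F x (y j) t - grad f x (y j))
        + (1 / ν) • (WithLp.fstL 2 ℝ (Vec dx) (Vec dy)) (G x (y j) t - grad g x (y j))) := by
    funext t
    rw [hyperGradTerm, hyperGradMean, ← Finset.sum_sub_distrib]
    refine Finset.sum_congr rfl fun j _ => ?_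
    have e1 : (WithLp.fstL 2 ℝ (Vec dx) (Vec dy)) (F x (y j) t - grad f x (y j))
        = (F x (y j) t).fst - gradX f x (y j) := rfl
    have e2 : (WithLp.fstL 2 ℝ (Vec dx) (Vec dy)) (G x (y j) t - grad g x (y j))
        = (G x (y j) t).fst - gradX g x (y j) := rfl
    rw [e1, e2]
    module
  rw [h3]
  exact h2.mono (le_of_eq (by rw [fdVariance]; push_cast; ring))

omit [IsProbabilityMeasure D] hpc in
theorem measurable_hyperGradNoise {Ω : Type*} [MeasurableSpace Ω] (hL1 : 0 ≤ L 1)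
    (hLf : ∀ x y x' y', ‖grad f x y - grad f x' y'‖ ≤ L 1 * ‖pair x y - pair x' y'‖)
    (hLg : ∀ x y x' y', ‖grad g x y - grad g x' y'‖ ≤ L 1 * ‖pair x y - pair x' y'‖)
    (ν : ℝ) {x : Ω → Vec dx} {y : ℤ → Ω → Vec dy} {t : Ω → 𝒮}
    (hx : Measurable x) (hy : ∀ j, Measurable (y j)) (ht : Measurable t) :
    Measurable (fun ω => hyperGradTerm F G p ν (x ω) (fun j => y j ω) (t ω)
      - hyperGradMean f g p ν (x ω) (fun j => y j ω)) := by
  refine (measurable_hyperGradTerm hF.measurable hG.measurable p ν hx hy ht).sub ?_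
  refine Finset.measurable_fun_sum _ fun j _ => ?_
  have f1 := (continuous_gradX hL1 hLf).measurable.comp (hx.prodMk (hy j))
  have f2 := (continuous_gradX hL1 hLg).measurable.comp (hx.prodMk (hy j))
  exact ((f1.const_smul (j : ℝ)).add (f2.const_smul (1 / ν))).const_smul (fdCoeff p j)

omit [IsProbabilityMeasure D] hpc in
theorem measurable_hyperGradPartialSum {Ω : Type*} [MeasurableSpace Ω] (hL1 : 0 ≤ L 1)
    (hLf : ∀ x y x' y', ‖grad f x y - grad f x' y'‖ ≤ L 1 * ‖pair x y - pair x' y'‖)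
    (hLg : ∀ x y x' y', ‖grad g x y - grad g x' y'‖ ≤ L 1 * ‖pair x y - pair x' y'‖)
    (ν : ℝ) {x : Ω → Vec dx} {y : ℤ → Ω → Vec dy} {t : ℕ → Ω → 𝒮} {k : ℕ}
    (hx : Measurable x) (hy : ∀ j, Measurable (y j)) (ht : ∀ i < k, Measurable (t i)) :
    Measurable (fun ω => ((x ω, fun j => y j ω), ∑ i ∈ Finset.range k,
      (hyperGradTerm F G p ν (x ω) (fun j => y j ω) (t i ω)
        - hyperGradMean f g p ν (x ω) (fun j => y j ω)))) :=
  (hx.prodMk (measurable_pi_lambda _ hy)).prodMk (Finset.measurable_fun_sum _ fun i hi =>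
    measurable_hyperGradNoise hF hG hL1 hLf hLg ν hx hy (ht i (Finset.mem_range.1 hi)))

variable {Ω : Type*} [MeasurableSpace Ω] {P : Measure Ω} [IsProbabilityMeasure P]
  {ι : Type*} {s : ι → Ω → 𝒮} (hs : ∀ i, Measurable (s i)) (hD : ∀ i, P.map (s i) = D)
  (hind : iIndepFun s P) {A : Set ι} {idx : ℕ → ι} (hidx : Function.Injective idx)
  (hA : ∀ k, idx k ∉ A)
include hs hD hind hidx hA

/-- The noise floor `8 ηy σ² / μ` is the fixed point of `u ↦ (1 - ηy μ/2) u + 4 ηy² σ²`. -/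
theorem lintegral_innerLoop_le (h : Params) {j : ℤ} (hlam : |(j : ℝ) * h.ν| * L 1 ≤ μ / 4)
    (hη : 0 < h.ηy) (hηL : 4 * h.ηy * L 1 ≤ 1) {x : Ω → Vec dx} {y : Ω → Vec dy}
    (hx : Measurable[sampleInfo s A] x) (hy : Measurable[sampleInfo s A] y) {b : ℝ} (hb : 0 ≤ b)
    (h0 : ∫⁻ ω, ENNReal.ofReal (‖y ω - tiltSol f g (j * h.ν) (x ω)‖ ^ 2) ∂P ≤ ENNReal.ofReal b)
    (k : ℕ) :
    ∫⁻ ω, ENNReal.ofReal (‖(innerLoop F G h j (x ω) (fun i => s (idx i) ω) (y ω) k).1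
        - tiltSol f g (j * h.ν) (x ω)‖ ^ 2) ∂P
      ≤ ENNReal.ofReal ((1 - h.ηy * (μ / 2)) ^ k * b + 8 * (h.ηy * σ ^ 2 / μ)) := by
  have hμ := hpc.μ_pos
  have hρ : 0 ≤ 1 - h.ηy * (μ / 2) := by
    have := hpc.μ_le
    nlinarith
  have hN : 0 ≤ 8 * (h.ηy * σ ^ 2 / μ) := by positivity
  induction k with
  | zero =>
    simp only [pow_zero, one_mul]
    exact h0.trans (ENNReal.ofReal_le_ofReal (by linarith))
  | succ k ih =>
    -- The samples read by the first `k` steps. The iterate is measurable for them, and sample `idx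
    -- k` is not among them.
    set B : Set ι := A ∪ idx '' Set.Iio k with hB
    have hAB : sampleInfo s A ≤ sampleInfo s B := biSup_mono fun i hi => Or.inl hi
    have hxB : Measurable[sampleInfo s B] x := hx.mono hAB le_rfl
    have hyB : Measurable[sampleInfo s B] y := hy.mono hAB le_rfl
    set r : Ω → Vec dy := fun ω => (innerLoop F G h j (x ω) (fun i => s (idx i) ω) (y ω) k).1
      with hr
    have hrB : Measurable[sampleInfo s B] r :=
      @measurable_innerLoop _ _ _ _ _ _ _ (sampleInfo s B) hF.measurable hG.measurable h j x y
        (fun i => s (idx i)) hxB hyB k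
        fun i hi => measurable_sampleInfo s (Or.inr (Set.mem_image_of_mem idx hi))
    have hkB : idx k ∉ B := by
      rintro (hk | ⟨i, hi, hik⟩)
      · exact hA k hk
      · have := hidx hik
        simp only [Set.mem_Iio] at hi
        omega
    have hXB : Measurable[sampleInfo s B] (fun ω => (x ω, r ω)) := hxB.prodMk hrB
    have hX : Measurable (fun ω => (x ω, r ω)) := hXB.mono (sampleInfo_le hs B) le_rfl
    have hi := indepFun_of_measurable_sampleInfo hs hind hkB hXB
    have hΨ : Measurable (fun z : (Vec dx × Vec dy) × 𝒮 => ENNReal.ofReal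
        (‖z.1.2 - h.ηy • (((j : ℝ) * h.ν) • (F z.1.1 z.1.2 z.2).snd + (G z.1.1 z.1.2 z.2).snd)
          - tiltSol f g (j * h.ν) z.1.1‖ ^ 2)) := by
      have m1 : Measurable (fun z : (Vec dx × Vec dy) × 𝒮 => z.1.1) := by fun_prop
      have m2 : Measurable (fun z : (Vec dx × Vec dy) × 𝒮 => z.1.2) := by fun_prop
      have m3 : Measurable (fun z : (Vec dx × Vec dy) × 𝒮 => z.2) := by fun_prop
      have f1 := measurable_snd_joint.comp (measurable_oracle hF.measurable m1 m2 m3)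
      have f2 := measurable_snd_joint.comp (measurable_oracle hG.measurable m1 m2 m3)
      have f3 := (hpc.continuous_tiltSol hlam).measurable.comp m1
      exact (((m2.sub (((f1.const_smul ((j : ℝ) * h.ν)).add f2).const_smul h.ηy)).sub
        f3).norm.pow_const 2).ennreal_ofReal
    have h1 := lintegral_comp_indep hX (hs (idx k)) hi (hD (idx k)) hΨ
    simp only [innerLoop]
    refine h1.le.trans ?_
    have h2 : ∀ ω, ∫⁻ t, ENNReal.ofReal (‖r ω - h.ηy • (((j : ℝ) * h.ν) • (F (x ω) (r ω) t).snd
          + (G (x ω) (r ω) t).snd) - tiltSol f g (j * h.ν) (x ω)‖ ^ 2) ∂D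
        ≤ ENNReal.ofReal ((1 - h.ηy * (μ / 2)) * ‖r ω - tiltSol f g (j * h.ν) (x ω)‖ ^ 2
          + 4 * h.ηy ^ 2 * σ ^ 2) := fun ω =>
      lintegral_sgdStep_le hpc hF hG hlam hη.le hηL (x ω) (r ω)
    refine (lintegral_mono h2).trans ?_
    refine (lintegral_ofReal_affine_le hρ (by positivity) (by positivity)
      (fun ω => by positivity) ih).trans (ENNReal.ofReal_le_ofReal (le_of_eq ?_))
    field_simp
    ring

-- Given `(x, y)`, the batch members are independent with mean zero, so the second moment of the sum
-- `W k` grows like `k V` and not like `k² V`; the prefactor `1/S²` leaves `V / S`.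
omit hpc in
theorem lintegral_hyperGradEst_sub_le (h : Params) (hν : 0 < h.ν) (hν1 : h.ν ≤ 1) (hS : 0 < h.S)
    (hL1 : 0 ≤ L 1)
    (hLf : ∀ x y x' y', ‖grad f x y - grad f x' y'‖ ≤ L 1 * ‖pair x y - pair x' y'‖)
    (hLg : ∀ x y x' y', ‖grad g x y - grad g x' y'‖ ≤ L 1 * ‖pair x y - pair x' y'‖)
    {x : Ω → Vec dx} {y : ℤ → Ω → Vec dy}
    (hx : Measurable[sampleInfo s A] x) (hy : ∀ j, Measurable[sampleInfo s A] (y j)) :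
    ∫⁻ ω, ENNReal.ofReal (‖hyperGradEst F G p h (x ω) (fun j => y j ω) (fun i => s (idx i) ω)
        - hyperGradMean f g p h.ν (x ω) (fun j => y j ω)‖ ^ 2) ∂P
      ≤ ENNReal.ofReal (fdVariance p * (σ ^ 2 / h.ν ^ 2) / h.S) := by
  set V := fdVariance p * (σ ^ 2 / h.ν ^ 2) with hV
  have hV0 : 0 ≤ V := by
    have : 0 ≤ fdVariance p := mul_nonneg (by positivity)
      (Finset.sum_nonneg fun j _ => by positivity)
    positivity
  set W : ℕ → Ω → Vec dx := fun k ω => ∑ i ∈ Finset.range k,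
    (hyperGradTerm F G p h.ν (x ω) (fun j => y j ω) (s (idx i) ω)
      - hyperGradMean f g p h.ν (x ω) (fun j => y j ω)) with hW
  have hΨ : Measurable (fun z : ((Vec dx × (ℤ → Vec dy)) × Vec dx) × 𝒮 =>
      ENNReal.ofReal (‖z.1.2 + (hyperGradTerm F G p h.ν z.1.1.1 z.1.1.2 z.2
        - hyperGradMean f g p h.ν z.1.1.1 z.1.1.2)‖ ^ 2)) := by
    have m0 : Measurable (fun z : ((Vec dx × (ℤ → Vec dy)) × Vec dx) × 𝒮 => z.1.2) := by fun_prop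
    have m1 : Measurable (fun z : ((Vec dx × (ℤ → Vec dy)) × Vec dx) × 𝒮 => z.1.1.1) := by
      fun_prop
    have m2 : ∀ j, Measurable
        (fun z : ((Vec dx × (ℤ → Vec dy)) × Vec dx) × 𝒮 => z.1.1.2 j) := fun j => by fun_prop
    have m3 : Measurable (fun z : ((Vec dx × (ℤ → Vec dy)) × Vec dx) × 𝒮 => z.2) := by fun_prop
    exact ((m0.add (measurable_hyperGradNoise hF hG hL1 hLf hLg h.ν m1 m2 m3)).norm.pow_const
      2).ennreal_ofReal
  have hWk : ∀ k, ∫⁻ ω, ENNReal.ofReal (‖W k ω‖ ^ 2) ∂P ≤ ENNReal.ofReal (k * V) := by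
    intro k
    induction k with
    | zero => simp [hW]
    | succ k ih =>
      set B : Set ι := A ∪ idx '' Set.Iio k with hB
      have hAB : sampleInfo s A ≤ sampleInfo s B := biSup_mono fun i hi => Or.inl hi
      have hkB : idx k ∉ B := by
        rintro (hk | ⟨i, hi, hik⟩)
        · exact hA k hk
        · have := hidx hik
          simp only [Set.mem_Iio] at hi
          omega
      have hXB : Measurable[sampleInfo s B] (fun ω => ((x ω, fun j => y j ω), W k ω)) :=
        @measurable_hyperGradPartialSum _ _ _ _ _ _ _ _ _ _ _ _ hF hG Ω (sampleInfo s B) hL1 hLf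
          hLg h.ν x y (fun i => s (idx i)) k (hx.mono hAB le_rfl) (fun j => (hy j).mono hAB le_rfl)
          fun i hi => measurable_sampleInfo s (Or.inr (Set.mem_image_of_mem idx hi))
      have hX := hXB.mono (sampleInfo_le hs B) le_rfl
      have hi := indepFun_of_measurable_sampleInfo hs hind hkB hXB
      have h1 := lintegral_comp_indep hX (hs (idx k)) hi (hD (idx k)) hΨ
      have h2 : ∀ ω, W (k + 1) ω = W k ω + (hyperGradTerm F G p h.ν (x ω) (fun j => y j ω)
          (s (idx k) ω) - hyperGradMean f g p h.ν (x ω) (fun j => y j ω)) := fun ω =>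
        Finset.sum_range_succ _ _
      simp only [h2]
      refine h1.le.trans ?_
      have h3 : ∀ ω, ∫⁻ t, ENNReal.ofReal (‖W k ω + (hyperGradTerm F G p h.ν (x ω)
          (fun j => y j ω) t - hyperGradMean f g p h.ν (x ω) (fun j => y j ω))‖ ^ 2) ∂D
          ≤ ENNReal.ofReal (1 * ‖W k ω‖ ^ 2 + V) := fun ω => by
        rw [one_mul]
        exact (isNoise_hyperGradTerm hF hG hν hν1 (x ω) (fun j => y j ω)).lintegral_sq_add_le _
      refine (lintegral_mono h3).trans ?_
      refine (lintegral_ofReal_affine_le zero_le_one hV0 (by positivity)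
        (fun ω => by positivity) ih).trans (ENNReal.ofReal_le_ofReal (le_of_eq ?_))
      push_cast
      ring
  have hS' : (0 : ℝ) < h.S := by exact_mod_cast hS
  have h4 : ∀ ω, hyperGradEst F G p h (x ω) (fun j => y j ω) (fun i => s (idx i) ω)
        - hyperGradMean f g p h.ν (x ω) (fun j => y j ω) = (1 / (h.S : ℝ)) • W h.S ω := fun ω => by
    simp only [hW, Finset.sum_sub_distrib, Finset.sum_const, Finset.card_range, smul_sub]
    rw [← Nat.cast_smul_eq_nsmul ℝ, smul_smul, one_div, inv_mul_cancel₀ hS'.ne', one_smul]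
    simp only [hyperGradEst, hyperGradTerm, one_div]
  have h5 : ∀ ω, ‖(1 / (h.S : ℝ)) • W h.S ω‖ ^ 2 = 1 / (h.S : ℝ) ^ 2 * ‖W h.S ω‖ ^ 2 + 0 :=
    fun ω => by rw [norm_smul, mul_pow, Real.norm_of_nonneg (by positivity)]; ring
  simp only [h4, h5]
  refine (lintegral_ofReal_affine_le (by positivity) le_rfl (by positivity)
    (fun ω => by positivity) (hWk h.S)).trans (ENNReal.ofReal_le_ofReal (le_of_eq ?_))
  field_simp
  ring

end Inner

theorem lintegral_ofReal_add_le {Ω : Type*} [MeasurableSpace Ω] {P : Measure Ω} {u v : Ω → ℝ}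
    {a b : ℝ} (ha : 0 ≤ a) (hb : 0 ≤ b) (hv : Measurable v)
    (h1 : ∫⁻ ω, ENNReal.ofReal (u ω) ∂P ≤ ENNReal.ofReal a)
    (h2 : ∫⁻ ω, ENNReal.ofReal (v ω) ∂P ≤ ENNReal.ofReal b) :
    ∫⁻ ω, ENNReal.ofReal (u ω + v ω) ∂P ≤ ENNReal.ofReal (a + b) := by
  rw [ENNReal.ofReal_add ha hb]
  refine (lintegral_mono fun ω => ENNReal.ofReal_add_le).trans ?_
  rw [lintegral_add_right _ hv.ennreal_ofReal]
  exact add_le_add h1 h2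

theorem lintegral_ofReal_sum_le {Ω ι : Type*} [MeasurableSpace Ω] {P : Measure Ω} {t : Finset ι}
    {u : ι → Ω → ℝ} {a : ι → ℝ} (ha : ∀ i ∈ t, 0 ≤ a i) (hu : ∀ i ∈ t, Measurable (u i))
    (h : ∀ i ∈ t, ∫⁻ ω, ENNReal.ofReal (u i ω) ∂P ≤ ENNReal.ofReal (a i)) :
    ∫⁻ ω, ENNReal.ofReal (∑ i ∈ t, u i ω) ∂P ≤ ENNReal.ofReal (∑ i ∈ t, a i) := by
  classical
  induction t using Finset.induction_on with
  | empty => simp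
  | insert i t hi ih =>
    simp only [Finset.sum_insert hi, add_comm (a i), add_comm (u i _)]
    exact lintegral_ofReal_add_le
      (Finset.sum_nonneg fun j hj => ha j (Finset.mem_insert_of_mem hj))
      (ha i (Finset.mem_insert_self i t)) (hu i (Finset.mem_insert_self i t))
      (ih (fun j hj => ha j (Finset.mem_insert_of_mem hj))
        (fun j hj => hu j (Finset.mem_insert_of_mem hj))
        (fun j hj => h j (Finset.mem_insert_of_mem hj)))
      (h i (Finset.mem_insert_self i t))

/-- Passes from second to first moments without square roots: with `a²` a bound on the second
moment, the first is at most `a`. -/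
theorem le_sq_div_add {a : ℝ} (ha : 0 < a) (v : ℝ) : v ≤ 1 / (2 * a) * v ^ 2 + a / 2 := by
  have h : 1 / (2 * a) * v ^ 2 + a / 2 - v = (v - a) ^ 2 / (2 * a) := by field_simp; ring
  have : 0 ≤ (v - a) ^ 2 / (2 * a) := by positivity
  linarith

/-! ### Number of oracle calls. -/

section Calls

variable {dx dy : ℕ} {𝒮 : Type*} (F G : Vec dx → Vec dy → 𝒮 → Joint dx dy)

theorem innerLoop_calls (h : Params) (j : ℤ) (x : Vec dx) (s : ℕ → 𝒮) (y : Vec dy) (k : ℕ) :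
    (innerLoop F G h j x s y k).2 = 2 * k := by
  induction k with
  | zero => rfl
  | succ k ih => simp only [innerLoop]; omega

theorem run_calls (p : ℕ) (h : Params) (x₀ : Vec dx) (y₀ : Vec dy) (s : SampleIdx → 𝒮) (t : ℕ) :
    (run F G p h x₀ y₀ s t).calls = 2 * ((p + 1) * t * (h.S + h.K)) := by
  induction t with
  | zero => simp [run]
  | succ t ih =>
    simp only [run, outerStep, innerLoop_calls, ih, Finset.sum_const, card_nodes,
      Finset.card_range, smul_eq_mul]
    ring

theorem run_calls_le {p : ℕ} (hp : 1 ≤ p) (h : Params) (x₀ : Vec dx) (y₀ : Vec dy)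
    (s : SampleIdx → 𝒮) (t : ℕ) :
    (run F G p h x₀ y₀ s t).calls ≤ 4 * (p * t * (h.S + h.K)) := by
  rw [run_calls]
  calc 2 * ((p + 1) * t * (h.S + h.K)) ≤ 2 * ((p + p) * t * (h.S + h.K)) := by gcongr
    _ = _ := by ring

end Calls

/-! ### Normalized descent and the errors along the run. -/

/-- A normalized step along `Φ` decreases a function with gradient `v` at first order, up to twice
the error of `Φ`. -/
theorem norm_sub_le_inner_normalize {E : Type*} [NormedAddCommGroup E] [InnerProductSpace ℝ E]
    (v Φ : E) : ‖v‖ - 2 * ‖Φ - v‖ ≤ inner ℝ v ((1 / ‖Φ‖) • Φ) := by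
  have h1 : inner ℝ (Φ - v) ((1 / ‖Φ‖) • Φ) ≤ ‖Φ - v‖ := by
    refine (real_inner_le_norm _ _).trans (mul_le_of_le_one_right (norm_nonneg _) ?_)
    rw [norm_smul, Real.norm_of_nonneg (by positivity), one_div]
    exact inv_mul_le_one
  have h2 : inner ℝ Φ ((1 / ‖Φ‖) • Φ) = ‖Φ‖ := by
    rw [inner_smul_right, real_inner_self_eq_norm_sq]
    -- For `Φ = 0` the convention `1 / 0 = 0` makes the normalized vector zero: no move.
    rcases (norm_nonneg Φ).eq_or_lt with h | h
    · rw [← h]; simp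
    · field_simp
  rw [inner_sub_left, h2] at h1
  have h3 := norm_sub_norm_le v Φ
  rw [norm_sub_rev v Φ] at h3
  linarith

theorem norm_normalize_le_one {E : Type*} [NormedAddCommGroup E] [NormedSpace ℝ E] (Φ : E) :
    ‖(1 / ‖Φ‖) • Φ‖ ≤ 1 := by
  rw [norm_smul, Real.norm_of_nonneg (by positivity), one_div]
  exact inv_mul_le_one

section Run

variable {dx dy p : ℕ} {L : ℕ → ℝ} {μ Δ σ : ℝ} {f g : Vec dx → Vec dy → ℝ}
  {𝒮 : Type*} [MeasurableSpace 𝒮] {D : Measure 𝒮} [IsProbabilityMeasure D]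
  {F G : Vec dx → Vec dy → 𝒮 → Joint dx dy} {x₀ : Vec dx}

/-- The samples drawn before iteration `t`. -/
def pastIdx (t : ℕ) : Set SampleIdx := {i | i.time < t}

/-- The samples drawn before the batch of iteration `t`. -/
def preBatchIdx (t : ℕ) : Set SampleIdx := {i | i.time < t + 1} \ Set.range (SampleIdx.batch t)

section Deterministic

variable (hpc : ProblemClass p L μ Δ f g x₀)
include hpc

theorem norm_hyperGradMean_sub_le {ν : ℝ} (hν : 0 < ν) (hν1 : ν ≤ 1) (x : Vec dx)
    (y z : ℤ → Vec dy) :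
    ‖hyperGradMean f g p ν x y - hyperGradMean f g p ν x z‖
      ≤ ∑ j ∈ nodes p, |fdCoeff p j| * ((p + 1) * (L 1 / ν)) * ‖y j - z j‖ := by
  have hL1 := hpc.L1_pos
  rw [hyperGradMean, hyperGradMean, ← Finset.sum_sub_distrib]
  refine norm_sum_le_of_le _ fun j hj => ?_
  have h1 := norm_gradX_sub_le hpc.gradf_lip hL1.le x x (y j) (z j)
  have h2 := norm_gradX_sub_le hpc.gradg_lip hL1.le x x (y j) (z j)
  rw [sub_self x, norm_zero, zero_add] at h1 h2
  have h3 : fdCoeff p j • ((j : ℝ) • gradX f x (y j) + (1 / ν) • gradX g x (y j))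
      - fdCoeff p j • ((j : ℝ) • gradX f x (z j) + (1 / ν) • gradX g x (z j))
      = fdCoeff p j • ((j : ℝ) • (gradX f x (y j) - gradX f x (z j))
        + (1 / ν) • (gradX g x (y j) - gradX g x (z j))) := by module
  rw [h3, norm_smul, Real.norm_eq_abs, mul_assoc]
  gcongr
  refine (norm_add_le _ _).trans ?_
  rw [norm_smul, norm_smul, Real.norm_eq_abs, Real.norm_of_nonneg (by positivity : 0 ≤ 1 / ν)]
  have h4 := abs_le_of_mem_nodes hj
  have h5 : L 1 ≤ L 1 / ν := by
    rw [le_div_iff₀ hν]; exact mul_le_of_le_one_right hL1.le hν1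
  calc |(j : ℝ)| * ‖gradX f x (y j) - gradX f x (z j)‖
        + 1 / ν * ‖gradX g x (y j) - gradX g x (z j)‖
      ≤ p * (L 1 * ‖y j - z j‖) + 1 / ν * (L 1 * ‖y j - z j‖) := by gcongr
    _ = p * L 1 * ‖y j - z j‖ + L 1 / ν * ‖y j - z j‖ := by ring
    _ ≤ p * (L 1 / ν) * ‖y j - z j‖ + L 1 / ν * ‖y j - z j‖ := by gcongr
    _ = _ := by ring

theorem continuous_hyperGrad (hp : 1 ≤ p) : Continuous (hyperGrad f g) :=
  continuous_of_norm_sub_le (hpc.norm_hyperGrad_sub_le hp)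

/-- The quadratic bound for `φ` along each step, telescoped down to `inf φ`. A normalized step has
length at most `η` whatever `Φ` is, so only the first moment of the error of `Φ` enters. -/
theorem sum_norm_hyperGrad_le (hp : 1 ≤ p) {η : ℝ} (hη : 0 ≤ η) {x Φ : ℕ → Vec dx}
    (hx0 : x 0 = x₀) (hx : ∀ t, x (t + 1) = x t - η • ((1 / ‖Φ t‖) • Φ t)) (T : ℕ) :
    η * ∑ t ∈ Finset.range T, ‖hyperGrad f g (x t)‖
      ≤ Δ + 2 * η * ∑ t ∈ Finset.range T, ‖Φ t - hyperGrad f g (x t)‖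
        + T * (20 * (L 1 * cond p L μ ^ 3) * η ^ 2) := by
  have hκ := hpc.cond_pos
  have hL1 := hpc.L1_pos
  have key : η * ∑ t ∈ Finset.range T, ‖hyperGrad f g (x t)‖
      ≤ (hyperObj f g (x 0) - hyperObj f g (x T))
        + 2 * η * ∑ t ∈ Finset.range T, ‖Φ t - hyperGrad f g (x t)‖
        + T * (20 * (L 1 * cond p L μ ^ 3) * η ^ 2) := by
    induction T with
    | zero => simp
    | succ T ih =>
      have h1 := (abs_le.1 (abs_sub_sub_inner_le hpc.hasGradientAt_hyperObj
        (hpc.norm_hyperGrad_sub_le hp) (x T) (x (T + 1)))).2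
      have h2 : x (T + 1) - x T = -(η • ((1 / ‖Φ T‖) • Φ T)) := by rw [hx]; abel
      have h3 : ‖x (T + 1) - x T‖ ≤ η := by
        rw [h2, norm_neg, norm_smul, Real.norm_of_nonneg hη]
        exact mul_le_of_le_one_right hη (norm_normalize_le_one _)
      have h4 : 20 * (L 1 * cond p L μ ^ 3) * ‖x (T + 1) - x T‖ ^ 2
          ≤ 20 * (L 1 * cond p L μ ^ 3) * η ^ 2 := by gcongr
      have h5 := mul_le_mul_of_nonneg_left
        (norm_sub_le_inner_normalize (hyperGrad f g (x T)) (Φ T)) hη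
      rw [h2, inner_neg_right, inner_smul_right] at h1
      rw [← h2] at h1
      rw [Finset.sum_range_succ, Finset.sum_range_succ]
      push_cast
      linarith
  have hinf : ⨅ x, hyperObj f g x ≤ hyperObj f g (x T) := ciInf_le hpc.bddBelow _
  have hgap := hpc.gap
  rw [hx0] at key
  linarith

end Deterministic

variable {Ω : Type*} [MeasurableSpace Ω] {P : Measure Ω} [IsProbabilityMeasure P]
  {s : SampleIdx → Ω → 𝒮} (hs : ∀ i, Measurable (s i)) (hD : ∀ i, P.map (s i) = D)
  (hind : iIndepFun s P) (hpc : ProblemClass p L μ Δ f g x₀) (hF : IsGradEstimator D σ f F)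
  (hG : IsGradEstimator D σ g G) (h : Params) (y₀ : Vec dy)

omit [MeasurableSpace 𝒮] in
theorem norm_run_succ_sub_le (hηx : 0 ≤ h.ηx) (r : SampleIdx → 𝒮) (t : ℕ) :
    ‖(run F G p h x₀ y₀ r (t + 1)).x - (run F G p h x₀ y₀ r t).x‖ ≤ h.ηx := by
  have h1 : (run F G p h x₀ y₀ r (t + 1)).x - (run F G p h x₀ y₀ r t).x
      = -(h.ηx • ((1 / ‖hyperGradEst F G p h (run F G p h x₀ y₀ r t).x
          (run F G p h x₀ y₀ r (t + 1)).y (fun i => r (.batch t i))‖)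
        • hyperGradEst F G p h (run F G p h x₀ y₀ r t).x
          (run F G p h x₀ y₀ r (t + 1)).y (fun i => r (.batch t i)))) := by
    simp only [run, outerStep]
    abel
  rw [h1, norm_neg, norm_smul, Real.norm_of_nonneg hηx]
  exact mul_le_of_le_one_right hηx (norm_normalize_le_one _)

-- Normalization keeps the iterates in a deterministic ball; this gives the integrability of the
-- gradient norms.
omit [MeasurableSpace 𝒮] in
theorem norm_run_sub_le (hηx : 0 ≤ h.ηx) (r : SampleIdx → 𝒮) (t : ℕ) :
    ‖(run F G p h x₀ y₀ r t).x - x₀‖ ≤ t * h.ηx := by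
  induction t with
  | zero => simp [run]
  | succ t ih =>
    have := norm_add_le ((run F G p h x₀ y₀ r (t + 1)).x - (run F G p h x₀ y₀ r t).x)
      ((run F G p h x₀ y₀ r t).x - x₀)
    rw [sub_add_sub_cancel] at this
    have h1 := norm_run_succ_sub_le (F := F) (G := G) (p := p) (x₀ := x₀) h y₀ hηx r t
    push_cast
    linarith

include hs hD hind hpc hF hG

/-- The errors of the inner loops before and after the `K` steps of iteration `t`. -/
theorem lintegral_inner_error_le (hlam : ∀ j ∈ nodes p, |(j : ℝ) * h.ν| * L 1 ≤ μ / 4)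
    (hη : 0 < h.ηy) (hηL : 4 * h.ηy * L 1 ≤ 1) {q N R : ℝ} (hq : (1 - h.ηy * (μ / 2)) ^ h.K ≤ q)
    (hq8 : q ≤ 1 / 8) (hN : 8 * (h.ηy * σ ^ 2 / μ) ≤ N) (hηx : 0 ≤ h.ηx)
    (hstep : 4 * (L 1 / μ) * h.ηx ≤ R)
    (hinit : ∀ j ∈ nodes p, ‖y₀ - tiltSol f g (j * h.ν) x₀‖ ≤ 2 * R) {j : ℤ} (hj : j ∈ nodes p)
    (t : ℕ) :
    ∫⁻ ω, ENNReal.ofReal (‖(run F G p h x₀ y₀ (fun i => s i ω) t).y j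
        - tiltSol f g (j * h.ν) (run F G p h x₀ y₀ (fun i => s i ω) t).x‖ ^ 2) ∂P
      ≤ ENNReal.ofReal (8 * (R ^ 2 + N)) ∧
    ∫⁻ ω, ENNReal.ofReal (‖(run F G p h x₀ y₀ (fun i => s i ω) (t + 1)).y j
        - tiltSol f g (j * h.ν) (run F G p h x₀ y₀ (fun i => s i ω) t).x‖ ^ 2) ∂P
      ≤ ENNReal.ofReal (q * (8 * (R ^ 2 + N)) + N) := by
  have hμ := hpc.μ_pos
  have hL1 := hpc.L1_pos
  have hN0 : 0 ≤ N := le_trans (by positivity) hN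
  have hb : 0 ≤ 8 * (R ^ 2 + N) := by positivity
  have hR0 : 0 ≤ R := le_trans (by positivity) hstep
  have hρ0 : 0 ≤ 1 - h.ηy * (μ / 2) := by
    have := hpc.μ_le
    nlinarith
  have hq0 : 0 ≤ q := (pow_nonneg hρ0 _).trans hq
  have second : ∀ t, ∫⁻ ω, ENNReal.ofReal (‖(run F G p h x₀ y₀ (fun i => s i ω) t).y j
        - tiltSol f g (j * h.ν) (run F G p h x₀ y₀ (fun i => s i ω) t).x‖ ^ 2) ∂P
      ≤ ENNReal.ofReal (8 * (R ^ 2 + N)) →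
    ∫⁻ ω, ENNReal.ofReal (‖(run F G p h x₀ y₀ (fun i => s i ω) (t + 1)).y j
        - tiltSol f g (j * h.ν) (run F G p h x₀ y₀ (fun i => s i ω) t).x‖ ^ 2) ∂P
      ≤ ENNReal.ofReal (q * (8 * (R ^ 2 + N)) + N) := by
    intro t ht
    obtain ⟨mx, my⟩ := @measurable_run _ _ _ _ F G Ω (sampleInfo s (pastIdx t)) hF.measurable
      hG.measurable h p x₀ y₀ s t fun i hi => measurable_sampleInfo s hi
    have h1 := lintegral_innerLoop_le hpc hF hG hs hD hind (A := pastIdx t)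
      (idx := fun k => SampleIdx.inner t j k) (fun a b hab => by injection hab)
      (fun k hk => lt_irrefl t hk) h (hlam j hj) hη hηL mx (my j) hb ht h.K
    refine h1.trans (ENNReal.ofReal_le_ofReal ?_)
    gcongr
  have first : ∫⁻ ω, ENNReal.ofReal (‖(run F G p h x₀ y₀ (fun i => s i ω) t).y j
        - tiltSol f g (j * h.ν) (run F G p h x₀ y₀ (fun i => s i ω) t).x‖ ^ 2) ∂P
      ≤ ENNReal.ofReal (8 * (R ^ 2 + N)) := by
    induction t with
    | zero =>
      simp only [run, lintegral_const, measure_univ, mul_one]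
      refine ENNReal.ofReal_le_ofReal ?_
      have := pow_le_pow_left₀ (norm_nonneg _) (hinit j hj) 2
      nlinarith
    | succ t ih =>
      have h1 := second t ih
      -- The minimizer moves by at most `4 (L_1/μ) ηx ≤ R` in one outer step, so a warm start costs
      -- a factor 2 and `2 R²`.
      have h2 : ∀ ω, ‖(run F G p h x₀ y₀ (fun i => s i ω) (t + 1)).y j
          - tiltSol f g (j * h.ν) (run F G p h x₀ y₀ (fun i => s i ω) (t + 1)).x‖ ^ 2
          ≤ 2 * ‖(run F G p h x₀ y₀ (fun i => s i ω) (t + 1)).y j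
          - tiltSol f g (j * h.ν) (run F G p h x₀ y₀ (fun i => s i ω) t).x‖ ^ 2 + 2 * R ^ 2 := by
        intro ω
        set y' := (run F G p h x₀ y₀ (fun i => s i ω) (t + 1)).y j
        have h3 := hpc.norm_tiltSol_sub_le (hlam j hj)
          (run F G p h x₀ y₀ (fun i => s i ω) t).x (run F G p h x₀ y₀ (fun i => s i ω) (t + 1)).x
        have h4 := norm_run_succ_sub_le (F := F) (G := G) (p := p) (x₀ := x₀) h y₀ hηx
          (fun i => s i ω) t
        rw [norm_sub_rev] at h4
        set z := tiltSol f g (j * h.ν) (run F G p h x₀ y₀ (fun i => s i ω) t).x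
        set z' := tiltSol f g (j * h.ν) (run F G p h x₀ y₀ (fun i => s i ω) (t + 1)).x
        have h5 : ‖z - z'‖ ≤ R := h3.trans (le_trans (by gcongr) hstep)
        have h6 := norm_add_le (y' - z) (z - z')
        rw [sub_add_sub_cancel] at h6
        have h7 : ‖y' - z'‖ ^ 2 ≤ (‖y' - z‖ + R) ^ 2 :=
          pow_le_pow_left₀ (norm_nonneg _) (h6.trans (by gcongr)) 2
        nlinarith [sq_nonneg (‖y' - z‖ - R)]
      refine (lintegral_mono fun ω => ENNReal.ofReal_le_ofReal (h2 ω)).trans ?_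
      refine (lintegral_ofReal_affine_le (by norm_num) (by positivity) (by positivity)
        (fun ω => by positivity) h1).trans (ENNReal.ofReal_le_ofReal ?_)
      -- With `q ≤ 1/8` the new error is at most `2 ((R² + N) + N) + 2 R² ≤ 8 (R² + N)`: the level
      -- reproduces itself.
      nlinarith [mul_le_mul_of_nonneg_right hq8 hb]
  exact ⟨first, second t first⟩

/-- The error of the hyper-gradient estimate in iteration `t`. -/
theorem lintegral_hyperGradEst_error_le (hp : 1 ≤ p) (hν : 0 < h.ν) (hν1 : h.ν ≤ 1) (hS : 0 < h.S)
    (hlam : ∀ j ∈ nodes p, |(j : ℝ) * h.ν| * L 1 ≤ μ / 4) {t : ℕ} {E a a' e : ℝ} (ha : 0 < a)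
    (ha' : 0 < a') (hE0 : 0 ≤ E)
    (hE : ∀ j ∈ nodes p, ∫⁻ ω, ENNReal.ofReal (‖(run F G p h x₀ y₀ (fun i => s i ω) (t + 1)).y j
        - tiltSol f g (j * h.ν) (run F G p h x₀ y₀ (fun i => s i ω) t).x‖ ^ 2) ∂P
      ≤ ENNReal.ofReal E)
    (hfd : ∀ x, ‖hyperGradMean f g p h.ν x (fun j => tiltSol f g (j * h.ν) x) - hyperGrad f g x‖
      ≤ e) :
    ∫⁻ ω, ENNReal.ofReal ‖hyperGradEst F G p h (run F G p h x₀ y₀ (fun i => s i ω) t).x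
        (run F G p h x₀ y₀ (fun i => s i ω) (t + 1)).y (fun i => s (.batch t i) ω)
        - hyperGrad f g (run F G p h x₀ y₀ (fun i => s i ω) t).x‖ ∂P
      ≤ ENNReal.ofReal ((1 / (2 * a) * (fdVariance p * (σ ^ 2 / h.ν ^ 2) / h.S) + a / 2)
        + ((∑ j ∈ nodes p, |fdCoeff p j| * ((p + 1) * (L 1 / h.ν)) * (1 / (2 * a') * E + a' / 2))
          + e)) := by
  have hL1 := hpc.L1_pos
  have he0 : 0 ≤ e := (norm_nonneg _).trans (hfd x₀)
  have hV0 : 0 ≤ fdVariance p * (σ ^ 2 / h.ν ^ 2) / h.S := by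
    have : 0 ≤ fdVariance p := mul_nonneg (by positivity)
      (Finset.sum_nonneg fun j _ => by positivity)
    positivity
  set A := preBatchIdx t with hA
  have mrun := @measurable_run _ _ _ _ F G Ω (sampleInfo s A) hF.measurable hG.measurable h p x₀ y₀
    s t fun i hi => measurable_sampleInfo s ⟨Nat.lt_succ_of_lt hi, by
      rintro ⟨k, rfl⟩; exact lt_irrefl t hi⟩
  have my : ∀ j, Measurable[sampleInfo s A]
      (fun ω => (run F G p h x₀ y₀ (fun i => s i ω) (t + 1)).y j) := fun j =>
    @measurable_innerLoop _ _ _ _ F G Ω (sampleInfo s A) hF.measurable hG.measurable h j _ _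
      (fun k => s (.inner t j k)) mrun.1 (mrun.2 j) h.K fun i _ => measurable_sampleInfo s
        ⟨Nat.lt_succ_self t, by rintro ⟨k, hk⟩; cases hk⟩
  have mx' := mrun.1.mono (sampleInfo_le hs A) le_rfl
  have my' := fun j => (my j).mono (sampleInfo_le hs A) le_rfl
  have hb := lintegral_hyperGradEst_sub_le (p := p) hF hG hs hD hind (A := A)
    (idx := SampleIdx.batch t) (fun a b hab => by injection hab)
    (fun k hk => hk.2 ⟨k, rfl⟩) h hν hν1 hS hL1.le hpc.gradf_lip hpc.gradg_lip mrun.1 my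
  set X : Ω → Vec dx := fun ω => (run F G p h x₀ y₀ (fun i => s i ω) t).x with hX
  set Y : ℤ → Ω → Vec dy := fun j ω => (run F G p h x₀ y₀ (fun i => s i ω) (t + 1)).y j with hY
  set Φ : Ω → Vec dx := fun ω => hyperGradEst F G p h (X ω) (fun j => Y j ω)
    (fun i => s (.batch t i) ω) with hΦ
  set δ : ℤ → Ω → ℝ := fun j ω => ‖Y j ω - tiltSol f g (j * h.ν) (X ω)‖ with hδ
  have mδ : ∀ j ∈ nodes p, Measurable (δ j) := fun j hj =>
    ((my' j).sub ((hpc.continuous_tiltSol (hlam j hj)).measurable.comp mx')).norm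
  -- Three sources of error: the batch noise, the inner loops (amplified by `L_1/ν`), and the finite
  -- difference. The first two are linearized at the levels `a` and `a'`.
  have hpt : ∀ ω, ‖Φ ω - hyperGrad f g (X ω)‖
      ≤ (1 / (2 * a) * ‖Φ ω - hyperGradMean f g p h.ν (X ω) (fun j => Y j ω)‖ ^ 2 + a / 2)
        + ((∑ j ∈ nodes p, (|fdCoeff p j| * ((p + 1) * (L 1 / h.ν)) * (1 / (2 * a')) * δ j ω ^ 2
          + |fdCoeff p j| * ((p + 1) * (L 1 / h.ν)) * (a' / 2))) + e) := by
    intro ω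
    have h1 := le_sq_div_add ha ‖Φ ω - hyperGradMean f g p h.ν (X ω) (fun j => Y j ω)‖
    have h2 := norm_hyperGradMean_sub_le hpc hν hν1 (X ω) (fun j => Y j ω)
      (fun j => tiltSol f g (j * h.ν) (X ω))
    have h3 : ∑ j ∈ nodes p, |fdCoeff p j| * ((p + 1) * (L 1 / h.ν)) * δ j ω
        ≤ ∑ j ∈ nodes p, (|fdCoeff p j| * ((p + 1) * (L 1 / h.ν)) * (1 / (2 * a')) * δ j ω ^ 2
          + |fdCoeff p j| * ((p + 1) * (L 1 / h.ν)) * (a' / 2)) := by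
      refine Finset.sum_le_sum fun j _ => ?_
      have h4 : 0 ≤ |fdCoeff p j| * ((p + 1) * (L 1 / h.ν)) := by positivity
      have := mul_le_mul_of_nonneg_left (le_sq_div_add ha' (δ j ω)) h4
      linarith
    have h5 := hfd (X ω)
    have h6 : Φ ω - hyperGrad f g (X ω)
        = (Φ ω - hyperGradMean f g p h.ν (X ω) (fun j => Y j ω))
          + (hyperGradMean f g p h.ν (X ω) (fun j => Y j ω)
            - hyperGradMean f g p h.ν (X ω) (fun j => tiltSol f g (j * h.ν) (X ω)))
          + (hyperGradMean f g p h.ν (X ω) (fun j => tiltSol f g (j * h.ν) (X ω))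
            - hyperGrad f g (X ω)) := by abel
    rw [h6]
    refine (norm_add_le _ _).trans ((add_le_add_left (norm_add_le _ _) _).trans ?_)
    linarith
  refine (lintegral_mono fun ω => ENNReal.ofReal_le_ofReal (hpt ω)).trans ?_
  have hc : ∀ j, 0 ≤ |fdCoeff p j| * ((p + 1) * (L 1 / h.ν)) := fun j => by positivity
  have hm : ∀ j ∈ nodes p, Measurable (fun ω =>
      |fdCoeff p j| * ((p + 1) * (L 1 / h.ν)) * (1 / (2 * a')) * δ j ω ^ 2
          + |fdCoeff p j| * ((p + 1) * (L 1 / h.ν)) * (a' / 2)) := fun j hj =>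
    (((mδ j hj).pow_const 2).const_mul _).add_const _
  have hsum0 : 0 ≤ ∑ j ∈ nodes p, |fdCoeff p j| * ((p + 1) * (L 1 / h.ν))
      * (1 / (2 * a') * E + a' / 2) := Finset.sum_nonneg fun j _ => by
    have := hc j
    positivity
  refine lintegral_ofReal_add_le (by positivity) (by positivity)
    ((Finset.measurable_fun_sum _ hm).add_const _) ?_ ?_
  · exact lintegral_ofReal_affine_le (by positivity) (by positivity) hV0
      (fun ω => by positivity) hb
  · refine lintegral_ofReal_add_le hsum0 he0 measurable_const ?_ (by simp)
    refine lintegral_ofReal_sum_le (fun j _ => by have := hc j; positivity) hm fun j hj => ?_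
    refine (lintegral_ofReal_affine_le (by have := hc j; positivity)
      (by have := hc j; positivity) hE0 (fun ω => by positivity) (hE j hj)).trans
      (ENNReal.ofReal_le_ofReal (le_of_eq (by ring)))

omit [IsProbabilityMeasure D] hD hind in
/-- Stationarity of the average iterate, from the bounds on the estimates. -/
theorem average_norm_hyperGrad_le (hp : 1 ≤ p) (hηx : 0 < h.ηx) (hT : 0 < h.T) {e : ℝ}
    (he : ∀ t, ∫⁻ ω, ENNReal.ofReal ‖hyperGradEst F G p h (run F G p h x₀ y₀ (fun i => s i ω) t).x
        (run F G p h x₀ y₀ (fun i => s i ω) (t + 1)).y (fun i => s (.batch t i) ω)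
        - hyperGrad f g (run F G p h x₀ y₀ (fun i => s i ω) t).x‖ ∂P ≤ ENNReal.ofReal e)
    (he0 : 0 ≤ e) :
    (∀ t, Integrable (fun ω => ‖hyperGrad f g (run F G p h x₀ y₀ (fun i => s i ω) t).x‖) P) ∧
    1 / (h.T : ℝ) * ∑ t ∈ Finset.range h.T,
        ∫ ω, ‖hyperGrad f g (run F G p h x₀ y₀ (fun i => s i ω) t).x‖ ∂P
      ≤ Δ / (h.ηx * h.T) + 2 * e + 20 * (L 1 * cond p L μ ^ 3) * h.ηx := by
  have hL1 := hpc.L1_pos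
  have hκ := hpc.cond_pos
  have mrun := fun t => measurable_run hF.measurable hG.measurable h p x₀ y₀ (s := s) t
    fun i _ => hs i
  have mhg : ∀ t, Measurable (fun ω => hyperGrad f g (run F G p h x₀ y₀ (fun i => s i ω) t).x) :=
    fun t => (continuous_hyperGrad hpc hp).measurable.comp (mrun t).1
  have mΦ : ∀ t, Measurable (fun ω => hyperGradEst F G p h
      (run F G p h x₀ y₀ (fun i => s i ω) t).x (run F G p h x₀ y₀ (fun i => s i ω) (t + 1)).y
      (fun i => s (.batch t i) ω)) := fun t =>
    measurable_hyperGradEst hF.measurable hG.measurable h p (mrun t).1 (mrun (t + 1)).2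
      (t := fun i => s (.batch t i)) fun i => hs _
  have int1 : ∀ t, Integrable
      (fun ω => ‖hyperGrad f g (run F G p h x₀ y₀ (fun i => s i ω) t).x‖) P := by
    intro t
    refine Integrable.of_bound (C := ‖hyperGrad f g x₀‖
      + 20 * (L 1 * cond p L μ ^ 3) * (t * h.ηx)) (mhg t).norm.aestronglyMeasurable
      (Filter.Eventually.of_forall fun ω => ?_)
    rw [norm_norm]
    have h1 := hpc.norm_hyperGrad_sub_le hp (run F G p h x₀ y₀ (fun i => s i ω) t).x x₀
    have h2 := norm_run_sub_le (F := F) (G := G) (p := p) (x₀ := x₀) h y₀ hηx.le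
      (fun i => s i ω) t
    have h3 := norm_sub_norm_le (hyperGrad f g (run F G p h x₀ y₀ (fun i => s i ω) t).x)
      (hyperGrad f g x₀)
    have h4 : 20 * (L 1 * cond p L μ ^ 3) * ‖(run F G p h x₀ y₀ (fun i => s i ω) t).x - x₀‖
        ≤ 20 * (L 1 * cond p L μ ^ 3) * (t * h.ηx) := by gcongr
    linarith
  refine ⟨int1, ?_⟩
  set u : ℕ → Ω → ℝ := fun t ω => ‖hyperGradEst F G p h
      (run F G p h x₀ y₀ (fun i => s i ω) t).x (run F G p h x₀ y₀ (fun i => s i ω) (t + 1)).y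
      (fun i => s (.batch t i) ω) - hyperGrad f g (run F G p h x₀ y₀ (fun i => s i ω) t).x‖ with hu
  have mu : ∀ t, Measurable (u t) := fun t => ((mΦ t).sub (mhg t)).norm
  have u0 : ∀ t ω, 0 ≤ u t ω := fun t ω => norm_nonneg _
  have int2 : ∀ t, Integrable (u t) P := fun t =>
    ⟨(mu t).aestronglyMeasurable, by
      rw [hasFiniteIntegral_iff_ofReal (Filter.Eventually.of_forall (u0 t))]
      exact (he t).trans_lt ENNReal.ofReal_lt_top⟩
  have hue : ∀ t, ∫ ω, u t ω ∂P ≤ e := fun t => by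
    have h1 := ofReal_integral_eq_lintegral_ofReal (int2 t) (Filter.Eventually.of_forall (u0 t))
    rw [← ENNReal.ofReal_le_ofReal_iff he0, h1]
    exact he t
  have hpt : ∀ ω, h.ηx * ∑ t ∈ Finset.range h.T,
        ‖hyperGrad f g (run F G p h x₀ y₀ (fun i => s i ω) t).x‖
      ≤ Δ + 2 * h.ηx * ∑ t ∈ Finset.range h.T, u t ω
        + h.T * (20 * (L 1 * cond p L μ ^ 3) * h.ηx ^ 2) := fun ω =>
    sum_norm_hyperGrad_le hpc hp hηx.le (x := fun t => (run F G p h x₀ y₀ (fun i => s i ω) t).x)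
      (Φ := fun t => hyperGradEst F G p h (run F G p h x₀ y₀ (fun i => s i ω) t).x
        (run F G p h x₀ y₀ (fun i => s i ω) (t + 1)).y (fun i => s (.batch t i) ω))
      rfl (fun t => rfl) h.T
  have intL : Integrable (fun ω => h.ηx * ∑ t ∈ Finset.range h.T,
      ‖hyperGrad f g (run F G p h x₀ y₀ (fun i => s i ω) t).x‖) P :=
    (integrable_finsetSum _ fun t _ => int1 t).const_mul _
  have intS : Integrable (fun ω => 2 * h.ηx * ∑ t ∈ Finset.range h.T, u t ω) P :=
    (integrable_finsetSum _ fun t _ => int2 t).const_mul _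
  have intM : Integrable (fun ω => Δ + 2 * h.ηx * ∑ t ∈ Finset.range h.T, u t ω) P :=
    (integrable_const Δ).add intS
  have h1 := integral_mono intL (intM.add (integrable_const
    (h.T * (20 * (L 1 * cond p L μ ^ 3) * h.ηx ^ 2)))) hpt
  simp only [Pi.add_apply] at h1
  rw [integral_const_mul, integral_finsetSum _ fun t _ => int1 t,
    integral_add intM (integrable_const _), integral_add (integrable_const Δ) intS,
    integral_const_mul, integral_finsetSum _ fun t _ => int2 t] at h1
  simp only [integral_const, probReal_univ, smul_eq_mul, one_mul] at h1
  have h2 : ∑ t ∈ Finset.range h.T, ∫ ω, u t ω ∂P ≤ h.T * e := by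
    refine (Finset.sum_le_sum fun t _ => hue t).trans ?_
    simp
  have hT' : (0 : ℝ) < h.T := by exact_mod_cast hT
  have h3 : h.ηx * ∑ t ∈ Finset.range h.T,
      ∫ ω, ‖hyperGrad f g (run F G p h x₀ y₀ (fun i => s i ω) t).x‖ ∂P
      ≤ Δ + 2 * h.ηx * (h.T * e) + h.T * (20 * (L 1 * cond p L μ ^ 3) * h.ηx ^ 2) :=
    h1.trans (by gcongr)
  have h4 : Δ / (h.ηx * h.T) + 2 * e + 20 * (L 1 * cond p L μ ^ 3) * h.ηx
      = (Δ + 2 * h.ηx * (h.T * e) + h.T * (20 * (L 1 * cond p L μ ^ 3) * h.ηx ^ 2))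
        / (h.ηx * h.T) := by field_simp
  rw [h4, le_div_iff₀ (by positivity)]
  calc _ = h.ηx * ∑ t ∈ Finset.range h.T,
      ∫ ω, ‖hyperGrad f g (run F G p h x₀ y₀ (fun i => s i ω) t).x‖ ∂P := by field_simp
    _ ≤ _ := h3

end Run

/-! ### Arithmetic of the hyper-parameters and the complexity bounds. -/

section Parameters

variable {p : ℕ} {L : ℕ → ℝ} {μ ε : ℝ}

theorem baseStep_pos (hκ : 0 < cond p L μ) (hΛ : 0 < Lbar p L) (hε : 0 < ε) :
    0 < baseStep p L μ ε :=
  Real.rpow_pos_of_pos (by positivity) _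

/-- The calibration behind `baseStep`: the finite difference error bound, up to its constant, is
exactly `ε` there. -/
theorem mul_baseStep_pow (hp : 1 ≤ p) (hκ : 0 < cond p L μ) (hΛ : 0 < Lbar p L) (hε : 0 < ε) :
    Lbar p L * cond p L μ * (cond p L μ ^ 2 * baseStep p L μ ε) ^ p = ε := by
  have h1 : baseStep p L μ ε ^ p = ε / (Lbar p L * cond p L μ ^ (2 * p + 1)) := by
    rw [baseStep, one_div]
    exact Real.rpow_inv_natCast_pow (by positivity) (by omega)
  rw [mul_pow, h1, ← pow_mul, pow_succ]
  field_simp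

theorem sq_mul_baseStep_le_one (hp : 1 ≤ p) (hκ : 0 < cond p L μ) (hΛ : 0 < Lbar p L) (hε : 0 < ε)
    (hεκ : ε ≤ Lbar p L * cond p L μ) : cond p L μ ^ 2 * baseStep p L μ ε ≤ 1 := by
  have h0 := baseStep_pos hκ hΛ hε
  rw [← pow_le_one_iff_of_nonneg (by positivity) (by omega : p ≠ 0)]
  have h1 := mul_baseStep_pow hp hκ hΛ hε
  have h2 : 0 < Lbar p L * cond p L μ := by positivity
  by_contra! h3
  nlinarith

/-- Replaces the `p`-th power by the first, the base being at most 1. It compares the outer step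
with `R` in `ηx_mul_le`. -/
theorem le_mul_baseStep (hp : 1 ≤ p) (hκ : 0 < cond p L μ) (hΛ : 0 < Lbar p L) (hε : 0 < ε)
    (hεκ : ε ≤ Lbar p L * cond p L μ) :
    ε ≤ Lbar p L * cond p L μ ^ 2 * (cond p L μ * baseStep p L μ ε) := by
  have h0 := baseStep_pos hκ hΛ hε
  have h1 := sq_mul_baseStep_le_one hp hκ hΛ hε hεκ
  have h2 := pow_le_of_le_one (by positivity) h1 (by omega : p ≠ 0)
  calc ε = Lbar p L * cond p L μ * (cond p L μ ^ 2 * baseStep p L μ ε) ^ p :=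
        (mul_baseStep_pow hp hκ hΛ hε).symm
    _ ≤ Lbar p L * cond p L μ * (cond p L μ ^ 2 * baseStep p L μ ε) := by gcongr
    _ = _ := by ring

theorem one_div_baseStep_sq (hp : 1 ≤ p) (hκ : 0 < cond p L μ) (hΛ : 0 < Lbar p L) (hε : 0 < ε) :
    1 / baseStep p L μ ε ^ 2
      = Lbar p L ^ (2 / (p : ℝ)) * cond p L μ ^ (4 + 2 / (p : ℝ)) / ε ^ (2 / (p : ℝ)) := by
  have hp' : (p : ℝ) ≠ 0 := by exact_mod_cast (by omega : p ≠ 0)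
  have h1 : baseStep p L μ ε ^ 2 = (ε / (Lbar p L * cond p L μ ^ (2 * p + 1))) ^ (2 / (p : ℝ)) := by
    rw [baseStep, ← Real.rpow_natCast, ← Real.rpow_mul (by positivity)]
    congr 1
    push_cast
    ring
  have h2 : cond p L μ ^ (4 + 2 / (p : ℝ)) = (cond p L μ ^ (2 * p + 1)) ^ (2 / (p : ℝ)) := by
    rw [← Real.rpow_natCast, ← Real.rpow_mul hκ.le]
    congr 1
    push_cast
    field_simp
    ring
  rw [h1, h2, Real.div_rpow hε.le (by positivity), Real.mul_rpow hΛ.le (by positivity)]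
  field_simp

/-- Splits the rate into the orders of `T` and, up to the logarithm, of `K`; the exponents `2 / p`
come from `1 / ν²`. -/
theorem rate_eq (hp : 1 ≤ p) {Δ σ : ℝ} (hκ : 0 < cond p L μ) (hΛ : 0 < Lbar p L) (hε : 0 < ε) :
    rate p L μ Δ σ ε = p * (Δ * L 1 * cond p L μ ^ 3 / ε ^ 2)
      * (cond p L μ ^ 2 * σ ^ 2 / (baseStep p L μ ε ^ 2 * ε ^ 2)) := by
  have h1 := one_div_baseStep_sq hp hκ hΛ hε
  have h2 : cond p L μ ^ (9 + 2 / (p : ℝ))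
      = cond p L μ ^ 5 * cond p L μ ^ (4 + 2 / (p : ℝ)) := by
    rw [show (9 : ℝ) + 2 / p = (5 : ℕ) + (4 + 2 / p) by push_cast; ring, Real.rpow_add hκ,
      Real.rpow_natCast]
  have h3 : ε ^ (4 + 2 / (p : ℝ)) = ε ^ 4 * ε ^ (2 / (p : ℝ)) := by
    rw [show (4 : ℝ) + 2 / p = (4 : ℕ) + 2 / p by push_cast; ring, Real.rpow_add hε,
      Real.rpow_natCast]
  have h4 : cond p L μ ^ 2 * σ ^ 2 / (baseStep p L μ ε ^ 2 * ε ^ 2)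
      = cond p L μ ^ 2 * σ ^ 2 / ε ^ 2 * (1 / baseStep p L μ ε ^ 2) := by
    field_simp
  rw [rate, h2, h3, h4, h1]
  field_simp

end Parameters

theorem natCeil_le_of_one_le {a c z : ℝ} (hc : 0 ≤ c) (ha : a ≤ c * z) (hz : 1 ≤ z) :
    (⌈a⌉₊ : ℝ) ≤ (c + 1) * z := by
  rcases le_or_gt a 0 with h | h
  · rw [Nat.ceil_eq_zero.2 h, Nat.cast_zero]; positivity
  · have := (Nat.ceil_lt_add_one h.le).le
    linarith

/-- The factors of the complexity bound. -/
def Factors.cost (c : Factors) : ℝ := (c.cT / c.cx + 1) * ((2 * c.cS + 4 + c.cK) / c.cν ^ 2)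

section Regime

variable {dx dy p : ℕ} {L : ℕ → ℝ} {μ Δ σ R ε : ℝ} {f g : Vec dx → Vec dy → ℝ} {x₀ : Vec dx}
  {c : Factors}

theorem params_ν (hκ : 0 < cond p L μ) (hR : cond p L μ * baseStep p L μ ε ≤ R) :
    (c.params p L μ Δ σ R ε).ν = c.cν * baseStep p L μ ε := by
  have h1 : baseStep p L μ ε ≤ R / cond p L μ := by
    rw [le_div_iff₀ hκ]; linarith
  simp only [Factors.params, min_eq_right h1]

namespace ProblemClass

variable (hpc : ProblemClass p L μ Δ f g x₀) (hp : 1 ≤ p) (hε : 0 < ε)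
  (hεκ : ε ≤ Lbar p L * cond p L μ)
include hpc hp hε hεκ

omit hp in
/-- The argument of the logarithm in the choice of `K` is at least `1 / cν`. -/
theorem one_div_le_logArg (hc : 0 < c.cν) (hR : cond p L μ * baseStep p L μ ε ≤ R) :
    1 / c.cν ≤ R * L 1 * cond p L μ / (c.cν * baseStep p L μ ε * ε) := by
  have hκ := hpc.cond_pos
  have hν0 := baseStep_pos hκ hpc.Lbar_pos hε
  have hL1 := hpc.L1_pos
  rw [div_le_div_iff₀ hc (by positivity)]
  have h1 : ε ≤ L 1 * cond p L μ ^ 2 := by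
    refine hεκ.trans ?_
    rw [hpc.Lbar_eq]
    have := hpc.μ_le
    calc _ = μ * cond p L μ ^ 2 := by ring
      _ ≤ _ := by gcongr
  calc 1 * (c.cν * baseStep p L μ ε * ε)
      ≤ 1 * (c.cν * baseStep p L μ ε * (L 1 * cond p L μ ^ 2)) := by gcongr
    _ = cond p L μ * baseStep p L μ ε * (L 1 * cond p L μ * c.cν) := by ring
    _ ≤ R * (L 1 * cond p L μ * c.cν) := by gcongr
    _ = _ := by ring

omit hp in
theorem half_le_log (hc : 0 < c.cν) (hc2 : c.cν ≤ 1 / 2)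
    (hR : cond p L μ * baseStep p L μ ε ≤ R) :
    1 / 2 ≤ Real.log (R * L 1 * cond p L μ / (c.cν * baseStep p L μ ε * ε)) := by
  have h1 := hpc.one_div_le_logArg hε hεκ hc hR
  have h2 : (2 : ℝ) ≤ 1 / c.cν := by rw [le_div_iff₀ hc]; linarith
  have h3 := Real.log_le_log two_pos (h2.trans h1)
  have := Real.log_two_gt_d9
  linarith

/-- `T` is of order `U`, `K` of order `W` times the logarithm, and `S` is smaller than `W` up to
constants. The last two hypotheses give `1 ≤ W` and `1 ≤ U`, so rounding up costs constant factors
only. -/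
theorem cost_le (hc : c.Pos) (hc2 : c.cν ≤ 1 / 2) (hσ : 0 < σ)
    (hR : cond p L μ * baseStep p L μ ε ≤ R)
    (hνσ : baseStep p L μ ε ^ 2 * ε ^ 2 ≤ cond p L μ * σ ^ 2)
    (hΔ : ε ^ 2 ≤ Δ * L 1 * cond p L μ ^ 3) :
    (p : ℝ) * (c.params p L μ Δ σ R ε).T
        * ((c.params p L μ Δ σ R ε).S + (c.params p L μ Δ σ R ε).K)
      ≤ c.cost * (rate p L μ Δ σ ε *
        Real.log (R * L 1 * cond p L μ / ((c.params p L μ Δ σ R ε).ν * ε))) := by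
  obtain ⟨hcν, hcx, hcy, hcS, hcK, hcT⟩ := hc
  have hκ := hpc.cond_pos
  have hκ1 := hpc.one_le_cond
  have hν0 := baseStep_pos hκ hpc.Lbar_pos hε
  have hL1 := hpc.L1_pos
  have hΔ0 := hpc.Δ_pos
  have hlog := hpc.half_le_log hε hεκ hcν hc2 hR
  have hνeq := params_ν (c := c) (Δ := Δ) (σ := σ) hκ hR
  rw [rate_eq hp hκ hpc.Lbar_pos hε, hνeq]
  set κ := cond p L μ
  set ν₀ := baseStep p L μ ε
  set ℓ := Real.log (R * L 1 * κ / (c.cν * ν₀ * ε)) with hℓ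
  set U := Δ * L 1 * κ ^ 3 / ε ^ 2 with hU
  set W := κ ^ 2 * σ ^ 2 / (ν₀ ^ 2 * ε ^ 2) with hW
  set Z := W / c.cν ^ 2 * ℓ with hZ
  have hW0 : 0 < W := by positivity
  have hU1 : 1 ≤ U := by rw [hU, le_div_iff₀ (by positivity)]; linarith
  have hW1 : 1 ≤ W := by
    rw [hW, le_div_iff₀ (by positivity), one_mul]
    refine hνσ.trans ?_
    gcongr
    nlinarith
  have hcν2 : W ≤ W / c.cν ^ 2 := by
    rw [le_div_iff₀ (by positivity)]
    exact mul_le_of_le_one_right hW0.le (pow_le_one₀ hcν.le (by linarith))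
  have hWZ : W / c.cν ^ 2 ≤ 2 * Z := by
    have : 0 ≤ W / c.cν ^ 2 := by positivity
    rw [hZ]; nlinarith
  -- The logarithm is only known to be at least `1/2`, so the unit for both `S` and `K` is `2 Z`.
  have hZ1 : 1 ≤ 2 * Z := by linarith
  have hT : ((c.params p L μ Δ σ R ε).T : ℝ) ≤ (c.cT / c.cx + 1) * U := by
    refine natCeil_le_of_one_le (by positivity) (le_of_eq ?_) hU1
    rw [hU]
    field_simp
    rfl
  have hS : ((c.params p L μ Δ σ R ε).S : ℝ) ≤ (c.cS + 1) * (2 * Z) := by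
    refine natCeil_le_of_one_le hcS.le ?_ hZ1
    change c.cS * (σ ^ 2 / ((c.params p L μ Δ σ R ε).ν ^ 2 * ε ^ 2)) ≤ _
    gcongr
    refine le_trans ?_ hWZ
    rw [hνeq, hW, mul_pow, div_div]
    have h1 : κ ^ 2 * σ ^ 2 / (ν₀ ^ 2 * ε ^ 2 * c.cν ^ 2)
        = κ ^ 2 * (σ ^ 2 / (c.cν ^ 2 * ν₀ ^ 2 * ε ^ 2)) := by field_simp
    rw [h1]
    exact le_mul_of_one_le_left (by positivity) (one_le_pow₀ hκ1)
  have hK : ((c.params p L μ Δ σ R ε).K : ℝ) ≤ (c.cK / 2 + 1) * (2 * Z) := by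
    refine natCeil_le_of_one_le (by positivity) ?_ hZ1
    change c.cK * (κ ^ 2 * σ ^ 2 / ((c.params p L μ Δ σ R ε).ν ^ 2 * ε ^ 2)
      * Real.log (R * L 1 * κ / ((c.params p L μ Δ σ R ε).ν * ε))) ≤ _
    rw [hνeq, ← hℓ, hZ, hW, mul_pow]
    refine le_of_eq ?_
    field_simp
  have hZ0 : 0 ≤ Z := by linarith
  calc (p : ℝ) * (c.params p L μ Δ σ R ε).T
        * ((c.params p L μ Δ σ R ε).S + (c.params p L μ Δ σ R ε).K)
      ≤ p * ((c.cT / c.cx + 1) * U) * ((c.cS + 1) * (2 * Z) + (c.cK / 2 + 1) * (2 * Z)) := by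
        gcongr
    _ = c.cost * (p * U * W * ℓ) := by
        rw [Factors.cost, hZ]
        field_simp
        ring

/-- Under the additional conditions, the logarithm can be stated without `ν`. -/
theorem log_le (hc : 0 < c.cν) (hc2 : c.cν ≤ 1 / 2) (hR : cond p L μ * baseStep p L μ ε ≤ R)
    (hε2 : ε ≤ 1 / 2) (hεRL : ε ≤ (R * L 1 * Lbar p L) ^ 2) :
    Real.log (R * L 1 * cond p L μ / (c.cν * baseStep p L μ ε * ε))
      ≤ (6 + 4 * Real.log (1 / c.cν)) * Real.log (R * L 1 * Lbar p L * cond p L μ / ε) := by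
  have hκ := hpc.cond_pos
  have hΛ := hpc.Lbar_pos
  have hν0 := baseStep_pos hκ hΛ hε
  have hL1 := hpc.L1_pos
  have hR0 : 0 < R := lt_of_lt_of_le (by positivity) hR
  have hp' : (1 : ℝ) ≤ p := by exact_mod_cast hp
  have hRL : 0 < R * L 1 := by positivity
  set A := Real.log (R * L 1) with hA
  set B := Real.log (Lbar p L) with hB
  set k := Real.log (cond p L μ) with hk
  set e := -Real.log ε with he
  set b := Real.log (1 / c.cν) with hb
  have hk0 : 0 ≤ k := Real.log_nonneg hpc.one_le_cond
  have he1 : 1 / 2 ≤ e := by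
    have h1 := Real.log_le_log hε hε2
    rw [one_div, Real.log_inv] at h1
    have := Real.log_two_gt_d9
    rw [he]; linarith
  have hb0 : 0 ≤ b := Real.log_nonneg (by rw [le_div_iff₀ hc]; linarith)
  have h2 : -e ≤ 2 * (A + B) := by
    have := Real.log_le_log hε hεRL
    rw [Real.log_pow, Real.log_mul hRL.ne' hΛ.ne'] at this
    push_cast at this
    rw [he, neg_neg]; exact this
  have h3 : -e ≤ B + k := by
    have := Real.log_le_log hε hεκ
    rw [Real.log_mul hΛ.ne' hκ.ne'] at this
    rw [he, neg_neg]; exact this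
  have hν : Real.log (baseStep p L μ ε) = 1 / (p : ℝ) * (-e - (B + (2 * p + 1) * k)) := by
    rw [baseStep, Real.log_rpow (by positivity), Real.log_div hε.ne' (by positivity),
      Real.log_mul hΛ.ne' (by positivity), Real.log_pow, he, neg_neg]
    push_cast
    ring
  have hb' : Real.log c.cν = -b := by rw [hb, one_div, Real.log_inv, neg_neg]
  have hl : Real.log (R * L 1 * cond p L μ / (c.cν * baseStep p L μ ε * ε))
      = A + k + b + e + 1 / (p : ℝ) * (e + B + (2 * p + 1) * k) := by
    rw [Real.log_div (by positivity) (by positivity), Real.log_mul hRL.ne' hκ.ne',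
      Real.log_mul (by positivity) hε.ne', Real.log_mul hc.ne' hν0.ne', hν, hb']
    linear_combination -he
  have hr : Real.log (R * L 1 * Lbar p L * cond p L μ / ε) = A + B + k + e := by
    rw [Real.log_div (by positivity) hε.ne', Real.log_mul (by positivity) hκ.ne',
      Real.log_mul hRL.ne' hΛ.ne', he]
    ring
  rw [hl, hr]
  set w := 1 / (p : ℝ) with hw
  have hw0 : 0 ≤ w := by positivity
  have hw1 : w ≤ 1 := by rw [hw, div_le_one (by positivity)]; exact hp'
  have hwp : w * p = 1 := by rw [hw]; field_simp
  have hexp : w * (e + B + (2 * p + 1) * k) = w * e + w * B + 2 * k + w * k := by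
    linear_combination (2 * k) * hwp
  rw [hexp]
  have h4 : 0 ≤ (1 - w) * (B + k + e) := mul_nonneg (by linarith) (by linarith)
  -- By `h2`, `A + B + k + e ≥ k + e/2 ≥ 1/4`. One copy of this sum pays for `A + B + k + e`, five
  -- copies for the rest `e + 3 k`, and the multiple `4 b` for `b`.
  have h5 : b ≤ b * (4 * (A + B + k + e)) := le_mul_of_one_le_right hb0 (by linarith)
  nlinarith

end ProblemClass

end Regime

/-! ### The explicit constant factors. -/

theorem one_sub_pow_le_pow {a r : ℝ} {n k : ℕ} (ha : a ≤ 1) (hr : 0 < r)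
    (h : n * Real.log (1 / r) ≤ a * k) : (1 - a) ^ k ≤ r ^ n := by
  rw [one_div, Real.log_inv] at h
  calc (1 - a) ^ k ≤ Real.exp (-a) ^ k :=
        pow_le_pow_left₀ (by linarith) (Real.one_sub_le_exp_neg a) k
    _ = Real.exp (k * -a) := (Real.exp_nat_mul _ _).symm
    _ ≤ Real.exp (n * Real.log r) := Real.exp_le_exp.2 (by linarith)
    _ = r ^ n := by rw [Real.exp_nat_mul, Real.exp_log hr]

theorem fdVariance_nonneg (p : ℕ) : 0 ≤ fdVariance p :=
  mul_nonneg (by positivity) (Finset.sum_nonneg fun j _ => by positivity)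

/-- The amplification of the errors of the inner loops by the difference formula. -/
def fdAmplification (p : ℕ) : ℝ := (p + 1) * ∑ j ∈ nodes p, |fdCoeff p j|

theorem fdAmplification_nonneg (p : ℕ) : 0 ≤ fdAmplification p :=
  mul_nonneg (by positivity) (Finset.sum_nonneg fun j _ => by positivity)

/-- The relative accuracy asked of the inner loops. -/
def innerAccuracy (p : ℕ) : ℝ := 1 / (32 * (fdAmplification p + 1))

/-- The constant factors, with the constant `C` of the finite difference error. -/
def admissibleFactors (p : ℕ) (C : ℝ) : Factors where
  -- The summands serve the penalty range (`p`), the finite difference error (`C`), and `cν ≤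
  -- innerAccuracy / 4` (`fdAmplification`).
  cν := 1 / (128 * (p + C + fdAmplification p + 1))
  -- `20 / 80`: the smoothness term becomes `ε / 4`.
  cx := 1 / 80
  cy := innerAccuracy p ^ 2 / 32
  -- Makes the variance of the batch at most `(ε/32)²`; the `+ 1` keeps the factor positive in any
  -- case.
  cS := 1024 * fdVariance p + 1
  -- With `cy * cK = 8`, the exponent `ηy (μ/2) K` is at least four times the logarithm.
  cK := 8 / (innerAccuracy p ^ 2 / 32)
  cT := 4

theorem innerAccuracy_pos (p : ℕ) : 0 < innerAccuracy p := by
  have := fdAmplification_nonneg p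
  rw [innerAccuracy]
  positivity

theorem innerAccuracy_le (p : ℕ) : innerAccuracy p ≤ 1 / 32 := by
  have := fdAmplification_nonneg p
  rw [innerAccuracy]
  gcongr
  linarith

theorem fdAmplification_mul_innerAccuracy_le (p : ℕ) :
    fdAmplification p * innerAccuracy p ≤ 1 / 32 := by
  have := fdAmplification_nonneg p
  rw [innerAccuracy, mul_one_div, div_le_div_iff₀ (by positivity) (by norm_num)]
  linarith

section Factors

variable {p : ℕ} {C : ℝ} (hC : 0 ≤ C)
include hC

theorem admissibleFactors_pos : (admissibleFactors p C).Pos := by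
  have h1 := fdAmplification_nonneg p
  have h2 := fdVariance_nonneg p
  have h3 := innerAccuracy_pos p
  refine ⟨?_, ?_, ?_, ?_, ?_, ?_⟩ <;> simp only [admissibleFactors] <;> positivity

theorem cν_le : (admissibleFactors p C).cν ≤ 1 / 128 := by
  have h1 := fdAmplification_nonneg p
  have h2 : (0 : ℝ) ≤ p := by positivity
  simp only [admissibleFactors]
  gcongr
  linarith

theorem cν_le_innerAccuracy : (admissibleFactors p C).cν ≤ innerAccuracy p / 4 := by
  have h1 := fdAmplification_nonneg p
  have h2 : (0 : ℝ) ≤ p := by positivity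
  rw [innerAccuracy, div_div]
  simp only [admissibleFactors]
  exact one_div_le_one_div_of_le (by positivity) (by linarith)

theorem natCast_mul_cν_le : p * (admissibleFactors p C).cν ≤ 1 / 128 := by
  have h1 := fdAmplification_nonneg p
  have h2 : (0 : ℝ) ≤ p := by positivity
  simp only [admissibleFactors]
  rw [mul_one_div, div_le_div_iff₀ (by positivity) (by norm_num)]
  linarith

theorem mul_cν_le : C * (admissibleFactors p C).cν ≤ 1 / 128 := by
  have h1 := fdAmplification_nonneg p
  have h2 : (0 : ℝ) ≤ p := by positivity
  simp only [admissibleFactors]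
  rw [mul_one_div, div_le_div_iff₀ (by positivity) (by norm_num)]
  linarith

end Factors

/-! ### Stationarity under the prescribed hyper-parameters. -/

namespace ProblemClass

variable {dx dy p : ℕ} {L : ℕ → ℝ} {μ Δ σ R ε C : ℝ} {f g : Vec dx → Vec dy → ℝ}
  {𝒮 : Type*} [MeasurableSpace 𝒮] {D : Measure 𝒮} [IsProbabilityMeasure D]
  {F G : Vec dx → Vec dy → 𝒮 → Joint dx dy} {x₀ : Vec dx} {y₀ : Vec dy}
  {Ω : Type*} [MeasurableSpace Ω] {P : Measure Ω} [IsProbabilityMeasure P]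
  {s : SampleIdx → Ω → 𝒮} {h : Params}

section

set_option linter.unusedSectionVars false

variable (hpc : ProblemClass p L μ Δ f g x₀) (hp : 1 ≤ p) (hε : 0 < ε)
  (hεκ : ε ≤ Lbar p L * cond p L μ) (hR : cond p L μ * baseStep p L μ ε ≤ R) (hC : 0 ≤ C)
  (hh : h = (admissibleFactors p C).params p L μ Δ σ R ε)
include hpc hε hR hC hh

theorem ν_eq : h.ν = (admissibleFactors p C).cν * baseStep p L μ ε := by
  rw [hh, params_ν hpc.cond_pos hR]

theorem ν_pos : 0 < h.ν := by
  rw [hpc.ν_eq hε hR hC hh]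
  exact mul_pos (admissibleFactors_pos hC).1 (baseStep_pos hpc.cond_pos hpc.Lbar_pos hε)

include hp hεκ

theorem sq_cond_mul_ν_le : cond p L μ ^ 2 * h.ν ≤ (admissibleFactors p C).cν := by
  rw [hpc.ν_eq hε hR hC hh]
  have h1 := sq_mul_baseStep_le_one hp hpc.cond_pos hpc.Lbar_pos hε hεκ
  have := (admissibleFactors_pos (p := p) hC).1
  nlinarith

theorem ν_le : h.ν ≤ (admissibleFactors p C).cν := by
  refine le_trans ?_ (hpc.sq_cond_mul_ν_le hp hε hεκ hR hC hh)
  exact le_mul_of_one_le_left (hpc.ν_pos hε hR hC hh).le (one_le_pow₀ hpc.one_le_cond)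

theorem abs_mul_ν_mul_le {j : ℤ} (hj : j ∈ nodes p) : |(j : ℝ) * h.ν| * L 1 ≤ μ / 4 := by
  have h1 := hpc.sq_cond_mul_ν_le hp hε hεκ hR hC hh
  have h2 := hpc.ν_pos hε hR hC hh
  have h3 := natCast_mul_cν_le (p := p) hC
  have h4 := abs_le_of_mem_nodes hj
  have h5 := hpc.one_le_cond
  have hμ := hpc.μ_pos
  have hL1 := hpc.L1_pos
  have h6 : L 1 ≤ cond p L μ ^ 2 * μ := by
    have : L 1 ≤ cond p L μ * μ := by
      rw [← hpc.Lbar_eq]; exact le_Lbar (by omega)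
    nlinarith [mul_nonneg (mul_nonneg hpc.cond_pos.le hμ.le) (sub_nonneg.2 h5)]
  rw [abs_mul, abs_of_pos h2]
  calc |(j : ℝ)| * h.ν * L 1 ≤ p * h.ν * (cond p L μ ^ 2 * μ) := by gcongr
    _ = p * (cond p L μ ^ 2 * h.ν) * μ := by ring
    _ ≤ p * (admissibleFactors p C).cν * μ := by gcongr
    _ ≤ 1 / 128 * μ := by gcongr
    _ ≤ μ / 4 := by linarith

/-- The penalty displaces the solution by at most `2 p ν κ`, which is below `R` because `κ ν₀ ≤ R`.
-/
theorem norm_init_sub_tiltSol_le (hy : ‖y₀ - lowerSol g x₀‖ ≤ R) {j : ℤ} (hj : j ∈ nodes p) :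
    ‖y₀ - tiltSol f g (j * h.ν) x₀‖ ≤ 2 * R := by
  have h1 := hpc.norm_tiltSol_sub_lowerSol_le
    (hpc.abs_mul_ν_mul_le hp hε hεκ hR hC hh hj) x₀
  have h2 := hpc.ν_pos hε hR hC hh
  have h3 := natCast_mul_cν_le (p := p) hC
  have h4 := abs_le_of_mem_nodes hj
  have h5 := baseStep_pos hpc.cond_pos hpc.Lbar_pos hε
  have hμ := hpc.μ_pos
  have hκ := hpc.cond_pos
  have hL00 := hpc.L_pos 0 (by omega)
  have hL0 : L 0 / μ ≤ cond p L μ := by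
    rw [div_le_iff₀ hμ, ← hpc.Lbar_eq]; exact le_Lbar (by omega)
  have h6 : 2 * |(j : ℝ) * h.ν| * (L 0 / μ) ≤ R := by
    rw [abs_mul, abs_of_pos h2]
    calc 2 * (|(j : ℝ)| * h.ν) * (L 0 / μ) ≤ 2 * (p * h.ν) * cond p L μ := by gcongr
      _ = 2 * (p * (admissibleFactors p C).cν) * (cond p L μ * baseStep p L μ ε) := by
        rw [hpc.ν_eq hε hR hC hh]; ring
      _ ≤ 2 * (1 / 128) * (cond p L μ * baseStep p L μ ε) := by gcongr
      _ ≤ 1 * (cond p L μ * baseStep p L μ ε) := by gcongr; norm_num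
      _ ≤ R := by linarith
  have h7 := norm_sub_le_norm_sub_add_norm_sub y₀ (lowerSol g x₀) (tiltSol f g (j * h.ν) x₀)
  rw [norm_sub_rev (lowerSol g x₀)] at h7
  linarith

theorem fd_error_le (x : Vec dx)
    (hfd : ∀ ν : ℝ, 0 < ν → p * (cond p L μ ^ 2 * ν) ≤ 1 / 4 →
      ‖hyperGradMean f g p ν x (fun j => tiltSol f g (j * ν) x) - hyperGrad f g x‖
        ≤ C * (Lbar p L * cond p L μ * (cond p L μ ^ 2 * ν) ^ p)) :
    ‖hyperGradMean f g p h.ν x (fun j => tiltSol f g (j * h.ν) x) - hyperGrad f g x‖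
      ≤ ε / 32 := by
  have h1 := hpc.sq_cond_mul_ν_le hp hε hεκ hR hC hh
  have h2 := hpc.ν_pos hε hR hC hh
  have h3 := natCast_mul_cν_le (p := p) hC
  have h4 := mul_cν_le (p := p) hC
  have h5 := (admissibleFactors_pos (p := p) hC).1
  have h6 := cν_le (p := p) hC
  refine (hfd h.ν h2 (by nlinarith [Nat.cast_nonneg (α := ℝ) p])).trans ?_
  have h7 : (admissibleFactors p C).cν ^ p ≤ (admissibleFactors p C).cν :=
    pow_le_of_le_one h5.le (by linarith) (by omega)
  calc C * (Lbar p L * cond p L μ * (cond p L μ ^ 2 * h.ν) ^ p)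
      = C * (admissibleFactors p C).cν ^ p
        * (Lbar p L * cond p L μ * (cond p L μ ^ 2 * baseStep p L μ ε) ^ p) := by
        rw [hpc.ν_eq hε hR hC hh]; ring
    _ = C * (admissibleFactors p C).cν ^ p * ε := by
        rw [mul_baseStep_pow hp hpc.cond_pos hpc.Lbar_pos hε]
    _ ≤ C * (admissibleFactors p C).cν * ε := by gcongr
    _ ≤ 1 / 128 * ε := by gcongr
    _ ≤ ε / 32 := by linarith

variable (hσ : 0 < σ)
include hσ

/-- The assumption `ν₀² ε² ≤ κ σ²` is what makes the SGD step size stable. -/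
theorem ηy_mul_le (hνσ : baseStep p L μ ε ^ 2 * ε ^ 2 ≤ cond p L μ * σ ^ 2) :
    4 * h.ηy * L 1 ≤ 1 := by
  have h5 := (admissibleFactors_pos (p := p) hC).1
  have h6 := cν_le (p := p) hC
  have hκ := hpc.cond_pos
  have hL1 := hpc.L1_pos
  have hy0 := innerAccuracy_pos p
  have hy1 := innerAccuracy_le p
  have h1 : h.ηy = innerAccuracy p ^ 2 / 32
      * (h.ν ^ 2 * ε ^ 2 / (L 1 * cond p L μ * σ ^ 2)) := by rw [hh]; rfl
  have h2 : h.ν ^ 2 * ε ^ 2 ≤ cond p L μ * σ ^ 2 := by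
    rw [hpc.ν_eq hε hR hC hh, mul_pow, mul_assoc]
    refine le_trans (mul_le_of_le_one_left (by positivity) ?_) hνσ
    exact pow_le_one₀ h5.le (by linarith)
  have h3 : 4 * h.ηy * L 1 = innerAccuracy p ^ 2 / 8
      * (h.ν ^ 2 * ε ^ 2 / (cond p L μ * σ ^ 2)) := by
    rw [h1]; field_simp; ring
  rw [h3]
  refine mul_le_one₀ ?_ (by positivity) (by rw [div_le_one (by positivity)]; exact h2)
  nlinarith

omit hp in
theorem ηy_pos : 0 < h.ηy := by
  have h1 : h.ηy = innerAccuracy p ^ 2 / 32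
      * (h.ν ^ 2 * ε ^ 2 / (L 1 * cond p L μ * σ ^ 2)) := by rw [hh]; rfl
  have := hpc.cond_pos
  have := hpc.L1_pos
  have := innerAccuracy_pos p
  have := hpc.ν_pos hε hR hC hh
  rw [h1]
  positivity

-- The natural unit for inner errors is `ν ε / L_1`, since the estimator multiplies them by `L_1 /
-- ν`.
omit hp hεκ in
theorem noise_le : 8 * (h.ηy * σ ^ 2 / μ) ≤ innerAccuracy p ^ 2 / 4 * (h.ν * ε / L 1) ^ 2 := by
  have h1 : h.ηy = innerAccuracy p ^ 2 / 32
      * (h.ν ^ 2 * ε ^ 2 / (L 1 * cond p L μ * σ ^ 2)) := by rw [hh]; rfl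
  have hκ := hpc.cond_pos
  have hL1 := hpc.L1_pos
  have hμ := hpc.μ_pos
  have := innerAccuracy_pos p
  have h3 := hpc.ν_pos hε hR hC hh
  have h2 : 8 * (h.ηy * σ ^ 2 / μ)
      = innerAccuracy p ^ 2 / 4 * (h.ν ^ 2 * ε ^ 2 / (L 1 * (cond p L μ * μ))) := by
    rw [h1]; field_simp; norm_num
  rw [h2, div_pow, mul_pow, sq (L 1)]
  gcongr
  rw [← hpc.Lbar_eq]
  exact le_Lbar (by omega)

/-- The fourth power is needed in `inner_error_bound_le`: two factors bring `R` down to `ν ε / L_1`,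
the other two give the relative accuracy. -/
theorem contraction_le (hηL : 4 * h.ηy * L 1 ≤ 1) :
    (1 - h.ηy * (μ / 2)) ^ h.K ≤ (h.ν * ε / (R * L 1 * cond p L μ)) ^ 4 := by
  have hκ := hpc.cond_pos
  have hL1 := hpc.L1_pos
  have hμ := hpc.μ_pos
  have hθ := innerAccuracy_pos p
  have hν := hpc.ν_pos hε hR hC hh
  have hηy := hpc.ηy_pos hε hεκ hR hC hh hσ
  have hR0 : 0 < R := lt_of_lt_of_le (mul_pos hκ (baseStep_pos hκ hpc.Lbar_pos hε)) hR
  have h1 : h.ηy = innerAccuracy p ^ 2 / 32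
      * (h.ν ^ 2 * ε ^ 2 / (L 1 * cond p L μ * σ ^ 2)) := by rw [hh]; rfl
  have hlog : 1 / 2 ≤ Real.log (R * L 1 * cond p L μ / (h.ν * ε)) := by
    rw [hpc.ν_eq hε hR hC hh]
    exact hpc.half_le_log hε hεκ (admissibleFactors_pos hC).1
      ((cν_le hC).trans (by norm_num)) hR
  have hK : 8 / (innerAccuracy p ^ 2 / 32) * (cond p L μ ^ 2 * σ ^ 2 / (h.ν ^ 2 * ε ^ 2)
      * Real.log (R * L 1 * cond p L μ / (h.ν * ε))) ≤ h.K := by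
    rw [hh]; exact Nat.le_ceil _
  have hLκ : L 1 ≤ cond p L μ * μ := by
    rw [← hpc.Lbar_eq]; exact le_Lbar (by omega)
  refine one_sub_pow_le_pow ?_ (by positivity) ?_
  · have := hpc.μ_le
    nlinarith
  · rw [one_div_div]
    set ℓ := Real.log (R * L 1 * cond p L μ / (h.ν * ε))
    push_cast
    calc 4 * ℓ ≤ 4 * ℓ * (cond p L μ * μ / L 1) :=
          le_mul_of_one_le_right (by linarith) (by rw [le_div_iff₀ hL1]; linarith)
      _ = h.ηy * (μ / 2) * (8 / (innerAccuracy p ^ 2 / 32)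
          * (cond p L μ ^ 2 * σ ^ 2 / (h.ν ^ 2 * ε ^ 2) * ℓ)) := by
        rw [h1]; field_simp; norm_num
      _ ≤ _ := by gcongr

omit hσ in
theorem contractionBase_le :
    h.ν * ε / (R * L 1 * cond p L μ) ≤ (admissibleFactors p C).cν := by
  have hκ := hpc.cond_pos
  have hL1 := hpc.L1_pos
  have hc := (admissibleFactors_pos (p := p) hC).1
  have hν0 := baseStep_pos hκ hpc.Lbar_pos hε
  have hR0 : 0 < R := lt_of_lt_of_le (mul_pos hκ hν0) hR
  have h1 := hpc.one_div_le_logArg hε hεκ hc hR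
  rw [← hpc.ν_eq hε hR hC hh] at h1
  have hν := hpc.ν_pos hε hR hC hh
  rw [div_le_div_iff₀ hc (by positivity)] at h1
  rw [div_le_iff₀ (by positivity)]
  linarith

omit hσ in
theorem ηx_mul_le : 4 * (L 1 / μ) * h.ηx ≤ R := by
  have hκ := hpc.cond_pos
  have hL1 := hpc.L1_pos
  have hμ := hpc.μ_pos
  have hΛ := hpc.Lbar_pos
  have h1 : h.ηx = 1 / 80 * (ε / (L 1 * cond p L μ ^ 3)) := by rw [hh]; rfl
  have h2 := le_mul_baseStep hp hκ hΛ hε hεκ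
  have h3 : 4 * (L 1 / μ) * h.ηx = 1 / 20 * (ε / (Lbar p L * cond p L μ ^ 2)) := by
    rw [h1, hpc.Lbar_eq]; field_simp; norm_num
  have h4 : ε / (Lbar p L * cond p L μ ^ 2) ≤ cond p L μ * baseStep p L μ ε := by
    rw [div_le_iff₀ (by positivity)]; linarith
  have h5 : 0 ≤ ε / (Lbar p L * cond p L μ ^ 2) := by positivity
  rw [h3]
  linarith

/-- The mean squared error of the inner loops. -/
theorem inner_error_bound_le :
    (h.ν * ε / (R * L 1 * cond p L μ)) ^ 4
        * (8 * (R ^ 2 + innerAccuracy p ^ 2 / 4 * (h.ν * ε / L 1) ^ 2))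
        + innerAccuracy p ^ 2 / 4 * (h.ν * ε / L 1) ^ 2
      ≤ (innerAccuracy p * (h.ν * ε / L 1)) ^ 2 := by
  have hκ := hpc.cond_pos
  have hL1 := hpc.L1_pos
  have hκ1 := hpc.one_le_cond
  have hν0 := baseStep_pos hκ hpc.Lbar_pos hε
  have hR0 : 0 < R := lt_of_lt_of_le (mul_pos hκ hν0) hR
  have hν := hpc.ν_pos hε hR hC hh
  have h1 := hpc.contractionBase_le hp hε hεκ hR hC hh
  have h2 := h1.trans (cν_le_innerAccuracy hC)
  have h2' := h1.trans (cν_le hC)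
  have h3 : h.ν * ε / (R * L 1 * cond p L μ) * R ≤ h.ν * ε / L 1 := by
    have : h.ν * ε / (R * L 1 * cond p L μ) * R = h.ν * ε / L 1 / cond p L μ := by field_simp
    rw [this]
    exact div_le_self (by positivity) hκ1
  set r := h.ν * ε / (R * L 1 * cond p L μ)
  set b := h.ν * ε / L 1
  set θ := innerAccuracy p
  have hr0 : 0 < r := by positivity
  have hb0 : 0 < b := by positivity
  have h4 : (r * R) ^ 2 ≤ b ^ 2 := pow_le_pow_left₀ (by positivity) h3 2
  have h5 : r ^ 2 ≤ (θ / 4) ^ 2 := pow_le_pow_left₀ hr0.le h2 2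
  have h6 : r ^ 4 ≤ 1 / 8 := by
    calc r ^ 4 ≤ (1 / 128) ^ 4 := pow_le_pow_left₀ hr0.le h2' 4
      _ ≤ 1 / 8 := by norm_num
  -- The three terms are at most `θ²/2`, `θ²/4` and `θ²/4` times `b²`.
  calc r ^ 4 * (8 * (R ^ 2 + θ ^ 2 / 4 * b ^ 2)) + θ ^ 2 / 4 * b ^ 2
      = 8 * (r ^ 2 * (r * R) ^ 2) + 8 * (r ^ 4 * (θ ^ 2 / 4 * b ^ 2)) + θ ^ 2 / 4 * b ^ 2 := by ring
    _ ≤ 8 * ((θ / 4) ^ 2 * b ^ 2) + 8 * (1 / 8 * (θ ^ 2 / 4 * b ^ 2)) + θ ^ 2 / 4 * b ^ 2 := by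
        gcongr
    _ = (θ * b) ^ 2 := by ring

omit hp hεκ in
theorem S_pos : 0 < h.S := by
  have := hpc.ν_pos hε hR hC hh
  have h1 : h.S = ⌈(admissibleFactors p C).cS * (σ ^ 2 / (h.ν ^ 2 * ε ^ 2))⌉₊ := by rw [hh]; rfl
  have h2 := (admissibleFactors_pos (p := p) hC).2.2.2.1
  rw [h1, Nat.ceil_pos]
  positivity

omit hp hεκ in
theorem batch_noise_le :
    1 / (2 * (ε / 32)) * (fdVariance p * (σ ^ 2 / h.ν ^ 2) / h.S) + ε / 32 / 2 ≤ ε / 32 := by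
  have hν := hpc.ν_pos hε hR hC hh
  have hV := fdVariance_nonneg p
  have h1 : (1024 * fdVariance p + 1) * (σ ^ 2 / (h.ν ^ 2 * ε ^ 2)) ≤ h.S := by
    rw [hh]; exact Nat.le_ceil _
  have hS : (0 : ℝ) < h.S := by exact_mod_cast hpc.S_pos hε hR hC hh hσ
  have h2 : fdVariance p * (σ ^ 2 / h.ν ^ 2) / h.S ≤ ε ^ 2 / 1024 := by
    rw [div_le_iff₀ hS]
    calc fdVariance p * (σ ^ 2 / h.ν ^ 2)
        = ε ^ 2 / 1024 * (1024 * fdVariance p * (σ ^ 2 / (h.ν ^ 2 * ε ^ 2))) := by field_simp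
      _ ≤ ε ^ 2 / 1024 * ((1024 * fdVariance p + 1) * (σ ^ 2 / (h.ν ^ 2 * ε ^ 2))) := by
        gcongr; linarith
      _ ≤ _ := by gcongr
  calc _ ≤ 1 / (2 * (ε / 32)) * (ε ^ 2 / 1024) + ε / 32 / 2 := by gcongr
    _ = ε / 32 := by field_simp; norm_num

/-- The linearization level equals the root of the error bound, so each bracket is at most that
level; `L_1 / ν` cancels its unit and `innerAccuracy` absorbs the amplification. -/
theorem bias_le {E : ℝ} (hE : E ≤ (innerAccuracy p * (h.ν * ε / L 1)) ^ 2) :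
    ∑ j ∈ nodes p, |fdCoeff p j| * ((p + 1) * (L 1 / h.ν))
        * (1 / (2 * (innerAccuracy p * (h.ν * ε / L 1))) * E
          + innerAccuracy p * (h.ν * ε / L 1) / 2) ≤ ε / 32 := by
  have hν := hpc.ν_pos hε hR hC hh
  have hL1 := hpc.L1_pos
  have hθ := innerAccuracy_pos p
  have hA := fdAmplification_mul_innerAccuracy_le p
  set a := innerAccuracy p * (h.ν * ε / L 1) with ha
  have ha0 : 0 < a := by positivity
  have h1 : 1 / (2 * a) * E + a / 2 ≤ a := by
    calc _ ≤ 1 / (2 * a) * a ^ 2 + a / 2 := by gcongr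
      _ = a := by field_simp; norm_num
  calc _ ≤ ∑ j ∈ nodes p, |fdCoeff p j| * ((p + 1) * (L 1 / h.ν)) * a := by gcongr
    _ = fdAmplification p * innerAccuracy p * ε := by
        rw [← Finset.sum_mul, ← Finset.sum_mul, fdAmplification, ha]
        field_simp
    _ ≤ 1 / 32 * ε := by gcongr
    _ = ε / 32 := by ring

/-- Stationarity of the average iterate under the prescribed hyper-parameters. -/
theorem average_norm_gradient_le (hνσ : baseStep p L μ ε ^ 2 * ε ^ 2 ≤ cond p L μ * σ ^ 2)
    (hy : ‖y₀ - lowerSol g x₀‖ ≤ R) (hs : ∀ i, Measurable (s i)) (hD : ∀ i, P.map (s i) = D)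
    (hind : iIndepFun s P) (hF : IsGradEstimator D σ f F) (hG : IsGradEstimator D σ g G)
    (hfd : ∀ (x : Vec dx) (ν : ℝ), 0 < ν → p * (cond p L μ ^ 2 * ν) ≤ 1 / 4 →
      ‖hyperGradMean f g p ν x (fun j => tiltSol f g (j * ν) x) - hyperGrad f g x‖
        ≤ C * (Lbar p L * cond p L μ * (cond p L μ ^ 2 * ν) ^ p)) :
    (∀ t, Integrable (fun ω => ‖hyperGrad f g (run F G p h x₀ y₀ (fun i => s i ω) t).x‖) P) ∧
    1 / (h.T : ℝ) * ∑ t ∈ Finset.range h.T,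
        ∫ ω, ‖hyperGrad f g (run F G p h x₀ y₀ (fun i => s i ω) t).x‖ ∂P ≤ ε := by
  have hκ := hpc.cond_pos
  have hL1 := hpc.L1_pos
  have hΔ := hpc.Δ_pos
  have hν := hpc.ν_pos hε hR hC hh
  have hθ := innerAccuracy_pos p
  have hν1 : h.ν ≤ 1 := (hpc.ν_le hp hε hεκ hR hC hh).trans ((cν_le hC).trans (by norm_num))
  have hlam := fun j hj => hpc.abs_mul_ν_mul_le hp hε hεκ hR hC hh (j := j) hj
  have hηL := hpc.ηy_mul_le hp hε hεκ hR hC hh hσ hνσ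
  have hηx : h.ηx = 1 / 80 * (ε / (L 1 * cond p L μ ^ 3)) := by rw [hh]; rfl
  have hηx0 : 0 < h.ηx := by rw [hηx]; positivity
  have hT : 4 * (Δ / (h.ηx * ε)) ≤ h.T := by rw [hh]; exact Nat.le_ceil _
  have hT0 : (0 : ℝ) < h.T := lt_of_lt_of_le (by positivity) hT
  have hR0 : 0 < R := lt_of_lt_of_le (mul_pos hκ (baseStep_pos hκ hpc.Lbar_pos hε)) hR
  have hq8 : (h.ν * ε / (R * L 1 * cond p L μ)) ^ 4 ≤ 1 / 8 := by
    calc _ ≤ (1 / 128 : ℝ) ^ 4 := pow_le_pow_left₀ (by positivity)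
          ((hpc.contractionBase_le hp hε hεκ hR hC hh).trans (cν_le hC)) 4
      _ ≤ 1 / 8 := by norm_num
  have hE := fun t j hj => (lintegral_inner_error_le hs hD hind hpc hF hG h y₀ hlam
    (hpc.ηy_pos hε hεκ hR hC hh hσ) hηL (hpc.contraction_le hp hε hεκ hR hC hh hσ hηL) hq8
    (hpc.noise_le hε hR hC hh hσ) hηx0.le (hpc.ηx_mul_le hp hε hεκ hR hC hh)
    (fun j hj => hpc.norm_init_sub_tiltSol_le hp hε hεκ hR hC hh hy hj) (j := j) hj t).2
  have hb := hpc.bias_le hp hε hεκ hR hC hh hσ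
    (hpc.inner_error_bound_le hp hε hεκ hR hC hh hσ)
  have hn := hpc.batch_noise_le hε hR hC hh hσ
  have he := fun t => (lintegral_hyperGradEst_error_le hs hD hind hpc hF hG h y₀ hp hν hν1
    (hpc.S_pos hε hR hC hh hσ) hlam (t := t) (a := ε / 32)
    (a' := innerAccuracy p * (h.ν * ε / L 1)) (e := ε / 32) (by positivity) (by positivity)
    (by positivity) (hE t) (fun x => hpc.fd_error_le hp hε hεκ hR hC hh x (hfd x))).trans
    (ENNReal.ofReal_le_ofReal (add_le_add hn (add_le_add_left hb _)))
  obtain ⟨hint, hav⟩ := average_norm_hyperGrad_le hs hpc hF hG h y₀ hp hηx0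
    (by exact_mod_cast hT0) he (by positivity)
  -- The budget: `ε/4` for the initial gap, `ε/4` for smoothness, and `2 · 3ε/32` for the three
  -- errors of the estimate.
  refine ⟨hint, hav.trans ?_⟩
  have h1 : Δ / (h.ηx * h.T) ≤ ε / 4 := by
    rw [div_le_iff₀ (by positivity)]
    calc Δ = ε / 4 * (h.ηx * (4 * (Δ / (h.ηx * ε)))) := by field_simp
      _ ≤ _ := by gcongr
  have h2 : 20 * (L 1 * cond p L μ ^ 3) * h.ηx = ε / 4 := by
    rw [hηx]; field_simp; norm_num
  rw [h2]
  linarith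

end

end ProblemClass

end Bilevel

end

theorem theorem1 (p : ℕ) (hp : 1 ≤ p) :
    ∃ (c : Bilevel.Factors) (C : ℝ), c.Pos ∧ 0 < C ∧
      ∀ (dx dy : ℕ) (L : ℕ → ℝ) (μ Δ σ R ε : ℝ)
        (f g : Bilevel.Vec dx → Bilevel.Vec dy → ℝ)
        (x₀ : Bilevel.Vec dx) (y₀ : Bilevel.Vec dy),
        Bilevel.ProblemClass p L μ Δ f g x₀ →
      ∀ (𝒮 : Type*) [MeasurableSpace 𝒮] (D : MeasureTheory.Measure 𝒮)
        [MeasureTheory.IsProbabilityMeasure D]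
        (F G : Bilevel.Vec dx → Bilevel.Vec dy → 𝒮 → Bilevel.Joint dx dy),
        0 < σ → Bilevel.IsGradEstimator D σ f F → Bilevel.IsGradEstimator D σ g G →
      ∀ (Ω : Type*) [MeasurableSpace Ω] (P : MeasureTheory.Measure Ω)
        [MeasureTheory.IsProbabilityMeasure P] (s : Bilevel.SampleIdx → Ω → 𝒮),
        (∀ i, Measurable (s i)) → (∀ i, P.map (s i) = D) → ProbabilityTheory.iIndepFun s P →
        -- the regime of the parameters
        0 < ε → ε ≤ Bilevel.Lbar p L * Bilevel.cond p L μ →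
        ‖y₀ - Bilevel.lowerSol g x₀‖ ≤ R →
        Bilevel.cond p L μ * Bilevel.baseStep p L μ ε ≤ R →
        Bilevel.baseStep p L μ ε ^ 2 * ε ^ 2 ≤ Bilevel.cond p L μ * σ ^ 2 →
      let h := c.params p L μ Δ σ R ε
      let st : ℕ → Ω → Bilevel.State dx dy :=
        fun t ω => Bilevel.run F G p h x₀ y₀ (fun i => s i ω) t
      -- a uniformly random iterate is an `ε`-stationary point, in expectation
      Differentiable ℝ (Bilevel.hyperObj f g) ∧
      (∀ t < h.T, MeasureTheory.Integrable
        (fun ω => ‖gradient (Bilevel.hyperObj f g) (st t ω).x‖) P) ∧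
      1 / (h.T : ℝ) * ∑ t ∈ Finset.range h.T,
        ∫ ω, ‖gradient (Bilevel.hyperObj f g) (st t ω).x‖ ∂P ≤ ε ∧
      -- the number of oracle calls
      (∀ ω, (st h.T ω).calls ≤ 4 * (p * h.T * (h.S + h.K))) ∧
      (ε ^ 2 ≤ Δ * L 1 * Bilevel.cond p L μ ^ 3 →
        (p : ℝ) * h.T * (h.S + h.K) ≤ C * (Bilevel.rate p L μ Δ σ ε *
          Real.log (R * L 1 * Bilevel.cond p L μ / (h.ν * ε)))) ∧
      (ε ^ 2 ≤ Δ * L 1 * Bilevel.cond p L μ ^ 3 →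
        ε ≤ 1 / 2 → ε ≤ R * L 1 → ε ≤ (R * L 1 * Bilevel.Lbar p L) ^ 2 →
        (p : ℝ) * h.T * (h.S + h.K) ≤ C * (Bilevel.rate p L μ Δ σ ε *
          Real.log (R * L 1 * Bilevel.Lbar p L * Bilevel.cond p L μ / ε))) := by
  obtain ⟨C, hC, hfd⟩ := Bilevel.ProblemClass.exists_norm_fd_sub_hyperGrad_le hp
  have hc := Bilevel.admissibleFactors_pos (p := p) hC
  have hc2 : (Bilevel.admissibleFactors p C).cν ≤ 1 / 2 :=
    (Bilevel.cν_le hC).trans (by norm_num)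
  have hcost : 0 < (Bilevel.admissibleFactors p C).cost := by
    obtain ⟨h1, h2, h3, h4, h5, h6⟩ := hc
    rw [Bilevel.Factors.cost]
    positivity
  have hlog : 0 ≤ Real.log (1 / (Bilevel.admissibleFactors p C).cν) :=
    Real.log_nonneg (by rw [le_div_iff₀ hc.1]; linarith)
  -- One constant for both complexity bounds: the second factor is what `log_le` costs, and it is at
  -- least 1.
  refine ⟨Bilevel.admissibleFactors p C, (Bilevel.admissibleFactors p C).cost
    * (6 + 4 * Real.log (1 / (Bilevel.admissibleFactors p C).cν)), hc, by positivity, ?_⟩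
  intro dx dy L μ Δ σ R ε f g x₀ y₀ hpc 𝒮 _ D _ F G hσ hF hG Ω _ P _ s hs hD hind hε hεκ hy hR hνσ
    h st
  have hh : h = (Bilevel.admissibleFactors p C).params p L μ Δ σ R ε := rfl
  have hgrad := hpc.gradient_hyperObj
  have main := hpc.average_norm_gradient_le hp hε hεκ hR hC hh hσ hνσ hy hs hD hind hF hG
    (fun x ν => hfd hpc x ν)
  have hℓ := hpc.half_le_log hε hεκ hc.1 hc2 hR
  have hrate : 0 ≤ Bilevel.rate p L μ Δ σ ε := by
    have := hpc.L1_pos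
    have := hpc.Δ_pos
    have := hpc.Lbar_pos
    have := hpc.cond_pos
    rw [Bilevel.rate]
    positivity
  refine ⟨fun x => (hpc.hasGradientAt_hyperObj x).differentiableAt, fun t _ => ?_, ?_,
    fun ω => Bilevel.run_calls_le F G hp h x₀ y₀ _ h.T, fun hΔ => ?_, fun hΔ hε2 _ hεRL => ?_⟩
  · simp only [hgrad]
    exact main.1 t
  · simp only [hgrad]
    exact main.2
  · refine (hpc.cost_le hp hε hεκ hc hc2 hσ hR hνσ hΔ).trans ?_
    rw [mul_assoc (Bilevel.Factors.cost _)]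
    refine mul_le_mul_of_nonneg_left ?_ hcost.le
    refine le_mul_of_one_le_left (mul_nonneg hrate ?_) (by linarith)
    rw [Bilevel.params_ν hpc.cond_pos hR]
    linarith
  · refine (hpc.cost_le hp hε hεκ hc hc2 hσ hR hνσ hΔ).trans ?_
    rw [mul_assoc (Bilevel.Factors.cost _), Bilevel.params_ν hpc.cond_pos hR]
    refine mul_le_mul_of_nonneg_left ?_ hcost.le
    rw [mul_left_comm]
    exact mul_le_mul_of_nonneg_left (hpc.log_le hp hε hεκ hc.1 hc2 hR hε2 hεRL) hrate
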